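/- Let $\Sigma=\{0<1<\dots<\sigma-1\}$ be a finite ordered alphabet and order $\Sigma^*$ co-lexicographically ($\alpha\prec\beta$ iff the reverse of $\alpha$ is lexicographically smaller than the reverse of $\beta$). All automata have one initial state; a DFA has at most one transition per state and letter; an automaton is basic if every state is reachable from the initial state and reaches a final state. A Wheeler automaton is a finite automaton with a linear order $<$ on its states such that the initial state is the minimum and has no incoming edges, and for all edges $u_1\xrightarrow{a_1}v_1$, $u_2\xrightarrow{a_2}v_2$: $a_1\prec a_2$ implies $v_1<v_2$, and $a_1=a_2$, $u_1<u_2$ imply $v_1\le v_2$. A WDFA is a deterministic Wheeler automaton. A language is Wheeler if some (possibly nondeterministic) Wheeler automaton accepts it. For a language $\mathcal L$ let $\mathrm{Pref}(\mathcal L)$ be the set of prefixes of its words, let $\alpha\equiv_{\mathcal L}\beta$ mean $\{\gamma:\alpha\gamma\in\mathcal L\}=\{\gamma:\beta\gamma\in\mathcal L\}$, and for $\alpha,\beta\in\mathrm{Pref}(\mathcal L)$ let $\alpha\equiv^c_{\mathcal L}\beta$ mean that $\alpha\equiv_{\mathcal L}\beta$, that $\alpha,\beta$ end with the same character (the empty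 word only with itself), and that every $\gamma\in\mathrm{Pref}(\mathcal L)$ with $\min(\alpha,\beta)\preceq\gamma\preceq\max(\alpha,\beta)$ satisfies $\alpha\equiv_{\mathcal L}\gamma\equiv_{\mathcal L}\beta$. Let $\mathcal A$ be the (basic) minimum DFA of a Wheeler language $\mathcal L$ over $\Sigma$, with $n$ states, let $d=n+n^2$, and let $\alpha_1\prec\dots\prec\alpha_k$ be the words of $\mathrm{Pref}(\mathcal L)$ of length at most $d$. 1. Call $i$ a boundary if $i=k$, or $\alpha_i\not\equiv_{\mathcal L}\alpha_{i+1}$, or $\alpha_i,\alpha_{i+1}$ do not end with the same character. Every $\equiv^c_{\mathcal L}$-class contains $\alpha_i$ for exactly one boundary $i$. 2. There is one random access machine program that, for every such $\mathcal L$, given $\mathcal A$ (as a transition table) and the sorted list $\alpha_1,\dots,\alpha_k$ (as an array of strings), outputs the minimum WDFA of $\mathcal L$ (basic, with the smallest number of states among the WDFAs accepting $\mathcal L$, its states listed in Wheeler order) in time $O(k+n^2\cdot\sigma\cdot m\log m)$, where $m$ is the number of states of the output. The constant is absolute, and the machine words have $O(\log N)$ bits, where $N$ is the length of the input. 3. Consequently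 there is one program that computes the minimum WDFA of $\mathcal L$ from $\mathcal A$ alone in exponential time $(\sigma+2)^{O(n^2)}$ (with machine words of $O(n^2\log(\sigma+2))$ bits). 4. Exponential time is optimal, since the output can be exponentially large: over some fixed alphabet there are, for every $r\in\mathbb N$, a Wheeler language whose minimum DFA has $O(r+1)$ states and whose minimum WDFA has at least $2^r$ states. -/

import Mathlib

namespace WheelerDFA

/-! ### Words, languages, co-lexicographic order -/

section Words

variable {S : Type} [LinearOrder S]

/-- Strict co-lexicographic order: the reversed words are compared lexicographically. -/
def ColexLT (u v : List S) : Prop := List.Lex (· < ·) u.reverse v.reverse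

/-- Non-strict co-lexicographic order. -/
def ColexLE (u v : List S) : Prop := ColexLT u v ∨ u = v

/-- The set of prefixes of words of `L`. -/
def prefixes (L : Language S) : Set (List S) := {u | ∃ v, u ++ v ∈ L}

/-- The prefixes of words of `L` of length at most `d`. -/
def prefixesUpTo (L : Language S) (d : ℕ) : Set (List S) :=
  {u | u ∈ prefixes L ∧ u.length ≤ d}

/-- Myhill-Nerode equivalence: equal right contexts. -/
def NerodeEquiv (L : Language S) (u v : List S) : Prop :=
  L.leftQuotient u = L.leftQuotient v

/-- The input consistent, convex refinement of the Myhill-Nerode equivalence (used on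
`prefixes L`).  `getLast?` is the last character, and `none` for the empty word. -/
def ConvexEquiv (L : Language S) (u v : List S) : Prop :=
  NerodeEquiv L u v ∧ u.getLast? = v.getLast? ∧
    ∀ w ∈ prefixes L, ((ColexLE u w ∧ ColexLE w v) ∨ (ColexLE v w ∧ ColexLE w u)) →
      NerodeEquiv L u w ∧ NerodeEquiv L w v

/-- `w 0, …, w (k - 1)` are the prefixes of `L` of length at most `d`, in strictly increasing
co-lexicographic order. -/
def IsSortedList (L : Language S) (d : ℕ) {k : ℕ} (w : Fin k → List S) : Prop :=
  (∀ i j, i < j → ColexLT (w i) (w j)) ∧ Set.range w = prefixesUpTo L d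

/-- Position `i` of the list is a boundary: it is the last one, or the next word is not
Myhill-Nerode equivalent to `w i`, or the next word ends with a different character. -/
def IsBoundary (L : Language S) {k : ℕ} (w : Fin k → List S) (i : Fin k) : Prop :=
  ∀ j : Fin k, (j : ℕ) = i + 1 →
    ¬ NerodeEquiv L (w i) (w j) ∨ (w i).getLast? ≠ (w j).getLast?

end Words

/-! ### Automata -/

/-- Every state is reachable from a start state and reaches an accepting state. -/
def IsBasic {S Q : Type} (M : NFA S Q) : Prop :=
  ∀ q, (∃ u, q ∈ M.eval u) ∧ ∃ v, ∃ p ∈ M.accept, p ∈ M.evalFrom {q} v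

/-- `M`, with the given linear order on its states, is a Wheeler automaton. -/
def IsWheeler {S Q : Type} [LinearOrder S] [LinearOrder Q] (M : NFA S Q) : Prop :=
  ∃ q₀, M.start = {q₀} ∧ (∀ q, q₀ ≤ q) ∧ (∀ u a, q₀ ∉ M.step u a) ∧
    ∀ u₁ u₂ a₁ a₂ v₁ v₂, v₁ ∈ M.step u₁ a₁ → v₂ ∈ M.step u₂ a₂ →
      (a₁ < a₂ → v₁ < v₂) ∧ (a₁ = a₂ → u₁ < u₂ → v₁ ≤ v₂)

/-- A language is Wheeler if a Wheeler (nondeterministic, finite) automaton accepts it.  A finite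
linearly ordered set of states is, up to isomorphism, `Fin m`. -/
def IsWheelerLanguage {S : Type} [LinearOrder S] (L : Language S) : Prop :=
  ∃ (m : ℕ) (M : NFA S (Fin m)), IsWheeler M ∧ M.accepts = L

/-- A deterministic automaton with partial transition function. -/
structure PDFA (S Q : Type) where
  init : Q
  step : Q → S → Option Q
  accept : Q → Bool

/-- A partial DFA as an automaton all of whose transition sets have at most one element. -/
def PDFA.toNFA {S Q : Type} (A : PDFA S Q) : NFA S Q where
  step q a := {p | A.step q a = some p}
  start := {A.init}
  accept := {q | A.accept q = true}

/-- The language accepted by a partial DFA. -/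
def PDFA.lang {S Q : Type} (A : PDFA S Q) : Language S := A.toNFA.accepts

/-- `A` is the minimum DFA of the language it accepts: it is basic, and no DFA with the same
language has fewer states. -/
def IsMinDFA {S : Type} {n : ℕ} (A : PDFA S (Fin n)) : Prop :=
  IsBasic A.toNFA ∧ ∀ (n' : ℕ) (A' : PDFA S (Fin n')), A'.lang = A.lang → n ≤ n'

/-- `B` is the minimum Wheeler DFA of `L`: it is basic, Wheeler for the order of its states
`0 < ⋯ < m - 1`, accepts `L`, and no Wheeler DFA that accepts `L` has fewer states. -/
def IsMinWDFA {S : Type} [LinearOrder S] {m : ℕ} (B : PDFA S (Fin m)) (L : Language S) : Prop :=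
  IsBasic B.toNFA ∧ IsWheeler B.toNFA ∧ B.lang = L ∧
    ∀ (m' : ℕ) (B' : PDFA S (Fin m')), IsWheeler B'.toNFA → B'.lang = L → m ≤ m'

/-! ### A random access machine -/

/-- A configuration: the contents of the registers and of the memory cells. -/
structure RAMState where
  reg : ℕ → ℕ
  mem : ℕ → ℕ

/-- Right hand sides of assignments to a register; `x`, `y` are names of registers. -/
inductive Rhs where
  | const (c : ℕ)
  | add (x y : ℕ)
  | sub (x y : ℕ)
  | mul (x y : ℕ)
  | div (x y : ℕ)
  | load (x : ℕ)

/-- The value of a right hand side; subtraction is truncated, `load x` reads the memory cell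
whose address is in register `x`. -/
def Rhs.eval (s : RAMState) : Rhs → ℕ
  | const c => c
  | add x y => s.reg x + s.reg y
  | sub x y => s.reg x - s.reg y
  | mul x y => s.reg x * s.reg y
  | div x y => s.reg x / s.reg y
  | load x => s.mem (s.reg x)

/-- Tests on two registers. -/
inductive Test where
  | lt (x y : ℕ)
  | eq (x y : ℕ)

/-- A test succeeds. -/
def Test.Holds (s : RAMState) : Test → Prop
  | lt x y => s.reg x < s.reg y
  | eq x y => s.reg x = s.reg y

/-- Programs. A program is a finite text, so that it uses a fixed finite set of registers. -/
inductive Program where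
  | skip
  | assign (x : ℕ) (e : Rhs)
  /-- write the contents of register `y` into the memory cell whose address is in register `x` -/
  | store (x y : ℕ)
  | seq (p q : Program)
  | ite (b : Test) (p q : Program)
  | while (b : Test) (p : Program)

/-- `Exec W p s s' t`: on a machine whose words hold the numbers `0, …, W`, the program `p`
started in `s` halts in `s'` after exactly `t` elementary steps (assignments, stores, skips and
tests).  A program that tries to compute a number above `W` has no execution. -/
inductive Exec (W : ℕ) : Program → RAMState → RAMState → ℕ → Prop where
  | skip (s : RAMState) : Exec W .skip s s 1
  | assign (s : RAMState) (x : ℕ) (e : Rhs) (h : e.eval s ≤ W) :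
      Exec W (.assign x e) s ⟨Function.update s.reg x (e.eval s), s.mem⟩ 1
  | store (s : RAMState) (x y : ℕ) :
      Exec W (.store x y) s ⟨s.reg, Function.update s.mem (s.reg x) (s.reg y)⟩ 1
  | seq {p q : Program} {s s' s'' : RAMState} {t t' : ℕ}
      (h : Exec W p s s' t) (h' : Exec W q s' s'' t') : Exec W (.seq p q) s s'' (t + t')
  | ite_true {b : Test} {p q : Program} {s s' : RAMState} {t : ℕ}
      (hb : b.Holds s) (h : Exec W p s s' t) : Exec W (.ite b p q) s s' (1 + t)
  | ite_false {b : Test} {p q : Program} {s s' : RAMState} {t : ℕ}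
      (hb : ¬ b.Holds s) (h : Exec W q s s' t) : Exec W (.ite b p q) s s' (1 + t)
  | while_true {b : Test} {p : Program} {s s' s'' : RAMState} {t t' : ℕ}
      (hb : b.Holds s) (h : Exec W p s s' t) (h' : Exec W (.while b p) s' s'' t') :
      Exec W (.while b p) s s'' (1 + t + t')
  | while_false {b : Test} {p : Program} {s : RAMState}
      (hb : ¬ b.Holds s) : Exec W (.while b p) s s 1

/-- The initial configuration: the input stands in the first memory cells, all other cells and
all registers hold `0`. -/
def loadInput (x : List ℕ) : RAMState := ⟨fun _ => 0, fun i => x.getD i 0⟩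

/-- The output `x` stands in consecutive memory cells, the first address being in register `0`. -/
def HasOutput (s : RAMState) (x : List ℕ) : Prop :=
  ∀ i, ∀ h : i < x.length, s.mem (s.reg 0 + i) = x[i]

/-! ### Encodings -/

/-- A DFA as a list of numbers: number of states, number of letters, initial state, the
indicator of the accepting states, and the transition table row by row (the entry is `0` if there
is no transition, and `p + 1` if it leads to `p`). -/
def encodeDFA {σ n : ℕ} (A : PDFA (Fin σ) (Fin n)) : List ℕ :=
  [n, σ, A.init.val] ++ List.ofFn (fun q => (A.accept q).toNat) ++
    (List.ofFn fun q => List.ofFn fun c => ((A.step q c).map fun p => p.val + 1).getD 0).flatten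

/-- A list of `k` words as a list of numbers: `k`, then the `k + 1` offsets (the `i`-th one is the
total length of the first `i` words), then the characters of all the words, one after the other. -/
def encodeWords {σ k : ℕ} (w : Fin k → List (Fin σ)) : List ℕ :=
  [k] ++ ((List.range (k + 1)).map fun i => ((List.ofFn w).take i).flatten.length) ++
    (List.ofFn w).flatten.map Fin.val

end WheelerDFA

/-!
The proof rests on two facts about a Wheeler language `L` whose minimum DFA has `n` states.

*Every class of the convex equivalence contains a word shorter than `n + n ^ 2`*
(`exists_short_convexEquiv`).  In a Wheeler automaton the sets of states reached by
co-lexicographically increasing words increase, so that a monotone chain of prefixes of `L` cannot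
alternate between two Nerode classes forever (`IsWheelerLanguage.exists_nerodeEquiv`).  In a word of
length at least `n + n ^ 2` a state repeats within the first `n` letters, and the factor between the
two visits can be dropped.  This does not change the Nerode class, and a prefix of `L` between the
old and the new word has the same suffix of length `n ^ 2` as both of them.  On this suffix a pair
of states repeats, so that a factor `e` of it can be pumped for all the words involved at the same
time.  If the word in between had another Nerode class, pumping `e` would make it interleave
infinitely often with one of the two others, which is impossible (`nerodeEquiv_of_interleave`).
So the classes, which are convex, are intervals of the sorted list of the prefixes of length at most
`n + n ^ 2`, and their last words are the boundaries.

*The states of the minimum Wheeler DFA are the classes of the convex equivalence.*  Words which lead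
to the same state of any Wheeler DFA for `L` are convexly equivalent (`IsWheeler.convexEquiv`), and
conversely the classes, in co-lexicographic order, form a Wheeler DFA (`IsClassMap.isMinWDFA`).

To compute it, the words need not be kept.  Consider the prefixes of length at most `l` in their
order, and call a maximal block of consecutive ones with the same state and the same last letter a
run.  The list of the states of the runs determines the one for `l + 1` (`IsRunList.next`): for each
letter in turn, follow its transitions from the runs from left to right, and start a new run
whenever the state reached is not the one reached before.  There are never more runs than convex
classes, and from `l = n + n ^ 2 - 1` on they correspond to the classes (`IsRunList.stable`).  Hence
the table written by the last of `n + n ^ 2` sweeps is that of the minimum Wheeler DFA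
(`runAutomaton_isMinWDFA`).  If it has `m` states, each sweep takes time `O(σ m)`, and the whole
computation `O(n ^ 2 σ m)`, which suffices if `2 ≤ m`; for `m = 1` the language contains only the
empty word, and the input is its own output.  Since `m ≤ (σ + 1) ^ (n + n ^ 2)`, the same program
runs in exponential time without the list.

For the lower bound, consider the words `x u x` with a letter `x` of a binary alphabet and a word
`u` of length `r` (`sandwich`).  All words `0 u` are Nerode equivalent, but between any two of them
there is a word `1 u`, which is not equivalent to them, so that a Wheeler DFA needs `2 ^ r` states.
-/

namespace WheelerDFA

/-! ### The co-lexicographic order -/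

section Colex

variable {S : Type} [LinearOrder S]

theorem colexLT_iff {u v : List S} : ColexLT u v ↔ u.reverse < v.reverse := Iff.rfl

theorem colexLE_iff {u v : List S} : ColexLE u v ↔ u.reverse ≤ v.reverse := by
  rw [ColexLE, colexLT_iff, le_iff_lt_or_eq, List.reverse_inj]

theorem ColexLT.trans {u v w : List S} (h : ColexLT u v) (h' : ColexLT v w) : ColexLT u w :=
  lt_trans (colexLT_iff.1 h) (colexLT_iff.1 h')

theorem ColexLT.ne {u v : List S} (h : ColexLT u v) : u ≠ v := by
  rintro rfl
  exact lt_irrefl _ (colexLT_iff.1 h)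

theorem ColexLT.not_le {u v : List S} (h : ColexLT u v) : ¬ ColexLE v u := by
  rw [colexLE_iff]
  exact not_le_of_gt (colexLT_iff.1 h)

theorem ColexLT.le {u v : List S} (h : ColexLT u v) : ColexLE u v := Or.inl h

theorem ColexLE.refl (u : List S) : ColexLE u u := Or.inr rfl

theorem ColexLE.trans {u v w : List S} (h : ColexLE u v) (h' : ColexLE v w) : ColexLE u w := by
  rw [colexLE_iff] at *
  exact le_trans h h'

theorem colexLE_or_lt (u v : List S) : ColexLE u v ∨ ColexLT v u := by
  rw [colexLE_iff, colexLT_iff]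
  exact le_or_gt _ _

theorem colexLE_total (u v : List S) : ColexLE u v ∨ ColexLE v u :=
  (colexLE_or_lt u v).imp_right ColexLT.le

theorem ColexLE.antisymm {u v : List S} (h : ColexLE u v) (h' : ColexLE v u) : u = v := by
  rw [colexLE_iff] at *
  exact List.reverse_injective (le_antisymm h h')

theorem colexLT_concat_iff {u v : List S} {a b : S} :
    ColexLT (u ++ [a]) (v ++ [b]) ↔ a < b ∨ a = b ∧ ColexLT u v := by
  simp [ColexLT, List.cons_lt_cons_iff]

theorem colexLE_concat_iff {u v : List S} {a : S} :
    ColexLE (u ++ [a]) (v ++ [a]) ↔ ColexLE u v := by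
  simp [ColexLE, colexLT_concat_iff]

theorem not_colexLT_nil (u : List S) : ¬ ColexLT u [] := by
  simp [ColexLT]

theorem nil_colexLE (u : List S) : ColexLE [] u := by
  rcases colexLE_or_lt [] u with h | h
  · exact h
  · exact absurd h (not_colexLT_nil u)

theorem colexLT_append_right_iff {u v : List S} (x : List S) :
    ColexLT (u ++ x) (v ++ x) ↔ ColexLT u v := by
  induction x using List.reverseRecOn with
  | nil => simp
  | append_singleton x a ih =>
    rw [← List.append_assoc, ← List.append_assoc, colexLT_concat_iff]
    simp [ih]

/-- A word lies co-lexicographically below every proper left extension of itself. -/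
theorem colexLT_append_left (u : List S) {x : List S} (hx : x ≠ []) : ColexLT u (x ++ u) := by
  have h := colexLT_append_right_iff (u := []) (v := x) u
  rw [List.nil_append] at h
  rw [h]
  rcases nil_colexLE x with h | h
  · exact h
  · exact absurd h.symm hx

/-- Comparing `u` with a word ending in a longer word `e` only depends on `e`. -/
theorem colexLT_append_long_iff {u e : List S} (x : List S) (h : u.length < e.length) :
    ColexLT u (x ++ e) ↔ ColexLT u e := by
  induction u using List.reverseRecOn generalizing e with
  | nil =>
    have hpos : ∀ v : List S, v ≠ [] → ColexLT [] v := fun v hv => by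
      simpa using colexLT_append_left [] hv
    have he : e ≠ [] := by rintro rfl; simp at h
    exact iff_of_true (hpos _ (by simp [he])) (hpos _ he)
  | append_singleton u a ih =>
    rcases List.eq_nil_or_concat e with rfl | ⟨e, b, rfl⟩
    · simp at h
    · rw [List.concat_eq_append, ← List.append_assoc, colexLT_concat_iff, colexLT_concat_iff,
        ih (by simpa using h)]

theorem append_long_colexLT_iff {u e : List S} (x : List S) (h : u.length < e.length) :
    ColexLT (x ++ e) u ↔ ColexLT e u := by
  have h1 := colexLT_append_long_iff x h
  have key : ∀ v : List S, v.length > u.length → (ColexLT v u ↔ ¬ ColexLT u v) := fun v hv => by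
    constructor
    · exact fun h h' => (h.trans h').ne rfl
    · intro h'
      rcases colexLE_or_lt u v with h | h
      · rcases h with h | h
        · exact absurd h h'
        · simp [h] at hv
      · exact h
  rw [key _ h, key _ (by simp; omega), h1]

/-- Words between two words with the same suffix have this suffix. -/
theorem suffix_of_colex_between {x u v w : List S} (h₁ : ColexLE (u ++ x) w)
    (h₂ : ColexLE w (v ++ x)) : ∃ y, w = y ++ x ∧ ColexLE u y ∧ ColexLE y v := by
  induction x using List.reverseRecOn generalizing w with
  | nil => exact ⟨w, by simp, by simpa using h₁, by simpa using h₂⟩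
  | append_singleton x a ih =>
    rcases List.eq_nil_or_concat w with rfl | ⟨w, b, rfl⟩
    · rcases h₁ with h | h
      · exact absurd h (not_colexLT_nil _)
      · simp at h
    · rw [List.concat_eq_append, ← List.append_assoc] at *
      have hab : a = b := by
        apply le_antisymm
        · rcases h₁ with h | h
          · rcases colexLT_concat_iff.1 h with h | h
            exacts [h.le, h.1.le]
          · exact (List.append_inj_right' h rfl |> List.singleton_inj.1).le
        · rcases h₂ with h | h
          · rcases colexLT_concat_iff.1 h with h | h
            exacts [h.le, h.1.le]
          · exact (List.append_inj_right' h rfl |> List.singleton_inj.1).le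
      subst hab
      obtain ⟨y, rfl, hy⟩ := ih (colexLE_concat_iff.1 h₁) (colexLE_concat_iff.1 h₂)
      exact ⟨y, by simp, hy⟩

/-- Words between two words with the same last character have the same last character. -/
theorem getLast?_of_colex_between {u v w : List S} (h : u.getLast? = v.getLast?)
    (h₁ : ColexLE u w) (h₂ : ColexLE w v) : w.getLast? = u.getLast? := by
  rcases List.eq_nil_or_concat u with rfl | ⟨u, a, rfl⟩
  · have hv : v = [] := by simpa [eq_comm] using h
    subst hv
    rw [h₁.antisymm h₂]
  · rcases List.eq_nil_or_concat v with rfl | ⟨v, b, rfl⟩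
    · simp at h
    · obtain rfl : a = b := by simpa using h
      obtain ⟨y, rfl, -⟩ := suffix_of_colex_between (x := [a]) (by simpa using h₁) (by simpa using h₂)
      simp

end Colex

/-! ### Prefixes and the convex equivalence -/

section Classes

variable {S : Type} {L : Language S}

theorem mem_leftQuotient' {u v : List S} : v ∈ L.leftQuotient u ↔ u ++ v ∈ L := Iff.rfl

theorem NerodeEquiv.mem_prefixes_iff {u v : List S} (h : NerodeEquiv L u v) :
    u ∈ prefixes L ↔ v ∈ prefixes L :=
  exists_congr fun x => iff_of_eq (congrArg (fun M : Language S => x ∈ M) h)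

theorem NerodeEquiv.mem_iff {u v : List S} (h : NerodeEquiv L u v) : u ∈ L ↔ v ∈ L := by
  have h' : ([] : List S) ∈ L.leftQuotient u ↔ [] ∈ L.leftQuotient v :=
    iff_of_eq (congrArg (fun M : Language S => [] ∈ M) h)
  simpa [mem_leftQuotient'] using h'

theorem prefixes_of_append {u v : List S} (h : u ++ v ∈ prefixes L) : u ∈ prefixes L := by
  obtain ⟨x, hx⟩ := h
  exact ⟨v ++ x, by simpa using hx⟩

theorem mem_prefixes_of_mem {u : List S} (h : u ∈ L) : u ∈ prefixes L := ⟨[], by simpa using h⟩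

variable [LinearOrder S]

theorem ConvexEquiv.refl (u : List S) : ConvexEquiv L u u := by
  refine ⟨rfl, rfl, fun w _ h => ?_⟩
  have : u = w := by
    rcases h with h | h <;> exact h.1.antisymm h.2
  subst this
  exact ⟨rfl, rfl⟩

theorem ConvexEquiv.symm {u v : List S} (h : ConvexEquiv L u v) : ConvexEquiv L v u :=
  ⟨Eq.symm h.1, h.2.1.symm, fun w hw hb =>
    have := h.2.2 w hw hb.symm
    ⟨Eq.symm this.2, Eq.symm this.1⟩⟩

/-- The convex equivalence of `u` with a larger word. -/
theorem convexEquiv_of_le {u v : List S} (huv : ColexLE u v) (h : NerodeEquiv L u v)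
    (hl : u.getLast? = v.getLast?)
    (hb : ∀ w ∈ prefixes L, ColexLE u w → ColexLE w v → NerodeEquiv L u w) :
    ConvexEquiv L u v := by
  have key : ∀ w ∈ prefixes L, ((ColexLE u w ∧ ColexLE w v) ∨ (ColexLE v w ∧ ColexLE w u)) →
      NerodeEquiv L u w := by
    rintro w hw (⟨h1, h2⟩ | ⟨h1, h2⟩)
    · exact hb w hw h1 h2
    · have : w = u := h2.antisymm (huv.trans h1)
      rw [this]
      rfl
  exact ⟨h, hl, fun w hw hwb => ⟨key w hw hwb, Eq.trans (Eq.symm (key w hw hwb)) h⟩⟩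

theorem ConvexEquiv.nerode_of_between {u v w : List S} (h : ConvexEquiv L u v)
    (hw : w ∈ prefixes L) (h₁ : ColexLE u w) (h₂ : ColexLE w v) : NerodeEquiv L u w :=
  (h.2.2 w hw (Or.inl ⟨h₁, h₂⟩)).1

theorem ConvexEquiv.trans {u v w : List S} (h : ConvexEquiv L u v)
    (h' : ConvexEquiv L v w) : ConvexEquiv L u w := by
  have huw : NerodeEquiv L u w := Eq.trans h.1 h'.1
  have key : ∀ x ∈ prefixes L, ((ColexLE u x ∧ ColexLE x w) ∨ (ColexLE w x ∧ ColexLE x u)) →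
      NerodeEquiv L u x := by
    rintro x hx hb
    have : NerodeEquiv L u x ∨ NerodeEquiv L x w := by
      rcases hb with ⟨h1, h2⟩ | ⟨h1, h2⟩ <;> rcases colexLE_total x v with hv | hv
      · exact Or.inl (h.2.2 x hx (Or.inl ⟨h1, hv⟩)).1
      · exact Or.inr (h'.2.2 x hx (Or.inl ⟨hv, h2⟩)).2
      · exact Or.inr (h'.2.2 x hx (Or.inr ⟨h1, hv⟩)).2
      · exact Or.inl (h.2.2 x hx (Or.inr ⟨hv, h2⟩)).1
    rcases this with h | h
    · exact h
    · exact Eq.trans huw (Eq.symm h)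
  exact ⟨huw, h.2.1.trans h'.2.1, fun x hx hb => ⟨key x hx hb, Eq.trans (Eq.symm (key x hx hb)) huw⟩⟩

/-- Classes of the convex equivalence are convex. -/
theorem ConvexEquiv.of_between {u v w : List S} (h : ConvexEquiv L u v)
    (hw : w ∈ prefixes L) (h₁ : ColexLE u w) (h₂ : ColexLE w v) : ConvexEquiv L u w :=
  convexEquiv_of_le h₁ (h.nerode_of_between hw h₁ h₂) (getLast?_of_colex_between h.2.1 h₁ h₂).symm
    fun _ hx hx₁ hx₂ => h.nerode_of_between hx hx₁ (hx₂.trans h₂)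

end Classes

/-! ### Runs of automata -/

section Runs

variable {S : Type} {L : Language S}

theorem NerodeEquiv.append {u v : List S} (h : NerodeEquiv L u v) (x : List S) :
    NerodeEquiv L (u ++ x) (v ++ x) := by
  rw [NerodeEquiv, Language.leftQuotient_append, Language.leftQuotient_append, h]

theorem mem_accepts_iff {Q : Type} {M : NFA S Q} {u : List S} :
    u ∈ M.accepts ↔ ∃ p ∈ M.accept, p ∈ M.eval u := Iff.rfl

theorem nerodeEquiv_of_eval_eq {Q : Type} {M : NFA S Q} {u v : List S} (h : M.eval u = M.eval v) :
    NerodeEquiv M.accepts u v := by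
  ext x
  have key : M.eval (u ++ x) = M.eval (v ++ x) := by
    change M.evalFrom M.start _ = M.evalFrom M.start _
    rw [NFA.evalFrom_append, NFA.evalFrom_append]
    exact congrArg (M.evalFrom · x) h
  rw [mem_leftQuotient', mem_leftQuotient', mem_accepts_iff, mem_accepts_iff, key]

theorem eval_nonempty_of_mem_prefixes {Q : Type} {M : NFA S Q} {u : List S}
    (h : u ∈ prefixes M.accepts) : (M.eval u).Nonempty := by
  obtain ⟨x, p, -, hp⟩ := h
  change p ∈ M.evalFrom M.start _ at hp
  rw [NFA.evalFrom_append] at hp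
  by_contra hne
  rw [Set.not_nonempty_iff_eq_empty] at hne
  change M.evalFrom M.start _ = _ at hne
  have hempty : ∀ y, M.evalFrom ∅ y = ∅ := fun y => by
    induction y with
    | nil => rfl
    | cons a y ih => rw [NFA.evalFrom_cons, NFA.stepSet_empty, ih]
  rw [hne, hempty] at hp
  exact hp

namespace PDFA

variable {Q : Type} (A : PDFA S Q)

/-- The state reached from `q` by reading a word, if there is one. -/
def runFrom (q : Q) : List S → Option Q
  | [] => some q
  | a :: u => (A.step q a).bind fun p => runFrom p u

/-- The state reached from the initial state by reading a word, if there is one. -/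
def run (u : List S) : Option Q := A.runFrom A.init u

/-- The word `u` leads from `q` to an accepting state. -/
def AcceptsFrom (q : Q) (u : List S) : Prop := ∃ p, A.runFrom q u = some p ∧ A.accept p = true

theorem runFrom_append (q : Q) (u v : List S) :
    A.runFrom q (u ++ v) = (A.runFrom q u).bind fun p => A.runFrom p v := by
  induction u generalizing q with
  | nil => rfl
  | cons a u ih =>
    simp only [List.cons_append, runFrom, Option.bind_assoc]
    congr 1
    funext p
    exact ih p

theorem run_append (u v : List S) : A.run (u ++ v) = (A.run u).bind fun p => A.runFrom p v :=
  A.runFrom_append _ _ _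

theorem run_concat (u : List S) (a : S) : A.run (u ++ [a]) = (A.run u).bind fun p => A.step p a := by
  rw [run_append]
  congr 1
  funext p
  simp [runFrom]

@[simp] theorem run_nil : A.run [] = some A.init := rfl

theorem evalFrom_toNFA (q : Q) (u : List S) : A.toNFA.evalFrom {q} u = {p | A.runFrom q u = some p} := by
  induction u using List.reverseRecOn with
  | nil => ext p; simp [runFrom, eq_comm]
  | append_singleton u a ih =>
    rw [NFA.evalFrom_append, ih, NFA.evalFrom_singleton]
    ext p
    simp only [NFA.mem_stepSet, Set.mem_ofPred_eq, runFrom_append, Option.bind_eq_some_iff]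
    refine exists_congr fun x => and_congr_right fun _ => ?_
    simp [toNFA, runFrom]

theorem mem_eval_toNFA {u : List S} {p : Q} : p ∈ A.toNFA.eval u ↔ A.run u = some p := by
  rw [NFA.eval]
  exact iff_of_eq (congrArg (p ∈ ·) (A.evalFrom_toNFA A.init u))

theorem mem_lang_iff {u : List S} : u ∈ A.lang ↔ A.AcceptsFrom A.init u := by
  rw [lang, mem_accepts_iff, AcceptsFrom]
  refine exists_congr fun p => ?_
  rw [mem_eval_toNFA, and_comm]
  rfl

theorem append_mem_lang_iff {u v : List S} {q : Q} (h : A.run u = some q) :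
    u ++ v ∈ A.lang ↔ A.AcceptsFrom q v := by
  rw [mem_lang_iff, AcceptsFrom, AcceptsFrom, runFrom_append]
  change (∃ p, (A.run u).bind _ = _ ∧ _) ↔ _
  rw [h]
  rfl

theorem exists_run_of_mem_prefixes {u : List S} (h : u ∈ prefixes A.lang) : ∃ q, A.run u = some q :=
  (eval_nonempty_of_mem_prefixes h).imp fun _ => A.mem_eval_toNFA.1

theorem nerodeEquiv_of_run_eq {u v : List S} (h : A.run u = A.run v) : NerodeEquiv A.lang u v := by
  apply nerodeEquiv_of_eval_eq
  ext p
  rw [mem_eval_toNFA, mem_eval_toNFA, h]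

variable {A}

theorem isBasic_toNFA_iff : IsBasic A.toNFA ↔
    ∀ q, (∃ u, A.run u = some q) ∧ ∃ v, A.AcceptsFrom q v := by
  refine forall_congr' fun q => and_congr (exists_congr fun u => A.mem_eval_toNFA)
    (exists_congr fun v => exists_congr fun p => ?_)
  rw [evalFrom_toNFA, and_comm]
  rfl

theorem mem_prefixes_of_run_eq_some (hA : IsBasic A.toNFA) {u : List S} {q : Q}
    (h : A.run u = some q) : u ∈ prefixes A.lang := by
  obtain ⟨v, hv⟩ := (isBasic_toNFA_iff.1 hA q).2
  exact ⟨v, (A.append_mem_lang_iff h).2 hv⟩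

/-- Transporting a DFA along a map `f` with a right inverse up to equality of right languages. -/
theorem exists_lang_eq_of_merge {Q' : Type} (f : Q → Q') (g : Q' → Q)
    (h : ∀ q v, A.AcceptsFrom (g (f q)) v ↔ A.AcceptsFrom q v) :
    ∃ A' : PDFA S Q', A'.lang = A.lang := by
  let A' : PDFA S Q' :=
    ⟨f A.init, fun x a => (A.step (g x) a).map f, fun x => A.accept (g x)⟩
  have key : ∀ v x, A'.AcceptsFrom x v ↔ A.AcceptsFrom (g x) v := by
    intro v
    induction v with
    | nil => intro x; simp [AcceptsFrom, runFrom, A']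
    | cons a v ih =>
      intro x
      have hx : A'.step x a = (A.step (g x) a).map f := rfl
      rcases hs : A.step (g x) a with _ | y
      · simp [AcceptsFrom, runFrom, hx, hs]
      · have h1 := (ih (f y)).trans (h y v)
        simpa [AcceptsFrom, runFrom, hx, hs] using h1
  refine ⟨A', ?_⟩
  ext v
  rw [mem_lang_iff, mem_lang_iff, key]
  exact h _ _

/-- Different states of a minimum DFA have different right languages. -/
theorem eq_of_acceptsFrom_iff {n : ℕ} {A : PDFA S (Fin n)} (hA : IsMinDFA A) {p q : Fin n}
    (h : ∀ v, A.AcceptsFrom p v ↔ A.AcceptsFrom q v) : p = q := by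
  by_contra hpq
  have e : {x : Fin n // x ≠ q} ≃ Fin (Fintype.card {x : Fin n // x ≠ q}) := Fintype.equivFin _
  obtain ⟨A', hA'⟩ := exists_lang_eq_of_merge (A := A)
    (fun x => e (if hx : x = q then ⟨p, hpq⟩ else ⟨x, hx⟩)) (fun y => (e.symm y).1) (by
      intro x v
      by_cases hx : x = q
      · subst hx; simp [h]
      · simp [hx])
  have h1 := hA.2 _ A' hA'
  have h2 : Fintype.card {x : Fin n // x ≠ q} < Fintype.card (Fin n) :=
    Fintype.card_subtype_lt (x := q) (by simp)
  rw [Fintype.card_fin] at h2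
  omega

theorem run_eq_of_nerodeEquiv {n : ℕ} {A : PDFA S (Fin n)} (hA : IsMinDFA A) {u v : List S}
    (hu : u ∈ prefixes A.lang) (h : NerodeEquiv A.lang u v) : A.run u = A.run v := by
  obtain ⟨p, hp⟩ := A.exists_run_of_mem_prefixes hu
  obtain ⟨q, hq⟩ := A.exists_run_of_mem_prefixes (h.mem_prefixes_iff.1 hu)
  rw [hp, hq]
  refine congrArg some (eq_of_acceptsFrom_iff hA fun x => ?_)
  rw [← A.append_mem_lang_iff hp, ← A.append_mem_lang_iff hq]
  exact iff_of_eq (congrArg (fun M : Language S => x ∈ M) h)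

/-- A basic DFA whose states have different right languages is the minimum DFA. -/
theorem isMinDFA_of_distinguishable {n : ℕ} {A : PDFA S (Fin n)} (hA : IsBasic A.toNFA)
    (h : ∀ p q, (∀ v, A.AcceptsFrom p v ↔ A.AcceptsFrom q v) → p = q) : IsMinDFA A := by
  refine ⟨hA, fun n' A' hA' => ?_⟩
  have hr : ∀ q, ∃ u, A.run u = some q := fun q => (isBasic_toNFA_iff.1 hA q).1
  choose u hu using hr
  have hs : ∀ q, ∃ p, A'.run (u q) = some p := fun q =>
    A'.exists_run_of_mem_prefixes (by rw [hA']; exact mem_prefixes_of_run_eq_some hA (hu q))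
  choose g hg using hs
  have hinj : Function.Injective g := by
    intro p q hpq
    apply h
    intro v
    rw [← A.append_mem_lang_iff (hu p), ← A.append_mem_lang_iff (hu q), ← hA',
      A'.append_mem_lang_iff (hg p), A'.append_mem_lang_iff (hg q), hpq]
  simpa using Fintype.card_le_of_injective g hinj

end PDFA

end Runs

/-! ### Wheeler automata -/

section Wheeler

variable {S : Type} [LinearOrder S] {L : Language S}

/-- The sets of states reached by co-lexicographically increasing words are increasing, up to
common elements. -/
theorem IsWheeler.le_or_mem {Q : Type} [LinearOrder Q] {M : NFA S Q} (hM : IsWheeler M)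
    {u v : List S} (huv : ColexLT u v) {p q : Q} (hp : p ∈ M.eval u) (hq : q ∈ M.eval v) :
    p ≤ q ∨ p ∈ M.eval v ∧ q ∈ M.eval u := by
  obtain ⟨q₀, hstart, hmin, -, hstep⟩ := hM
  induction u using List.reverseRecOn generalizing v p q with
  | nil =>
    rw [NFA.eval_nil, hstart, Set.mem_singleton_iff] at hp
    exact Or.inl (hp ▸ hmin q)
  | append_singleton u a ih =>
    rcases List.eq_nil_or_concat v with rfl | ⟨v, b, rfl⟩
    · exact absurd huv (not_colexLT_nil _)
    rw [List.concat_eq_append] at *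
    rw [NFA.eval_append_singleton, NFA.mem_stepSet] at hp hq
    obtain ⟨p', hp', hpp⟩ := hp
    obtain ⟨q', hq', hqq⟩ := hq
    rcases colexLT_concat_iff.1 huv with hab | ⟨rfl, huv'⟩
    · exact Or.inl ((hstep _ _ _ _ _ _ hpp hqq).1 hab).le
    · simp only [NFA.eval_append_singleton, NFA.mem_stepSet]
      rcases ih huv' hp' hq' with h | h
      · rcases h.lt_or_eq with h | rfl
        · exact Or.inl ((hstep _ _ _ _ _ _ hpp hqq).2 rfl h)
        · exact Or.inr ⟨⟨_, hq', hpp⟩, ⟨_, hp', hqq⟩⟩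
      · exact Or.inr ⟨⟨_, h.1, hpp⟩, ⟨_, h.2, hqq⟩⟩

/-- In a long increasing chain of words two consecutive words reach the same set of states: the
least and the greatest reached state are nondecreasing, and they determine the set. -/
theorem IsWheeler.exists_eval_eq {N : ℕ} {M : NFA S (Fin N)} (hM : IsWheeler M) (w : ℕ → List S)
    (hw : ∀ i < 2 * N, ColexLT (w i) (w (i + 1))) (hne : ∀ i ≤ 2 * N, (M.eval (w i)).Nonempty) :
    ∃ i < 2 * N, M.eval (w i) = M.eval (w (i + 1)) := by
  have hlo : ∀ i, ∃ a, i ≤ 2 * N → IsLeast (M.eval (w i)) a := fun i => by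
    by_cases hi : i ≤ 2 * N
    · obtain ⟨a, ha, h⟩ := Set.exists_min_image _ id (Set.toFinite _) (hne i hi)
      exact ⟨a, fun _ => ⟨ha, h⟩⟩
    · exact ⟨(hne 0 (by omega)).some, fun h => absurd h hi⟩
  have hhi : ∀ i, ∃ a, i ≤ 2 * N → IsGreatest (M.eval (w i)) a := fun i => by
    by_cases hi : i ≤ 2 * N
    · obtain ⟨a, ha, h⟩ := Set.exists_max_image _ id (Set.toFinite _) (hne i hi)
      exact ⟨a, fun _ => ⟨ha, h⟩⟩
    · exact ⟨(hne 0 (by omega)).some, fun h => absurd h hi⟩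
  choose lo hlo using hlo
  choose hi hhi using hhi
  by_contra hcon
  push Not at hcon
  -- unless the set of states stays the same, one of its two extremes grows
  have hgrow : ∀ i < 2 * N, (lo i : ℕ) + hi i < lo (i + 1) + hi (i + 1) := by
    intro i hi'
    have l1 := hlo i hi'.le
    have l2 := hlo (i + 1) hi'
    have g1 := hhi i hi'.le
    have g2 := hhi (i + 1) hi'
    have hl : lo i ≤ lo (i + 1) := by
      rcases hM.le_or_mem (hw i hi') l1.1 l2.1 with h | h
      exacts [h, l1.2 h.2]
    have hg : hi i ≤ hi (i + 1) := by
      rcases hM.le_or_mem (hw i hi') g1.1 g2.1 with h | h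
      exacts [h, g2.2 h.1]
    by_contra hlt
    have el : lo i = lo (i + 1) := by
      apply le_antisymm hl
      rw [Fin.le_def] at *
      omega
    have eg : hi i = hi (i + 1) := by
      apply le_antisymm hg
      rw [Fin.le_def] at *
      omega
    apply hcon i hi'
    ext p
    constructor
    · intro hp
      rcases hM.le_or_mem (hw i hi') hp l2.1 with h | h
      · rw [le_antisymm h (el ▸ l1.2 hp)]
        exact l2.1
      · exact h.1
    · intro hp
      rcases hM.le_or_mem (hw i hi') g1.1 hp with h | h
      · rw [le_antisymm (eg ▸ g2.2 hp) h]
        exact g1.1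
      · exact h.2
  have hle : ∀ i ≤ 2 * N, i ≤ (lo i : ℕ) + hi i := by
    intro i
    induction i with
    | zero => intro _; omega
    | succ i ih =>
      intro h
      have := ih (by omega)
      have := hgrow i (by omega)
      omega
  have := hle (2 * N) le_rfl
  have := (lo (2 * N)).isLt
  have := (hi (2 * N)).isLt
  omega

/-- Long monotone chains of prefixes of a Wheeler language contain consecutive equivalent words. -/
theorem IsWheelerLanguage.exists_nerodeEquiv (hL : IsWheelerLanguage L) :
    ∃ K : ℕ, ∀ w : ℕ → List S, (∀ i, w i ∈ prefixes L) →
      ((∀ i, ColexLT (w i) (w (i + 1))) ∨ ∀ i, ColexLT (w (i + 1)) (w i)) →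
      ∃ i < K, NerodeEquiv L (w i) (w (i + 1)) := by
  obtain ⟨N, M, hM, rfl⟩ := hL
  refine ⟨2 * N, fun w hp hw => ?_⟩
  rcases hw with hw | hw
  · obtain ⟨i, hi, h⟩ := hM.exists_eval_eq w (fun i _ => hw i)
      fun i _ => eval_nonempty_of_mem_prefixes (hp i)
    exact ⟨i, hi, nerodeEquiv_of_eval_eq h⟩
  · obtain ⟨i, hi, h⟩ := hM.exists_eval_eq (fun i => w (2 * N - i))
      (fun i hi => by
        have := hw (2 * N - (i + 1))
        rwa [show 2 * N - (i + 1) + 1 = 2 * N - i by omega] at this)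
      fun i _ => eval_nonempty_of_mem_prefixes (hp _)
    refine ⟨2 * N - (i + 1), by omega, ?_⟩
    rw [show 2 * N - (i + 1) + 1 = 2 * N - i by omega]
    exact Eq.symm (nerodeEquiv_of_eval_eq h)

/-- Words leading to the same state of a Wheeler DFA are convexly equivalent. -/
theorem IsWheeler.convexEquiv {Q : Type} [LinearOrder Q] {B : PDFA S Q} (hB : IsWheeler B.toNFA)
    {u v : List S} {q : Q} (hu : B.run u = some q) (hv : B.run v = some q) :
    ConvexEquiv B.lang u v := by
  have hmono : ∀ {x y : List S} {p p' : Q}, ColexLE x y → B.run x = some p → B.run y = some p' →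
      p ≤ p' := by
    rintro x y p p' (h | rfl) hx hy
    · rcases hB.le_or_mem h (B.mem_eval_toNFA.2 hx) (B.mem_eval_toNFA.2 hy) with h | h
      · exact h
      · have := B.mem_eval_toNFA.1 h.1
        rw [hy, Option.some_inj] at this
        exact this.ge
    · rw [hx, Option.some_inj] at hy
      exact hy.le
  have hlast : u.getLast? = v.getLast? := by
    obtain ⟨q₀, hstart, -, hinit, hstep⟩ := hB
    have hq₀ : B.init = q₀ := by
      have : B.init ∈ B.toNFA.start := rfl
      rwa [hstart] at this
    rcases List.eq_nil_or_concat u with rfl | ⟨u, a, rfl⟩ <;>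
      rcases List.eq_nil_or_concat v with rfl | ⟨v, b, rfl⟩
    · rfl
    · rw [List.concat_eq_append, PDFA.run_concat, Option.bind_eq_some_iff] at hv
      obtain ⟨p, -, hp⟩ := hv
      rw [PDFA.run_nil, Option.some_inj] at hu
      exact absurd (show q₀ ∈ B.toNFA.step p b by rw [← hq₀, hu]; exact hp) (hinit _ _)
    · rw [List.concat_eq_append, PDFA.run_concat, Option.bind_eq_some_iff] at hu
      obtain ⟨p, -, hp⟩ := hu
      rw [PDFA.run_nil, Option.some_inj] at hv
      exact absurd (show q₀ ∈ B.toNFA.step p a by rw [← hq₀, hv]; exact hp) (hinit _ _)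
    · rw [List.concat_eq_append, PDFA.run_concat, Option.bind_eq_some_iff] at hu hv
      obtain ⟨p, -, hp⟩ := hu
      obtain ⟨p', -, hp'⟩ := hv
      rcases lt_trichotomy a b with h | rfl | h
      · exact absurd ((hstep _ _ _ _ _ _ hp hp').1 h) (lt_irrefl _)
      · simp
      · exact absurd ((hstep _ _ _ _ _ _ hp' hp).1 h) (lt_irrefl _)
  have key : ∀ {x y : List S}, B.run x = some q → B.run y = some q → x.getLast? = y.getLast? →
      ColexLE x y → ConvexEquiv B.lang x y := by
    intro x y hx hy hl hxy
    refine convexEquiv_of_le hxy (B.nerodeEquiv_of_run_eq (hx.trans hy.symm)) hl fun w hw h1 h2 => ?_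
    obtain ⟨p, hp⟩ := B.exists_run_of_mem_prefixes hw
    apply B.nerodeEquiv_of_run_eq
    rw [hx, hp, le_antisymm (hmono h1 hx hp) (hmono h2 hp hy)]
  rcases colexLE_total u v with h | h
  · exact key hu hv hlast h
  · exact (key hv hu hlast.symm h).symm

end Wheeler

/-! ### Short representatives of the convex classes -/

section Short

variable {S : Type} [LinearOrder S] {L : Language S}

/-- Two words, one below the other, that interleave under pumping with `e` are equivalent. -/
theorem nerodeEquiv_of_interleave (hL : IsWheelerLanguage L) {x y e : List S}
    (hx : x ∈ prefixes L) (hy : y ∈ prefixes L) (hxe : NerodeEquiv L (x ++ e) x)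
    (hye : NerodeEquiv L (y ++ e) y)
    (h : ColexLT x y ∧ ColexLT y (x ++ e) ∨ ColexLT y x ∧ ColexLT (x ++ e) y) :
    NerodeEquiv L x y := by
  have hpow : ∀ {z : List S}, NerodeEquiv L (z ++ e) z → ∀ i,
      NerodeEquiv L (z ++ (List.replicate i e).flatten) z := by
    intro z hz i
    induction i with
    | zero => simp [NerodeEquiv]
    | succ i ih =>
      rw [List.replicate_succ, List.flatten_cons, ← List.append_assoc]
      exact Eq.trans (hz.append _) ih
  obtain ⟨K, hK⟩ := hL.exists_nerodeEquiv
  -- the chain `y, x e, y e, x e e, …`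
  let w : ℕ → List S := fun i =>
    if i % 2 = 0 then y ++ (List.replicate (i / 2) e).flatten
    else x ++ (List.replicate (i / 2 + 1) e).flatten
  have hw0 : ∀ i, i % 2 = 0 → w i = y ++ (List.replicate (i / 2) e).flatten := fun i hi => if_pos hi
  have hw1 : ∀ i, ¬ i % 2 = 0 → w i = x ++ (List.replicate (i / 2 + 1) e).flatten :=
    fun i hi => if_neg hi
  have hn0 : ∀ i, i % 2 = 0 → NerodeEquiv L (w i) y := fun i hi => by
    rw [hw0 i hi]; exact hpow hye _
  have hn1 : ∀ i, ¬ i % 2 = 0 → NerodeEquiv L (w i) x := fun i hi => by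
    rw [hw1 i hi]; exact hpow hxe _
  obtain ⟨i, -, hi⟩ := hK w
    (fun i => by
      by_cases hi : i % 2 = 0
      · exact (hn0 i hi).mem_prefixes_iff.2 hy
      · exact (hn1 i hi).mem_prefixes_iff.2 hx)
    (by
      refine h.imp (fun h i => ?_) (fun h i => ?_)
      all_goals
        by_cases hi : i % 2 = 0
        · rw [hw0 i hi, hw1 (i + 1) (by omega), show (i + 1) / 2 = i / 2 by omega,
            List.replicate_succ, List.flatten_cons, ← List.append_assoc, colexLT_append_right_iff]
          exact h.2
        · rw [hw1 i hi, hw0 (i + 1) (by omega), show (i + 1) / 2 = i / 2 + 1 by omega,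
            colexLT_append_right_iff]
          exact h.1)
  by_cases h2 : i % 2 = 0
  · exact Eq.trans (Eq.symm (hn1 (i + 1) (by omega))) (Eq.trans (Eq.symm hi) (hn0 i h2))
  · exact Eq.trans (Eq.symm (hn1 i h2)) (Eq.trans hi (hn0 (i + 1) (by omega)))

/-- If reading `e` does not change the classes of `x`, `y`, `z`, then `y` cannot separate the
equivalent words `x` and `z`: pumping `e`, the word `y` interleaves with one of them. -/
theorem nerodeEquiv_of_loop (hL : IsWheelerLanguage L) {x y z e : List S} (he : e ≠ [])
    (hx : x ∈ prefixes L) (hy : y ∈ prefixes L) (hxz : NerodeEquiv L x z)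
    (hxe : NerodeEquiv L (x ++ e) x) (hye : NerodeEquiv L (y ++ e) y)
    (h₁ : ColexLT x y) (h₂ : ColexLT y z) : NerodeEquiv L x y := by
  have hze : NerodeEquiv L (z ++ e) z := Eq.trans (Eq.symm (hxz.append e)) (Eq.trans hxe hxz)
  -- a power of `e` longer than `y`
  obtain ⟨f, hf, hfe⟩ : ∃ f : List S, y.length < f.length ∧
      ∀ v, NerodeEquiv L (v ++ e) v → NerodeEquiv L (v ++ f) v := by
    refine ⟨(List.replicate (y.length + 1) e).flatten, ?_, fun v hv => ?_⟩
    · have : 0 < e.length := List.length_pos_iff.2 he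
      simp only [List.length_flatten, List.map_replicate, List.sum_replicate, smul_eq_mul]
      nlinarith
    · generalize y.length + 1 = k
      induction k with
      | zero => simp [NerodeEquiv]
      | succ k ih =>
        rw [List.replicate_succ, List.flatten_cons, ← List.append_assoc]
        exact Eq.trans (hv.append _) ih
  -- every word ending with `f` compares to `y` as `f` does
  rcases colexLE_or_lt y f with h | h
  · have h : ColexLT y f := h.resolve_right (by rintro rfl; omega)
    exact nerodeEquiv_of_interleave hL hx hy (hfe _ hxe) (hfe _ hye)
      (Or.inl ⟨h₁, (colexLT_append_long_iff x hf).2 h⟩)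
  · exact Eq.trans hxz (nerodeEquiv_of_interleave hL (hxz.mem_prefixes_iff.1 hx) hy (hfe _ hze)
      (hfe _ hye) (Or.inr ⟨h₂, (append_long_colexLT_iff z hf).2 h⟩))

variable {n : ℕ} {A : PDFA S (Fin n)}

/-- Nothing separates two words which reach the same state before a long common suffix `x`: on a
suffix of length `n ^ 2` a pair of states repeats. -/
theorem nerodeEquiv_of_long_suffix (hL : IsWheelerLanguage A.lang) {u v x w : List S}
    (huv : A.run u = A.run v) (hx : n ^ 2 ≤ x.length) (hu : u ++ x ∈ prefixes A.lang)
    (hw : w ∈ prefixes A.lang) (h₁ : ColexLE (u ++ x) w) (h₂ : ColexLE w (v ++ x)) :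
    NerodeEquiv A.lang (u ++ x) w := by
  obtain ⟨y, rfl, hy₁, hy₂⟩ := suffix_of_colex_between h₁ h₂
  rcases hy₁ with hy₁ | rfl
  swap
  · rfl
  rcases hy₂ with hy₂ | rfl
  swap
  · exact (A.nerodeEquiv_of_run_eq huv).append x
  have hpre : ∀ {z : List S}, z ++ x ∈ prefixes A.lang → ∀ j, z ++ x.take j ∈ prefixes A.lang :=
    fun {z} hz j => prefixes_of_append (v := x.drop j) (by simpa using hz)
  have hs : ∀ {z : List S}, z ++ x ∈ prefixes A.lang → ∀ j, ∃ q, A.run (z ++ x.take j) = some q :=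
    fun hz j => A.exists_run_of_mem_prefixes (hpre hz j)
  choose f hf using hs hu
  choose g hg using hs hw
  obtain ⟨i, j, hij, hfg⟩ := Fintype.exists_ne_map_eq_of_card_lt
    (fun i : Fin (n ^ 2 + 1) => (f i, g i)) (by simp [sq])
  wlog hlt : i < j generalizing i j
  · exact this j i hij.symm hfg.symm (lt_of_le_of_ne (not_lt.1 hlt) hij.symm)
  rw [Prod.mk.injEq] at hfg
  set e := (x.take j).drop i with he
  have hsplit : x.take j = x.take i ++ e := by
    have : x.take i = (x.take j).take i := by
      rw [List.take_take, min_eq_left (by exact_mod_cast hlt.le)]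
    rw [this, he, List.take_append_drop]
  have hne : e ≠ [] := by
    apply List.ne_nil_of_length_pos
    have := j.isLt
    rw [he, List.length_drop, List.length_take]
    have : (i : ℕ) < j := hlt
    omega
  -- reading `e`, a factor of `x`, changes neither the class of `u ++ x.take i` nor the one of
  -- `y ++ x.take i`
  have key : NerodeEquiv A.lang (u ++ x.take i) (y ++ x.take i) := by
    refine nerodeEquiv_of_loop hL (z := v ++ x.take i) hne (hpre hu _) (hpre hw _)
      ((A.nerodeEquiv_of_run_eq huv).append _) ?_ ?_ ((colexLT_append_right_iff _).2 hy₁)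
      ((colexLT_append_right_iff _).2 hy₂)
    · apply A.nerodeEquiv_of_run_eq
      rw [List.append_assoc, ← hsplit, hf, hf, hfg.1]
    · apply A.nerodeEquiv_of_run_eq
      rw [List.append_assoc, ← hsplit, hg, hg, hfg.2]
  simpa using key.append (x.drop i)

/-- Among the first `n` letters of a long word, a factor between two visits of the same state can be
dropped without leaving the convex class. -/
theorem exists_shorter_convexEquiv (hL : IsWheelerLanguage A.lang) {u : List S}
    (hu : u ∈ prefixes A.lang) (hlen : n + n ^ 2 ≤ u.length) :
    ∃ v ∈ prefixes A.lang, v.length < u.length ∧ ConvexEquiv A.lang v u := by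
  have hs : ∀ j, ∃ q, A.run (u.take j) = some q := fun j =>
    A.exists_run_of_mem_prefixes (prefixes_of_append (v := u.drop j) (by simpa using hu))
  choose f hf using hs
  have hn : 0 < n := (f 0).pos
  obtain ⟨i, j, hij, hfij⟩ := Fintype.exists_ne_map_eq_of_card_lt
    (fun i : Fin (n + 1) => f i) (by simp)
  wlog hlt : i < j generalizing i j
  · exact this j i hij.symm hfij.symm (lt_of_le_of_ne (not_lt.1 hlt) hij.symm)
  have hlt' : (i : ℕ) < j := hlt
  have hj := j.isLt
  have hrun : A.run (u.take i) = A.run (u.take j) := by rw [hf, hf]; exact congrArg some hfij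
  set x := u.drop j with hx
  have hxl : n ^ 2 ≤ x.length := by rw [hx, List.length_drop]; omega
  have hsplit : u.take j ++ x = u := List.take_append_drop _ _
  have hner : NerodeEquiv A.lang (u.take i ++ x) u := by
    have := (A.nerodeEquiv_of_run_eq hrun).append x
    rwa [hsplit] at this
  have hv := hner.mem_prefixes_iff.2 hu
  refine ⟨u.take i ++ x, hv, ?_, ?_⟩
  · rw [hx, List.length_append, List.length_take, List.length_drop]
    omega
  have hxne : x ≠ [] := by
    apply List.ne_nil_of_length_pos
    have : 0 < n ^ 2 := by positivity
    omega
  have hlast : (u.take i ++ x).getLast? = u.getLast? := by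
    conv_rhs => rw [← hsplit]
    rw [List.getLast?_append_of_ne_nil _ hxne, List.getLast?_append_of_ne_nil _ hxne]
  rcases colexLE_total (u.take i ++ x) u with h | h
  · exact convexEquiv_of_le h hner hlast fun w hw h1 h2 =>
      nerodeEquiv_of_long_suffix hL hrun hxl hv hw h1 (by rwa [hsplit])
  · refine (convexEquiv_of_le h (Eq.symm hner) hlast.symm fun w hw h1 h2 => ?_).symm
    have := nerodeEquiv_of_long_suffix hL hrun.symm hxl (by rwa [hsplit]) hw (by rwa [hsplit]) h2
    rwa [hsplit] at this

/-- Every convex class of a Wheeler language contains a word shorter than `n + n ^ 2`. -/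
theorem exists_short_convexEquiv (hL : IsWheelerLanguage A.lang) {u : List S}
    (hu : u ∈ prefixes A.lang) :
    ∃ v ∈ prefixes A.lang, v.length < n + n ^ 2 ∧ ConvexEquiv A.lang v u := by
  induction hlen : u.length using Nat.strong_induction_on generalizing u with
  | _ l ih =>
    subst hlen
    by_cases h : u.length < n + n ^ 2
    · exact ⟨u, hu, h, ConvexEquiv.refl u⟩
    · obtain ⟨v, hv, hlt, hvu⟩ := exists_shorter_convexEquiv hL hu (not_lt.1 h)
      obtain ⟨v', hv', hlen', h'⟩ := ih _ hlt hv rfl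
      exact ⟨v', hv', hlen', h'.trans hvu⟩

/-- For the convex equivalence it suffices to inspect the short words in between: every other word
in between is convexly equivalent to a short one. -/
theorem convexEquiv_of_short (hL : IsWheelerLanguage A.lang) {D : ℕ} (hD : n + n ^ 2 ≤ D + 1)
    {u v : List S} (hu : u ∈ prefixes A.lang) (huv : ColexLE u v) (h : NerodeEquiv A.lang u v)
    (hl : u.getLast? = v.getLast?)
    (hb : ∀ w ∈ prefixesUpTo A.lang D, ColexLE u w → ColexLE w v → NerodeEquiv A.lang u w) :
    ConvexEquiv A.lang u v := by
  have hv := h.mem_prefixes_iff.1 hu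
  refine convexEquiv_of_le huv h hl fun w hw h1 h2 => ?_
  obtain ⟨w', hw', hlen, hww⟩ := exists_short_convexEquiv hL hw
  rcases colexLE_total u w' with h3 | h3
  · rcases colexLE_total w' v with h4 | h4
    · exact Eq.trans (hb w' ⟨hw', by omega⟩ h3 h4) hww.1
    · exact Eq.trans h (Eq.symm (hww.symm.nerode_of_between hv h2 h4))
  · exact Eq.trans (Eq.symm (hww.nerode_of_between hu h3 h1)) hww.1

/-- The boundaries of the sorted list of short prefixes represent the convex classes. -/
theorem existsUnique_boundary (hL : IsWheelerLanguage A.lang) {k : ℕ} {w : Fin k → List S}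
    (hw : IsSortedList A.lang (n + n ^ 2) w) {u : List S} (hu : u ∈ prefixes A.lang) :
    ∃! i : Fin k, IsBoundary A.lang w i ∧ ConvexEquiv A.lang (w i) u := by
  classical
  obtain ⟨hmono, hrange⟩ := hw
  have hmem : ∀ i, w i ∈ prefixes A.lang := fun i =>
    (show w i ∈ prefixesUpTo A.lang (n + n ^ 2) from hrange ▸ Set.mem_range_self i).1
  have hle : ∀ {i j}, i ≤ j → ColexLE (w i) (w j) := fun {i j} h => by
    rcases h.lt_or_eq with h | rfl
    exacts [(hmono _ _ h).le, ColexLE.refl _]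
  have hlt : ∀ {i j}, ColexLE (w i) (w j) → i ≤ j := fun {i j} h => by
    by_contra hij
    exact (hmono _ _ (not_le.1 hij)).not_le h
  have hne : {i | ConvexEquiv A.lang (w i) u}.Nonempty := by
    obtain ⟨v, hv, hlen, hvu⟩ := exists_short_convexEquiv hL hu
    obtain ⟨i, rfl⟩ : v ∈ Set.range w := by rw [hrange]; exact ⟨hv, hlen.le⟩
    exact ⟨i, hvu⟩
  -- the class is an interval of the list, and its last word is its only boundary
  obtain ⟨i, hi, hmax⟩ := Set.exists_max_image _ id (Set.toFinite _) hne
  refine ⟨i, ⟨fun j hj => ?_, hi⟩, ?_⟩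
  · by_contra hcon
    push Not at hcon
    have hij : i < j := by rw [Fin.lt_def]; omega
    have hc : ConvexEquiv A.lang (w i) (w j) := by
      refine convexEquiv_of_short hL (Nat.le_succ _) (hmem i) (hle hij.le) hcon.1 hcon.2
        fun x hx h1 h2 => ?_
      obtain ⟨t, rfl⟩ : x ∈ Set.range w := by rw [hrange]; exact hx
      have h1 := hlt h1
      have h2 := hlt h2
      rw [Fin.le_def] at h1 h2
      rcases (show (t : ℕ) = i ∨ (t : ℕ) = j by omega) with h | h
      · rw [Fin.ext h]; rfl
      · rw [Fin.ext h]; exact hcon.1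
    have : j ≤ i := hmax j (hc.symm.trans hi)
    exact absurd hij (not_lt.2 this)
  · rintro j ⟨hbj, hj⟩
    refine le_antisymm (hmax j hj) ?_
    by_contra hcon
    rw [not_le, Fin.lt_def] at hcon
    let s : Fin k := ⟨j + 1, by have := i.isLt; omega⟩
    have hc := (hj.trans hi.symm).of_between (hmem s)
      (hle (by rw [Fin.le_def]; simp [s])) (hle (by rw [Fin.le_def]; simp [s]; omega))
    rcases hbj s rfl with h | h
    exacts [h hc.1, h hc.2.1]

end Short

/-! ### Wheeler automata from monotone class maps -/

section ClassMap

variable {S Q : Type} [LinearOrder S] [LinearOrder Q]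

/-- The states of `B` are the values of `cl`, a map that numbers the prefixes of `L` in a monotone
way; the value of `cl` outside `prefixes L` is irrelevant. -/
structure IsClassMap (B : PDFA S Q) (L : Language S) (cl : List S → Q) : Prop where
  init : B.init = cl []
  step_some : ∀ u a, u ++ [a] ∈ prefixes L → B.step (cl u) a = some (cl (u ++ [a]))
  step_none : ∀ u a, u ∈ prefixes L → u ++ [a] ∉ prefixes L → B.step (cl u) a = none
  accept_iff : ∀ u ∈ prefixes L, B.accept (cl u) = true ↔ u ∈ L
  onto : ∀ q, ∃ u ∈ prefixes L, cl u = q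
  mono : ∀ u ∈ prefixes L, ∀ v ∈ prefixes L, ColexLE u v → cl u ≤ cl v
  last : ∀ u ∈ prefixes L, ∀ v ∈ prefixes L, cl u = cl v → u.getLast? = v.getLast?

namespace IsClassMap

variable {B : PDFA S Q} {L : Language S} {cl : List S → Q}

theorem nil_mem (h : IsClassMap B L cl) : [] ∈ prefixes L := by
  obtain ⟨u, hu, -⟩ := h.onto B.init
  exact prefixes_of_append (u := []) hu

theorem run_eq (h : IsClassMap B L cl) {u : List S} (hu : u ∈ prefixes L) :
    B.run u = some (cl u) := by
  induction u using List.reverseRecOn with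
  | nil => rw [PDFA.run_nil, h.init]
  | append_singleton u a ih =>
    rw [PDFA.run_concat, ih (prefixes_of_append hu)]
    exact h.step_some u a hu

theorem mem_of_run (h : IsClassMap B L cl) {u : List S} {q : Q} (hu : B.run u = some q) :
    u ∈ prefixes L := by
  induction u using List.reverseRecOn generalizing q with
  | nil => exact h.nil_mem
  | append_singleton u a ih =>
    rw [PDFA.run_concat, Option.bind_eq_some_iff] at hu
    obtain ⟨p, hp, hpq⟩ := hu
    have hu' := ih hp
    by_contra hcon
    rw [h.run_eq hu', Option.some_inj] at hp
    rw [← hp, h.step_none u a hu' hcon] at hpq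
    cases hpq

theorem lang_eq (h : IsClassMap B L cl) : B.lang = L := by
  ext u
  rw [PDFA.mem_lang_iff]
  constructor
  · rintro ⟨p, hp, hacc⟩
    have hu := h.mem_of_run hp
    rw [show B.runFrom B.init u = B.run u from rfl, h.run_eq hu, Option.some_inj] at hp
    exact (h.accept_iff u hu).1 (hp ▸ hacc)
  · intro hu
    exact ⟨cl u, h.run_eq (mem_prefixes_of_mem hu), (h.accept_iff u (mem_prefixes_of_mem hu)).2 hu⟩

theorem isBasic (h : IsClassMap B L cl) : IsBasic B.toNFA := by
  rw [PDFA.isBasic_toNFA_iff]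
  intro q
  obtain ⟨u, hu, rfl⟩ := h.onto q
  refine ⟨⟨u, h.run_eq hu⟩, ?_⟩
  obtain ⟨v, hv⟩ := hu
  refine ⟨v, ?_⟩
  rw [← B.append_mem_lang_iff (h.run_eq ⟨v, hv⟩), h.lang_eq]
  exact hv

theorem exists_of_step (h : IsClassMap B L cl) {p q : Q} {a : S} (hs : B.step p a = some q) :
    ∃ u, u ++ [a] ∈ prefixes L ∧ cl u = p ∧ cl (u ++ [a]) = q := by
  obtain ⟨u, hu, rfl⟩ := h.onto p
  by_cases hua : u ++ [a] ∈ prefixes L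
  · refine ⟨u, hua, rfl, ?_⟩
    rw [h.step_some u a hua, Option.some_inj] at hs
    exact hs
  · rw [h.step_none u a hu hua] at hs
    cases hs

theorem isWheeler (h : IsClassMap B L cl) : IsWheeler B.toNFA := by
  refine ⟨B.init, rfl, fun q => ?_, fun p a hp => ?_, ?_⟩
  · obtain ⟨u, hu, rfl⟩ := h.onto q
    rw [h.init]
    exact h.mono _ h.nil_mem _ hu (nil_colexLE u)
  · obtain ⟨u, hu, -, hcl⟩ := h.exists_of_step hp
    rw [h.init] at hcl
    simpa using h.last _ hu _ h.nil_mem hcl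
  · intro p₁ p₂ a₁ a₂ q₁ q₂ h₁ h₂
    obtain ⟨u₁, hu₁, rfl, rfl⟩ := h.exists_of_step h₁
    obtain ⟨u₂, hu₂, rfl, rfl⟩ := h.exists_of_step h₂
    constructor
    · intro ha
      refine lt_of_le_of_ne (h.mono _ hu₁ _ hu₂ (colexLT_concat_iff.2 (Or.inl ha)).le) fun hcl => ?_
      have := h.last _ hu₁ _ hu₂ hcl
      simp only [List.getLast?_concat, Option.some_inj] at this
      exact ha.ne this
    · rintro rfl hlt
      refine h.mono _ hu₁ _ hu₂ (colexLE_concat_iff.2 ?_)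
      rcases colexLE_or_lt u₁ u₂ with hle | hgt
      · exact hle
      · exact absurd (h.mono _ (prefixes_of_append hu₂) _ (prefixes_of_append hu₁) hgt.le)
          (not_le.2 hlt)

/-- If the class map separates the classes of the convex equivalence, the automaton is the minimum
Wheeler DFA. -/
theorem isMinWDFA {m : ℕ} {B : PDFA S (Fin m)} {cl : List S → Fin m} (h : IsClassMap B L cl)
    (hcl : ∀ u ∈ prefixes L, ∀ v ∈ prefixes L, ConvexEquiv L u v → cl u = cl v) :
    IsMinWDFA B L := by
  refine ⟨h.isBasic, h.isWheeler, h.lang_eq, fun m' B' hB' hL => ?_⟩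
  have hrep := h.onto
  choose u hu hcu using hrep
  have hs : ∀ q, ∃ p, B'.run (u q) = some p := fun q =>
    B'.exists_run_of_mem_prefixes (by rw [hL]; exact hu q)
  choose g hg using hs
  have hinj : Function.Injective g := by
    intro p q hpq
    have := hB'.convexEquiv (hg p) ((hg q).trans (congrArg some hpq.symm))
    rw [hL] at this
    rw [← hcu p, ← hcu q]
    exact hcl _ (hu p) _ (hu q) this
  simpa using Fintype.card_le_of_injective g hinj

end IsClassMap

end ClassMap

/-- A finite nonempty language is Wheeler: its trie, with the prefixes in co-lexicographic order, is
a Wheeler automaton. -/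
theorem isWheelerLanguage_of_finite {S : Type} [LinearOrder S] {L : Language S} {x : List S}
    (hx : x ∈ L) (hfin : (prefixes L).Finite) : IsWheelerLanguage L := by
  classical
  let s : Finset (List S) := (hfin.image List.reverse).toFinset
  have hs : ∀ {u : List S}, u.reverse ∈ s ↔ u ∈ prefixes L := fun {u} => by
    simp [s]
  let e := s.orderIsoOfFin rfl
  have hnil : [] ∈ prefixes L := prefixes_of_append (u := []) (mem_prefixes_of_mem hx)
  let cl : List S → Fin s.card := fun u =>
    if hu : u ∈ prefixes L then e.symm ⟨u.reverse, hs.2 hu⟩ else e.symm ⟨_, hs.2 hnil⟩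
  have hcl : ∀ {u} (hu : u ∈ prefixes L), cl u = e.symm ⟨u.reverse, hs.2 hu⟩ := fun hu => dif_pos hu
  let wd : Fin s.card → List S := fun j => (e j : List S).reverse
  have hwd : ∀ {u}, u ∈ prefixes L → wd (cl u) = u := fun {u} hu => by
    simp [wd, hcl hu]
  let B : PDFA S (Fin s.card) :=
    ⟨cl [], fun j a => if wd j ++ [a] ∈ prefixes L then some (cl (wd j ++ [a])) else none,
      fun j => wd j ∈ L⟩
  have hB : IsClassMap B L cl := by
    refine ⟨rfl, fun u a hu => ?_, fun u a hu hua => ?_, fun u hu => ?_, fun j => ?_,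
      fun u hu v hv huv => ?_, fun u hu v hv huv => ?_⟩
    · simp [B, hwd (prefixes_of_append hu), hu]
    · simp [B, hwd hu, hua]
    · simp [B, hwd hu]
    · have hj : wd j ∈ prefixes L := by
        rw [← hs]
        simp [wd]
      refine ⟨wd j, hj, ?_⟩
      simp [hcl hj, wd]
    · rw [hcl hu, hcl hv]
      simpa using colexLE_iff.1 huv
    · rw [← hwd hu, ← hwd hv, huv]
  exact ⟨_, B.toNFA, hB.isWheeler, hB.lang_eq⟩

/-! ### An exponential gap -/

theorem ColexLT.append_of_length_eq {S : Type} [LinearOrder S] {u v : List S} (h : ColexLT u v)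
    (hl : u.length = v.length) (x y : List S) : ColexLT (x ++ u) (y ++ v) := by
  induction u using List.reverseRecOn generalizing v with
  | nil => exact absurd h (by rw [List.eq_nil_of_length_eq_zero hl.symm]; exact not_colexLT_nil _)
  | append_singleton u a ih =>
    rcases List.eq_nil_or_concat v with rfl | ⟨v, b, rfl⟩
    · simp at hl
    · rw [List.concat_eq_append] at *
      rw [← List.append_assoc, ← List.append_assoc, colexLT_concat_iff]
      exact (colexLT_concat_iff.1 h).imp_right fun h => ⟨h.1, ih h.2 (by simpa using hl)⟩

/-- The minimum DFA of the words `x u x`, where `x` is a letter and `u` has length `r`, over a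
binary alphabet.  State `0` is initial, state `1 + 2 * i + x` remembers the first letter `x` and the
length `i ≤ r` of what was read after it, and state `2 * r + 3` is accepting. -/
def sandwich (r : ℕ) : PDFA (Fin 2) (Fin (2 * r + 4)) where
  init := 0
  step q a :=
    if (q : ℕ) = 0 then some ⟨1 + a, by omega⟩
    else if h : (q : ℕ) ≤ 2 * r then some ⟨q + 2, by omega⟩
    else if (q : ℕ) = 2 * r + 1 + a then some ⟨2 * r + 3, by omega⟩
    else none
  accept q := (q : ℕ) = 2 * r + 3

namespace sandwich

variable {r : ℕ}

theorem runFrom_mid {i x : ℕ} (hx : x < 2) (u : List (Fin 2)) (h : i + u.length ≤ r) :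
    (sandwich r).runFrom ⟨1 + 2 * i + x, by omega⟩ u =
      some ⟨1 + 2 * (i + u.length) + x, by omega⟩ := by
  induction u generalizing i with
  | nil => rfl
  | cons a u ih =>
    rw [List.length_cons] at h
    have hs : (sandwich r).step ⟨1 + 2 * i + x, by omega⟩ a =
        some ⟨1 + 2 * (i + 1) + x, by omega⟩ := by
      simp only [sandwich]
      rw [if_neg (by omega), dif_pos (by omega)]
      congr 2
      omega
    rw [PDFA.runFrom, hs, Option.bind_some, ih (i := i + 1) (show i + 1 + u.length ≤ r by omega)]
    congr 2
    rw [List.length_cons]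
    omega

theorem run_cons (x : Fin 2) (u : List (Fin 2)) (h : u.length ≤ r) :
    (sandwich r).run (x :: u) = some ⟨1 + 2 * u.length + x, by omega⟩ := by
  have := runFrom_mid (r := r) (i := 0) x.isLt u (by omega)
  simp only [Nat.zero_add, Nat.mul_zero, Nat.add_zero] at this
  rw [← this]
  rfl

theorem acceptsFrom_last (x : Fin 2) :
    (sandwich r).AcceptsFrom ⟨1 + 2 * r + x, by omega⟩ [x] := by
  refine ⟨⟨2 * r + 3, by omega⟩, ?_, by simp [sandwich]⟩
  simp only [PDFA.runFrom, sandwich]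
  rw [if_neg (by omega), dif_neg (by omega), if_pos (by omega)]
  rfl

theorem acceptsFrom_mid {i : ℕ} (hi : i ≤ r) (x : Fin 2) :
    (sandwich r).AcceptsFrom ⟨1 + 2 * i + x, by omega⟩ (List.replicate (r - i) 0 ++ [x]) := by
  obtain ⟨p, hp, hacc⟩ := acceptsFrom_last (r := r) x
  refine ⟨p, ?_, hacc⟩
  rw [PDFA.runFrom_append, runFrom_mid x.isLt _ (by simp; omega), Option.bind_some, ← hp]
  congr 2
  simp
  omega

theorem mid_of_ne {q : Fin (2 * r + 4)} (h0 : (q : ℕ) ≠ 0) (h1 : (q : ℕ) ≠ 2 * r + 3) :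
    ∃ i, ∃ hi : i ≤ r, ∃ x : Fin 2, q = ⟨1 + 2 * i + x, by omega⟩ := by
  refine ⟨((q : ℕ) - 1) / 2, by omega, ⟨((q : ℕ) - 1) % 2, by omega⟩, ?_⟩
  ext
  simp only
  omega

/-- The words accepted from a state determine it: by their length and their last letter. -/
theorem of_acceptsFrom {q : Fin (2 * r + 4)} {v : List (Fin 2)}
    (h : (sandwich r).AcceptsFrom q v) : v.length = (2 * r + 4 - q) / 2 ∧
      ((q : ℕ) ≠ 0 → ∀ x ∈ v.getLast?, (x : ℕ) = (q - 1) % 2) := by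
  induction v generalizing q with
  | nil =>
    obtain ⟨p, hp, hacc⟩ := h
    rw [PDFA.runFrom, Option.some_inj] at hp
    subst hp
    have : (q : ℕ) = 2 * r + 3 := by simpa [sandwich] using hacc
    refine ⟨by rw [this, List.length_nil]; omega, by simp⟩
  | cons a v ih =>
    obtain ⟨p, hp, hacc⟩ := h
    rw [PDFA.runFrom, Option.bind_eq_some_iff] at hp
    obtain ⟨q', hq', hrun⟩ := hp
    have := ih ⟨p, hrun, hacc⟩
    simp only [sandwich] at hq'
    rw [List.length_cons, this.1]
    have hlast : v ≠ [] → (a :: v).getLast? = v.getLast? := fun hv =>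
      List.getLast?_append_of_ne_nil [a] hv
    split_ifs at hq' with h1 h2 h3
    · rw [Option.some_inj] at hq'
      subst hq'
      have := a.isLt
      exact ⟨by simp only; omega, fun h => absurd h1 h⟩
    · rw [Option.some_inj] at hq'
      subst hq'
      refine ⟨by simp only; omega, fun _ x hx => ?_⟩
      rw [hlast (List.ne_nil_of_length_pos (by rw [this.1]; simp only; omega))] at hx
      rw [this.2 (by simp) x hx]
      simp only
      omega
    · rw [Option.some_inj] at hq'
      subst hq'
      have ha := a.isLt
      refine ⟨by simp only; omega, fun _ x hx => ?_⟩
      have hv : v = [] := List.eq_nil_of_length_eq_zero (by rw [this.1]; simp only; omega)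
      subst hv
      obtain rfl : a = x := by simpa using hx
      omega

theorem exists_acceptsFrom (q : Fin (2 * r + 4)) :
    ∃ v, (sandwich r).AcceptsFrom q v ∧ ((q : ℕ) ≠ 2 * r + 3 → v ≠ []) := by
  by_cases h0 : (q : ℕ) = 0
  · obtain ⟨p, hp, hacc⟩ := acceptsFrom_mid (r := r) (i := 0) (Nat.zero_le _) 0
    refine ⟨0 :: (List.replicate (r - 0) 0 ++ [0]), ⟨p, ?_, hacc⟩, by simp⟩
    have hs : (sandwich r).step q 0 = some ⟨1 + 2 * 0 + (0 : Fin 2), by simp⟩ := by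
      simp only [sandwich]
      rw [if_pos h0]
    rw [PDFA.runFrom, hs, ← hp, Option.bind_some]
  · by_cases h1 : (q : ℕ) = 2 * r + 3
    · exact ⟨[], ⟨q, rfl, by simp [sandwich, h1]⟩, fun h => absurd h1 h⟩
    · obtain ⟨i, hi, x, rfl⟩ := mid_of_ne h0 h1
      exact ⟨_, acceptsFrom_mid hi x, by simp⟩

theorem isBasic : IsBasic (sandwich r).toNFA := by
  rw [PDFA.isBasic_toNFA_iff]
  refine fun q => ⟨?_, (exists_acceptsFrom q).imp fun _ => And.left⟩
  by_cases h0 : (q : ℕ) = 0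
  · exact ⟨[], by rw [PDFA.run_nil]; congr 1; exact Fin.ext h0.symm⟩
  · by_cases h1 : (q : ℕ) = 2 * r + 3
    · obtain ⟨p, hp, hacc⟩ := acceptsFrom_last (r := r) 0
      refine ⟨(0 :: List.replicate r 0) ++ [0], ?_⟩
      rw [PDFA.run_append, run_cons 0 _ (by simp), Option.bind_some]
      simp only [List.length_replicate]
      rw [hp]
      have : (p : ℕ) = 2 * r + 3 := by simpa [sandwich] using hacc
      exact congrArg some (Fin.ext (this.trans h1.symm))
    · obtain ⟨i, hi, x, rfl⟩ := mid_of_ne h0 h1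
      refine ⟨x :: List.replicate i 0, ?_⟩
      rw [run_cons x _ (by simpa using hi)]
      simp

theorem isMinDFA : IsMinDFA (sandwich r) := by
  refine PDFA.isMinDFA_of_distinguishable isBasic fun p q h => ?_
  obtain ⟨v, hv, hne⟩ := exists_acceptsFrom p
  have hp := of_acceptsFrom hv
  have hq := of_acceptsFrom ((h v).1 hv)
  have hlen := hp.1.symm.trans hq.1
  have hpl := p.isLt
  have hql := q.isLt
  ext
  by_cases h1 : (p : ℕ) = 2 * r + 3
  · omega
  · have hv' : v.getLast? = some (v.getLast (hne h1)) := List.getLast?_eq_getLast_of_ne_nil _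
    by_cases hp0 : (p : ℕ) = 0
    · omega
    · have e1 := hp.2 hp0 _ hv'
      have e2 := hq.2 (by omega) _ hv'
      omega

theorem isWheelerLanguage : IsWheelerLanguage (sandwich r).lang := by
  obtain ⟨v, hv, -⟩ := exists_acceptsFrom (r := r) 0
  refine isWheelerLanguage_of_finite ((sandwich r).mem_lang_iff.2 hv)
    ((List.finite_length_le (Fin 2) (r + 2)).subset ?_)
  rintro u ⟨x, hx⟩
  have := (of_acceptsFrom ((sandwich r).mem_lang_iff.1 hx)).1
  simp only [List.length_append, sandwich, Fin.val_zero] at this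
  change u.length ≤ r + 2
  omega

/-- The words `0 u` are equivalent, but the words `1 u` lie in between: a Wheeler DFA has to
separate the words `0 u`. -/
theorem two_pow_le {m : ℕ} {B : PDFA (Fin 2) (Fin m)} (hB : IsWheeler B.toNFA)
    (hL : B.lang = (sandwich r).lang) : 2 ^ r ≤ m := by
  have hpre : ∀ (x : Fin 2) (u : Fin r → Fin 2), x :: List.ofFn u ∈ prefixes (sandwich r).lang :=
    fun x u => PDFA.mem_prefixes_of_run_eq_some isBasic (run_cons x _ (by simp))
  have hs : ∀ u : Fin r → Fin 2, ∃ q, B.run (0 :: List.ofFn u) = some q := fun u =>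
    B.exists_run_of_mem_prefixes (by rw [hL]; exact hpre _ _)
  choose g hg using hs
  have hne : ∀ u : Fin r → Fin 2,
      ¬ NerodeEquiv (sandwich r).lang (0 :: List.ofFn u) (1 :: List.ofFn u) := by
    intro u h
    have := PDFA.run_eq_of_nerodeEquiv isMinDFA (hpre 0 u) h
    rw [run_cons _ _ (by simp), run_cons _ _ (by simp)] at this
    simp at this
  have key : ∀ {u v : Fin r → Fin 2}, g u = g v →
      ¬ ColexLT (List.ofFn u) (List.ofFn v) := by
    intro u v huv hlt
    have hc := hB.convexEquiv (hg u) ((hg v).trans (congrArg some huv.symm))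
    rw [hL] at hc
    refine hne u (hc.nerode_of_between (hpre 1 u) ?_ ?_)
    · exact ((colexLT_append_right_iff (u := [0]) (v := [1]) (List.ofFn u)).2
        (by simpa using colexLT_concat_iff (u := []) (v := []) (a := (0 : Fin 2)) (b := 1))).le
    · exact (hlt.append_of_length_eq (by simp) [1] [0]).le
  have hinj : Function.Injective g := by
    intro u v huv
    apply List.ofFn_injective
    rcases colexLE_or_lt (List.ofFn u) (List.ofFn v) with (h | h) | h
    · exact absurd h (key huv)
    · exact h
    · exact absurd h (key huv.symm)
  simpa using Fintype.card_le_of_injective g hinj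

end sandwich

/-! ### One sweep over a list of runs -/

section Sweep

/-- The code of the last transition with letter `c` among the first `j` entries of `R`, and `0` if
there is none; `δ x c` is the code of the transition from `x`, with `0` for no transition. -/
def lastCode (δ : ℕ → ℕ → ℕ) (R : ℕ → ℕ) (c : ℕ) : ℕ → ℕ
  | 0 => 0
  | j + 1 => if δ (R j) c = 0 then lastCode δ R c j else δ (R j) c

/-- The `j`-th entry of `R` starts a new run in the block of the letter `c`. -/
def IsFresh (δ : ℕ → ℕ → ℕ) (R : ℕ → ℕ) (c j : ℕ) : Prop :=
  δ (R j) c ≠ 0 ∧ δ (R j) c ≠ lastCode δ R c j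

instance (δ : ℕ → ℕ → ℕ) (R : ℕ → ℕ) (c j : ℕ) : Decidable (IsFresh δ R c j) :=
  inferInstanceAs (Decidable (_ ∧ _))

/-- `b` plus the number of runs that the first `j` entries of `R` start in the block of `c`. -/
def runCount (δ : ℕ → ℕ → ℕ) (R : ℕ → ℕ) (c b : ℕ) : ℕ → ℕ
  | 0 => b
  | j + 1 => runCount δ R c b j + if IsFresh δ R c j then 1 else 0

/-- The number of new runs before the block of `c`: the one of the empty word, and those in the
blocks of smaller letters. -/
def blockStart (δ : ℕ → ℕ → ℕ) (R : ℕ → ℕ) (r : ℕ) : ℕ → ℕ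
  | 0 => 1
  | c + 1 => runCount δ R c (blockStart δ R r c) r

/-- The number of new runs before the `j`-th entry is read in the block of `c`. -/
def sweepCount (δ : ℕ → ℕ → ℕ) (R : ℕ → ℕ) (r c j : ℕ) : ℕ :=
  runCount δ R c (blockStart δ R r c) j

/-- The code (`0` for none, `i + 1` for run `i`) of the transition from the `j`-th old run with
the letter `c`. -/
def sweepCode (δ : ℕ → ℕ → ℕ) (R : ℕ → ℕ) (r c j : ℕ) : ℕ :=
  if δ (R j) c = 0 then 0 else sweepCount δ R r c (j + 1)

variable {δ : ℕ → ℕ → ℕ} {R : ℕ → ℕ} {r : ℕ}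

theorem sweepCount_succ (c j : ℕ) : sweepCount δ R r c (j + 1) =
    sweepCount δ R r c j + if IsFresh δ R c j then 1 else 0 := rfl

theorem sweepCount_zero (c : ℕ) : sweepCount δ R r c 0 = blockStart δ R r c := rfl

theorem blockStart_succ (c : ℕ) : blockStart δ R r (c + 1) = sweepCount δ R r c r := rfl

theorem sweepCount_mono (c : ℕ) : Monotone (sweepCount δ R r c) :=
  monotone_nat_of_le_succ fun j => by rw [sweepCount_succ]; omega

theorem blockStart_mono : Monotone (blockStart δ R r) :=
  monotone_nat_of_le_succ fun c => by
    rw [blockStart_succ, ← sweepCount_zero]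
    exact sweepCount_mono c (Nat.zero_le r)

theorem one_le_blockStart (c : ℕ) : 1 ≤ blockStart δ R r c := blockStart_mono (Nat.zero_le c)

theorem blockStart_le_sweepCount (c j : ℕ) : blockStart δ R r c ≤ sweepCount δ R r c j :=
  sweepCount_mono c (Nat.zero_le j)

theorem sweepCount_le_blockStart {c c' j : ℕ} (hc : c < c') (hj : j ≤ r) :
    sweepCount δ R r c j ≤ blockStart δ R r c' :=
  (sweepCount_mono c hj).trans (blockStart_mono hc)

theorem sweepCount_le (c j : ℕ) : sweepCount δ R r c j ≤ blockStart δ R r c + j := by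
  induction j with
  | zero => exact le_rfl
  | succ j ih =>
    rw [sweepCount_succ]
    split_ifs <;> omega

theorem blockStart_le (c : ℕ) : blockStart δ R r c ≤ 1 + c * r := by
  induction c with
  | zero => exact Nat.le_add_right 1 _
  | succ c ih =>
    have := sweepCount_le (δ := δ) (R := R) (r := r) c r
    rw [blockStart_succ, Nat.succ_mul]
    omega

/-- As long as no run is started, the last transition stays the same. -/
theorem lastCode_eq_of_sweepCount_eq {c j k : ℕ} (hjk : j ≤ k)
    (h : sweepCount δ R r c j = sweepCount δ R r c k) :
    lastCode δ R c j = lastCode δ R c k := by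
  induction k, hjk using Nat.le_induction with
  | base => rfl
  | succ k hjk ih =>
    have h1 := sweepCount_mono (δ := δ) (R := R) (r := r) c hjk
    rw [sweepCount_succ] at h
    have ih := ih (by omega)
    have hf : ¬ IsFresh δ R c k := fun hf => by rw [if_pos hf] at h; omega
    rw [lastCode]
    split_ifs with h0
    · exact ih
    · rw [IsFresh, not_and_not_right] at hf
      rw [hf h0, ih]

theorem lastCode_succ {c j : ℕ} (h : δ (R j) c ≠ 0) : lastCode δ R c (j + 1) = δ (R j) c :=
  if_neg h

theorem exists_isFresh_of_lastCode_ne_zero {c k : ℕ} (h : lastCode δ R c k ≠ 0) :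
    ∃ j < k, IsFresh δ R c j ∧ sweepCount δ R r c (j + 1) = sweepCount δ R r c k := by
  induction k with
  | zero => exact absurd rfl h
  | succ k ih =>
    by_cases hf : IsFresh δ R c k
    · exact ⟨k, Nat.lt_succ_self k, hf, rfl⟩
    · have hk : lastCode δ R c k ≠ 0 := by
        by_cases h0 : δ (R k) c = 0
        · rwa [lastCode, if_pos h0] at h
        · rw [IsFresh, not_and_not_right] at hf
          rwa [← hf h0]
      obtain ⟨j, hj, hjf, hjk⟩ := ih hk
      exact ⟨j, by omega, hjf, by rw [hjk, sweepCount_succ c k, if_neg hf, Nat.add_zero]⟩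

/-- Every transition leads to a run which is started by an equal transition. -/
theorem exists_isFresh {c k : ℕ} (h : δ (R k) c ≠ 0) :
    ∃ j ≤ k, IsFresh δ R c j ∧ sweepCount δ R r c (k + 1) = sweepCount δ R r c j + 1 ∧
      δ (R j) c = δ (R k) c := by
  obtain ⟨j, hj, hf, hjk⟩ := exists_isFresh_of_lastCode_ne_zero (r := r) (k := k + 1)
    (by rwa [lastCode_succ h])
  refine ⟨j, by omega, hf, ?_, ?_⟩
  · rw [← hjk, sweepCount_succ, if_pos hf]
  · rw [← lastCode_succ hf.1, ← lastCode_succ h]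
    exact lastCode_eq_of_sweepCount_eq hj hjk

theorem exists_isFresh_of_lt_runs {c i k : ℕ} (h₁ : blockStart δ R r c ≤ i)
    (h₂ : i < sweepCount δ R r c k) : ∃ j < k, IsFresh δ R c j ∧ sweepCount δ R r c j = i := by
  induction k with
  | zero => rw [sweepCount_zero] at h₂; omega
  | succ k ih =>
    by_cases hi : i < sweepCount δ R r c k
    · obtain ⟨j, hj, h⟩ := ih hi
      exact ⟨j, by omega, h⟩
    · rw [sweepCount_succ] at h₂
      have hf : IsFresh δ R c k := by
        by_contra hf
        rw [if_neg hf] at h₂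
        omega
      rw [if_pos hf] at h₂
      exact ⟨k, Nat.lt_succ_self k, hf, by omega⟩

/-- Every new run but that of the empty word is started by some entry in the block of some letter. -/
theorem exists_block {c i : ℕ} (h₁ : 1 ≤ i) (h₂ : i < blockStart δ R r c) :
    ∃ b < c, ∃ j < r, IsFresh δ R b j ∧ sweepCount δ R r b j = i := by
  induction c with
  | zero => exact absurd h₂ (not_lt.2 h₁)
  | succ c ih =>
    by_cases hi : i < blockStart δ R r c
    · obtain ⟨b, hb, h⟩ := ih hi
      exact ⟨b, by omega, h⟩
    · obtain ⟨j, h⟩ := exists_isFresh_of_lt_runs (not_lt.1 hi) h₂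
      exact ⟨c, Nat.lt_succ_self c, j, h⟩

end Sweep

/-! ### Lists of runs -/

section RunList

variable {σ n : ℕ}

/-- The entry of the transition table: `0` for no transition, `p + 1` for a transition to `p`. -/
def PDFA.code (A : PDFA (Fin σ) (Fin n)) (x c : ℕ) : ℕ :=
  if h : x < n ∧ c < σ then ((A.step ⟨x, h.1⟩ ⟨c, h.2⟩).map fun p => p.val + 1).getD 0 else 0

theorem PDFA.code_le (A : PDFA (Fin σ) (Fin n)) (x c : ℕ) : A.code x c ≤ n := by
  rw [PDFA.code]
  split_ifs with h
  · rcases A.step ⟨x, h.1⟩ ⟨c, h.2⟩ with _ | p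
    · exact Nat.zero_le _
    · exact p.isLt
  · exact Nat.zero_le _

theorem PDFA.code_eq (A : PDFA (Fin σ) (Fin n)) (q : Fin n) (c : Fin σ) :
    A.code q c = ((A.step q c).map fun p => p.val + 1).getD 0 := by
  rw [PDFA.code, dif_pos ⟨q.isLt, c.isLt⟩]

/-- `R 0, …, R (r - 1)` are the states of the runs of the prefixes of length at most `l`: the maximal
blocks of words which are consecutive in the co-lexicographic order (among these prefixes), lead to
the same state and have the same last letter.  `idx` maps a word to the position of its run. -/
structure IsRunList (A : PDFA (Fin σ) (Fin n)) (l r : ℕ) (R : ℕ → ℕ) (idx : List (Fin σ) → ℕ) :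
    Prop where
  lt : ∀ u ∈ prefixesUpTo A.lang l, idx u < r
  onto : ∀ j < r, ∃ u ∈ prefixesUpTo A.lang l, idx u = j
  mono : ∀ u ∈ prefixesUpTo A.lang l, ∀ v ∈ prefixesUpTo A.lang l, ColexLE u v → idx u ≤ idx v
  last : ∀ u ∈ prefixesUpTo A.lang l, ∀ v ∈ prefixesUpTo A.lang l, idx u = idx v →
    u.getLast? = v.getLast?
  state : ∀ u ∈ prefixesUpTo A.lang l, ∀ q, A.run u = some q → R (idx u) = q
  maximal : ∀ u ∈ prefixesUpTo A.lang l, ∀ v ∈ prefixesUpTo A.lang l, idx v = idx u + 1 →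
    u.getLast? = v.getLast? → R (idx u) ≠ R (idx v)

/-- The convex equivalence is right invariant, since the words between `u ++ [a]` and `v ++ [a]` are
the words `y ++ [a]` with `y` between `u` and `v`. -/
theorem ConvexEquiv.concat {S : Type} [LinearOrder S] {L : Language S} {u v : List S}
    (h : ConvexEquiv L u v) (a : S) : ConvexEquiv L (u ++ [a]) (v ++ [a]) := by
  have key : ∀ {u v : List S}, ConvexEquiv L u v → ColexLE u v →
      ConvexEquiv L (u ++ [a]) (v ++ [a]) := by
    intro u v h huv
    refine convexEquiv_of_le (colexLE_concat_iff.2 huv) (h.1.append _) (by simp)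
      fun w hw h₁ h₂ => ?_
    obtain ⟨y, rfl, hy₁, hy₂⟩ := suffix_of_colex_between h₁ h₂
    exact (h.nerode_of_between (prefixes_of_append hw) hy₁ hy₂).append _
  rcases colexLE_total u v with huv | huv
  exacts [key h huv, (key h.symm huv).symm]

theorem mem_prefixesUpTo_concat {S : Type} {L : Language S} {l : ℕ} {u : List S} {a : S}
    (h : u ++ [a] ∈ prefixesUpTo L (l + 1)) : u ∈ prefixesUpTo L l :=
  ⟨prefixes_of_append h.1, by simpa using h.2⟩

theorem nil_mem_prefixes (A : PDFA (Fin σ) (Fin n)) (hA : IsBasic A.toNFA) :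
    [] ∈ prefixes A.lang :=
  PDFA.mem_prefixes_of_run_eq_some hA A.run_nil

/-- Positions of the words after a sweep, in terms of the positions before it. -/
def nextIdx (δ : ℕ → ℕ → ℕ) (R : ℕ → ℕ) (r : ℕ) (idx : List (Fin σ) → ℕ) (u : List (Fin σ)) : ℕ :=
  match u.getLast? with
  | none => 0
  | some c => sweepCount δ R r c (idx u.dropLast + 1) - 1

theorem nextIdx_nil (δ : ℕ → ℕ → ℕ) (R : ℕ → ℕ) (r : ℕ) (idx : List (Fin σ) → ℕ) :
    nextIdx δ R r idx [] = 0 := rfl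

theorem nextIdx_concat (δ : ℕ → ℕ → ℕ) (R : ℕ → ℕ) (r : ℕ) (idx : List (Fin σ) → ℕ)
    (u : List (Fin σ)) (c : Fin σ) :
    nextIdx δ R r idx (u ++ [c]) = sweepCount δ R r c (idx u + 1) - 1 := by
  simp [nextIdx]

namespace IsRunList

variable {A : PDFA (Fin σ) (Fin n)} {l r : ℕ} {R : ℕ → ℕ} {idx : List (Fin σ) → ℕ}

theorem zero (hA : IsBasic A.toNFA) (hR : R 0 = A.init) : IsRunList A 0 1 R fun _ => 0 := by
  have hnil : ∀ u ∈ prefixesUpTo A.lang 0, u = [] := fun u hu =>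
    List.eq_nil_of_length_eq_zero (Nat.le_zero.1 hu.2)
  refine ⟨fun _ _ => Nat.one_pos, fun j hj => ⟨[], ⟨nil_mem_prefixes A hA, le_rfl⟩, by omega⟩,
    fun _ _ _ _ _ => le_rfl, fun u hu v hv _ => by rw [hnil u hu, hnil v hv], fun u hu q hq => ?_,
    fun u hu v hv h => by omega⟩
  rw [hnil u hu, PDFA.run_nil, Option.some_inj] at hq
  rw [hR, hq]

theorem colexLT_of_idx_lt (h : IsRunList A l r R idx) {u v : List (Fin σ)}
    (hu : u ∈ prefixesUpTo A.lang l) (hv : v ∈ prefixesUpTo A.lang l) (hlt : idx u < idx v) :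
    ColexLT u v := by
  rcases colexLE_or_lt v u with h' | h'
  · exact absurd (h.mono v hv u hu h') (not_le.2 hlt)
  · exact h'

theorem run_eq_of_state_eq (h : IsRunList A l r R idx) {u v : List (Fin σ)}
    (hu : u ∈ prefixesUpTo A.lang l) (hv : v ∈ prefixesUpTo A.lang l)
    (huv : R (idx u) = R (idx v)) : A.run u = A.run v := by
  obtain ⟨p, hp⟩ := A.exists_run_of_mem_prefixes hu.1
  obtain ⟨q, hq⟩ := A.exists_run_of_mem_prefixes hv.1
  rw [h.state u hu p hp, h.state v hv q hq] at huv
  rw [hp, hq, Fin.ext huv]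

/-- Convexly equivalent words are in the same run: the words between them lead to the same state and
have the same last letter, but runs are maximal. -/
theorem idx_eq_of_convexEquiv (h : IsRunList A l r R idx) (hA : IsMinDFA A) {u v : List (Fin σ)}
    (hu : u ∈ prefixesUpTo A.lang l) (hv : v ∈ prefixesUpTo A.lang l)
    (huv : ConvexEquiv A.lang u v) : idx u = idx v := by
  have key : ∀ {u v : List (Fin σ)}, u ∈ prefixesUpTo A.lang l → v ∈ prefixesUpTo A.lang l →
      ConvexEquiv A.lang u v → ¬ idx u < idx v := by
    intro u v hu hv huv hlt
    -- the run next to that of `u`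
    obtain ⟨x, hx, hxi⟩ := h.onto (idx u + 1) (by have := h.lt v hv; omega)
    have hux := h.colexLT_of_idx_lt hu hx (by omega)
    obtain ⟨y, hy, hyi, huy⟩ : ∃ y ∈ prefixesUpTo A.lang l, idx y = idx u + 1 ∧
        ConvexEquiv A.lang u y := by
      rcases colexLE_total x v with hxv | hxv
      · exact ⟨x, hx, hxi, huv.of_between hx.1 hux.le hxv⟩
      · have := h.mono v hv x hx hxv
        exact ⟨v, hv, by omega, huv⟩
    apply h.maximal u hu y hy hyi huy.2.1
    obtain ⟨p, hp⟩ := A.exists_run_of_mem_prefixes hu.1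
    rw [h.state u hu p hp, h.state y hy p]
    rw [← hp]
    exact (PDFA.run_eq_of_nerodeEquiv hA hu.1 huy.1).symm
  exact le_antisymm (not_lt.1 (key hv hu huv.symm)) (not_lt.1 (key hu hv huv))

/-- From length `n + n ^ 2 - 1` on, the runs are the classes of the convex equivalence. -/
theorem convexEquiv_of_idx_eq (h : IsRunList A l r R idx) (hL : IsWheelerLanguage A.lang)
    (hl : n + n ^ 2 ≤ l + 1) {u v : List (Fin σ)} (hu : u ∈ prefixesUpTo A.lang l)
    (hv : v ∈ prefixesUpTo A.lang l) (huv : idx u = idx v) : ConvexEquiv A.lang u v := by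
  have key : ∀ {u v : List (Fin σ)}, u ∈ prefixesUpTo A.lang l → v ∈ prefixesUpTo A.lang l →
      idx u = idx v → ColexLE u v → ConvexEquiv A.lang u v := by
    intro u v hu hv huv hle
    have hn : ∀ w ∈ prefixesUpTo A.lang l, idx u = idx w → NerodeEquiv A.lang u w :=
      fun w hw huw => A.nerodeEquiv_of_run_eq (h.run_eq_of_state_eq hu hw (by rw [huw]))
    refine convexEquiv_of_short hL hl hu.1 hle (hn v hv huv) (h.last u hu v hv huv)
      fun w hw h₁ h₂ => hn w hw ?_
    have := h.mono u hu w hw h₁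
    have := h.mono w hw v hv h₂
    omega
  rcases colexLE_total u v with hle | hle
  exacts [key hu hv huv hle, (key hv hu huv.symm hle).symm]

/-- The transition table, at the state of the run of `u`, tells where `u ++ [c]` leads. -/
theorem code_eq (h : IsRunList A l r R idx) (hA : IsBasic A.toNFA) {u : List (Fin σ)}
    (hu : u ∈ prefixesUpTo A.lang l) (c : Fin σ) :
    (A.code (R (idx u)) c ≠ 0 ↔ u ++ [c] ∈ prefixes A.lang) ∧
      ∀ p, A.run (u ++ [c]) = some p → A.code (R (idx u)) c = p + 1 := by
  obtain ⟨q, hq⟩ := A.exists_run_of_mem_prefixes hu.1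
  have hrun : A.run (u ++ [c]) = A.step q c := by rw [PDFA.run_concat, hq, Option.bind_some]
  rw [h.state u hu q hq, A.code_eq, hrun]
  rcases hs : A.step q c with _ | p
  · refine ⟨⟨fun h0 => absurd rfl h0, fun hp => ?_⟩, fun p hp => by cases hp⟩
    obtain ⟨p, hp⟩ := A.exists_run_of_mem_prefixes hp
    rw [hrun, hs] at hp
    cases hp
  · refine ⟨⟨fun _ => ?_, fun _ => Nat.succ_ne_zero _⟩, fun p' hp' => ?_⟩
    · exact PDFA.mem_prefixes_of_run_eq_some hA (hrun.trans hs)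
    · rw [Option.some_inj] at hp'
      rw [← hp']
      rfl

/-- A sweep turns the list of runs for length `l` into the one for length `l + 1`. -/
theorem next (h : IsRunList A l r R idx) (hA : IsBasic A.toNFA) {R' : ℕ → ℕ}
    (h0 : R' 0 = A.init)
    (hR' : ∀ c < σ, ∀ j < r, IsFresh A.code R c j →
      R' (sweepCount A.code R r c j) = A.code (R j) c - 1) :
    IsRunList A (l + 1) (blockStart A.code R r σ) R' (nextIdx A.code R r idx) := by
  -- a word ending with `c` lands in the block of `c`, at a run started by some entry
  have hland : ∀ {u : List (Fin σ)} {c : Fin σ}, u ++ [c] ∈ prefixesUpTo A.lang (l + 1) →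
      ∃ j ≤ idx u, IsFresh A.code R c j ∧
        sweepCount A.code R r c (idx u + 1) = sweepCount A.code R r c j + 1 ∧
        nextIdx A.code R r idx (u ++ [c]) = sweepCount A.code R r c j ∧
        A.code (R j) c = A.code (R (idx u)) c ∧ j < r := by
    intro u c huc
    have hu := mem_prefixesUpTo_concat huc
    obtain ⟨j, hj, hf, hcount, hcode⟩ :=
      exists_isFresh (r := r) ((h.code_eq hA hu c).1.2 huc.1)
    refine ⟨j, hj, hf, hcount, ?_, hcode, hj.trans_lt (h.lt u hu)⟩
    rw [nextIdx_concat, hcount, Nat.add_sub_cancel]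
  have hblock : ∀ {u : List (Fin σ)} {c : Fin σ}, u ++ [c] ∈ prefixesUpTo A.lang (l + 1) →
      blockStart A.code R r c ≤ nextIdx A.code R r idx (u ++ [c]) ∧
        nextIdx A.code R r idx (u ++ [c]) < blockStart A.code R r (c + 1) := by
    intro u c huc
    obtain ⟨j, hj, hf, hcount, hidx, -, hjr⟩ := hland huc
    rw [hidx]
    refine ⟨blockStart_le_sweepCount _ _, ?_⟩
    have := sweepCount_le_blockStart (δ := A.code) (R := R) (r := r) (Nat.lt_succ_self (c : ℕ))
      (Nat.succ_le_of_lt (h.lt u (mem_prefixesUpTo_concat huc)))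
    rw [Nat.succ_eq_add_one, hcount] at this
    exact this
  have hstate : ∀ {u : List (Fin σ)} {c : Fin σ}, u ++ [c] ∈ prefixesUpTo A.lang (l + 1) →
      R' (nextIdx A.code R r idx (u ++ [c])) = A.code (R (idx u)) c - 1 := by
    intro u c huc
    obtain ⟨j, -, hf, -, hidx, hcode, hjr⟩ := hland huc
    rw [hidx, hR' c c.isLt j hjr hf, hcode]
  refine ⟨fun u hu => ?_, fun i hi => ?_, fun u hu v hv huv => ?_, fun u hu v hv huv => ?_,
    fun u hu q hq => ?_, fun u hu v hv hidx hlast => ?_⟩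
  · rcases List.eq_nil_or_concat u with rfl | ⟨u, c, rfl⟩
    · exact one_le_blockStart σ
    · rw [List.concat_eq_append] at *
      exact (hblock hu).2.trans_le (blockStart_mono c.isLt)
  · rcases Nat.eq_zero_or_pos i with rfl | hpos
    · exact ⟨[], ⟨nil_mem_prefixes A hA, Nat.zero_le _⟩, rfl⟩
    · obtain ⟨c, hc, j, hj, hf, rfl⟩ := exists_block hpos hi
      obtain ⟨u, hu, rfl⟩ := h.onto j hj
      refine ⟨u ++ [⟨c, hc⟩], ⟨(h.code_eq hA hu _).1.1 hf.1, by simpa using hu.2⟩, ?_⟩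
      rw [nextIdx_concat, sweepCount_succ, if_pos hf, Nat.add_sub_cancel]
  · rcases List.eq_nil_or_concat u with rfl | ⟨u, c, rfl⟩
    · exact Nat.zero_le _
    rcases List.eq_nil_or_concat v with rfl | ⟨v, d, rfl⟩
    · rcases huv with huv | huv
      · exact absurd huv (not_colexLT_nil _)
      · rw [huv]
    rw [List.concat_eq_append, List.concat_eq_append] at *
    have hcd : c ≤ d := by
      rcases huv with huv | huv
      · exact (colexLT_concat_iff.1 huv).elim le_of_lt fun h => h.1.le
      · exact (List.singleton_inj.1 (List.append_inj_right' huv rfl)).le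
    rcases hcd.lt_or_eq with hcd | rfl
    · exact ((hblock hu).2.le.trans (blockStart_mono (show (c : ℕ) + 1 ≤ d from hcd))).trans
        (hblock hv).1
    · rw [nextIdx_concat, nextIdx_concat]
      have := h.mono u (mem_prefixesUpTo_concat hu) v (mem_prefixesUpTo_concat hv)
        (colexLE_concat_iff.1 huv)
      exact Nat.sub_le_sub_right (sweepCount_mono _ (by omega)) 1
  · have hpos : ∀ {u : List (Fin σ)} {c : Fin σ}, u ++ [c] ∈ prefixesUpTo A.lang (l + 1) →
        nextIdx A.code R r idx (u ++ [c]) ≠ 0 := fun {u c} huc => by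
      have := (hblock huc).1
      have := one_le_blockStart (δ := A.code) (R := R) (r := r) c
      omega
    rcases List.eq_nil_or_concat u with rfl | ⟨u, c, rfl⟩ <;>
      rcases List.eq_nil_or_concat v with rfl | ⟨v, d, rfl⟩ <;>
      simp only [List.concat_eq_append] at *
    · exact absurd huv.symm (hpos hv)
    · exact absurd huv (hpos hu)
    · have h1 := hblock hu
      have h2 := hblock hv
      rw [huv] at h1
      have : c = d := by
        rcases lt_trichotomy c d with hcd | hcd | hcd
        · have := blockStart_mono (δ := A.code) (R := R) (r := r) (show (c : ℕ) + 1 ≤ d from hcd)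
          omega
        · exact hcd
        · have := blockStart_mono (δ := A.code) (R := R) (r := r) (show (d : ℕ) + 1 ≤ c from hcd)
          omega
      simp [this]
  · rcases List.eq_nil_or_concat u with rfl | ⟨u, c, rfl⟩
    · rw [PDFA.run_nil, Option.some_inj] at hq
      rw [nextIdx_nil, h0, hq]
    · rw [List.concat_eq_append] at *
      rw [hstate hu, (h.code_eq hA (mem_prefixesUpTo_concat hu) c).2 q hq, Nat.add_sub_cancel]
  · rcases List.eq_nil_or_concat u with rfl | ⟨u, c, rfl⟩
    · have hv0 : v = [] := by simpa [eq_comm] using hlast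
      rw [hv0] at hidx
      omega
    rcases List.eq_nil_or_concat v with rfl | ⟨v, d, rfl⟩
    · simp at hlast
    simp only [List.concat_eq_append] at *
    obtain rfl : c = d := by simpa using hlast
    obtain ⟨j, -, hf, hcount, hnext, hcode, -⟩ := hland hu
    obtain ⟨k, -, hf', hcount', hnext', hcode', -⟩ := hland hv
    have hu' := (h.code_eq hA (mem_prefixesUpTo_concat hu) c).1.2 hu.1
    rw [hnext, hnext'] at hidx
    rw [hstate hu, hstate hv, ← hcode']
    -- the run of `v` is started directly after the run of `u`, so by another state
    have hlt : idx u + 1 ≤ k := by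
      by_contra hcon
      have := sweepCount_mono (δ := A.code) (R := R) (r := r) c (show k + 1 ≤ idx u + 1 by omega)
      rw [sweepCount_succ, if_pos hf'] at this
      omega
    have hstable := lastCode_eq_of_sweepCount_eq (r := r) hlt (by rw [hcount, hidx])
    rw [lastCode_succ hu'] at hstable
    have := hf'.2
    have := hf'.1
    omega

section Final

variable {l' r' : ℕ} {R' : ℕ → ℕ} {idx' : List (Fin σ) → ℕ}

/-- There are at most as many runs of short words as convex classes. -/
theorem le_of_isRunList (h : IsRunList A l r R idx) (h' : IsRunList A l' r' R' idx')
    (hA : IsMinDFA A) (hL : IsWheelerLanguage A.lang) (hl : l ≤ l') (hl' : n + n ^ 2 ≤ l' + 1) :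
    r ≤ r' := by
  have hu : ∀ j : Fin r, ∃ u ∈ prefixesUpTo A.lang l, idx u = j := fun j => h.onto j j.isLt
  choose u hu hju using hu
  have hu' : ∀ j, u j ∈ prefixesUpTo A.lang l' := fun j => ⟨(hu j).1, (hu j).2.trans hl⟩
  have hinj : Function.Injective fun j : Fin r => (⟨idx' (u j), h'.lt _ (hu' j)⟩ : Fin r') := by
    intro i j hij
    have := h.idx_eq_of_convexEquiv hA (hu i) (hu j)
      (h'.convexEquiv_of_idx_eq hL hl' (hu' i) (hu' j) (Fin.ext_iff.1 hij))
    rw [hju, hju] at this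
    exact Fin.ext this
  simpa using Fintype.card_le_of_injective _ hinj

/-- From length `n + n ^ 2 - 1` on, the lists of runs are stable. -/
theorem stable (h : IsRunList A l r R idx) (h' : IsRunList A l' r' R' idx')
    (hA : IsMinDFA A) (hL : IsWheelerLanguage A.lang) (hl : l ≤ l') (hl' : n + n ^ 2 ≤ l + 1) :
    r = r' ∧ ∀ u ∈ prefixesUpTo A.lang l, idx u = idx' u := by
  have hsub : ∀ {u}, u ∈ prefixesUpTo A.lang l → u ∈ prefixesUpTo A.lang l' := fun hu =>
    ⟨hu.1, hu.2.trans hl⟩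
  have hiff : ∀ {u v}, u ∈ prefixesUpTo A.lang l → v ∈ prefixesUpTo A.lang l →
      (idx u = idx v ↔ idx' u = idx' v) := fun hu hv =>
    ⟨fun huv => h'.idx_eq_of_convexEquiv hA (hsub hu) (hsub hv)
      (h.convexEquiv_of_idx_eq hL hl' hu hv huv), fun huv => h.idx_eq_of_convexEquiv hA hu hv
      (h'.convexEquiv_of_idx_eq hL (by omega) (hsub hu) (hsub hv) huv)⟩
  have hu : ∀ j : Fin r, ∃ u ∈ prefixesUpTo A.lang l, idx u = j := fun j => h.onto j j.isLt
  choose u hu hju using hu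
  let f : Fin r → Fin r' := fun j => ⟨idx' (u j), h'.lt _ (hsub (hu j))⟩
  have hf : StrictMono f := by
    intro i j hij
    have hlt : idx (u i) < idx (u j) := by rw [hju, hju]; exact hij
    refine lt_of_le_of_ne (h'.mono _ (hsub (hu i)) _ (hsub (hu j))
      (h.colexLT_of_idx_lt (hu i) (hu j) hlt).le) fun heq => ?_
    exact hlt.ne ((hiff (hu i) (hu j)).2 (Fin.ext_iff.1 heq))
  have hsurj : Function.Surjective f := by
    intro i
    obtain ⟨v, hv, hvi⟩ := h'.onto i i.isLt
    obtain ⟨w, hw, hlen, hwv⟩ := exists_short_convexEquiv hL hv.1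
    have hwl : w ∈ prefixesUpTo A.lang l := ⟨hw, by omega⟩
    refine ⟨⟨idx w, h.lt w hwl⟩, Fin.ext ?_⟩
    rw [← hvi, ← h'.idx_eq_of_convexEquiv hA (hsub hwl) hv hwv]
    exact (hiff (hu _) hwl).1 (hju _)
  have hrr : r = r' := by
    simpa using Fintype.card_of_bijective ⟨hf.injective, hsurj⟩
  subst hrr
  refine ⟨rfl, fun v hv => ?_⟩
  have hid : f = id := by
    have := Subsingleton.elim (hf.orderIsoOfSurjective f hsurj) (OrderIso.refl (Fin r))
    funext j
    exact congrArg (fun e : Fin r ≃o Fin r => e j) this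
  have := congrFun hid ⟨idx v, h.lt v hv⟩
  rw [Fin.ext_iff] at this
  exact this.symm.trans ((hiff (hu _) hv).1 (hju _))

end Final

end IsRunList

/-- Two classes of the convex equivalence that are not separated by the order are equal. -/
theorem ConvexEquiv.of_crossing {S : Type} [LinearOrder S] {L : Language S} {u u' v v' : List S}
    (hu : ConvexEquiv L u u') (hv : ConvexEquiv L v v') (hup : u ∈ prefixes L)
    (hvp' : v' ∈ prefixes L) (h : ColexLE v u) (h' : ColexLE u' v') : ConvexEquiv L u v := by
  rcases colexLE_total u v' with huv | huv
  · exact (hv.of_between hup h huv).symm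
  · exact hu.trans ((hu.symm.of_between hvp' h' huv).trans hv.symm)

/-- The automaton whose states are the runs, with the transitions found by the last sweep. -/
def runAutomaton (A : PDFA (Fin σ) (Fin n)) (R R' : ℕ → ℕ) (r m : ℕ) [NeZero m] :
    PDFA (Fin σ) (Fin m) where
  init := 0
  step j c :=
    if h : sweepCode A.code R r c j ≠ 0 ∧ sweepCode A.code R r c j ≤ m then
      some ⟨sweepCode A.code R r c j - 1, by omega⟩ else none
  accept j := if h : R' j < n then A.accept ⟨R' j, h⟩ else false

/-- The runs for the lengths `n + n ^ 2 - 1` and `n + n ^ 2` are the states of the minimum Wheeler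
DFA, and the sweep from the former to the latter finds its transitions. -/
theorem runAutomaton_isMinWDFA {A : PDFA (Fin σ) (Fin n)} (hA : IsMinDFA A)
    (hL : IsWheelerLanguage A.lang) {l r : ℕ} {R R' : ℕ → ℕ} {idx : List (Fin σ) → ℕ}
    (h : IsRunList A l r R idx) (hl : n + n ^ 2 = l + 1) [NeZero (blockStart A.code R r σ)]
    (h' : IsRunList A (l + 1) (blockStart A.code R r σ) R' (nextIdx A.code R r idx)) :
    IsMinWDFA (runAutomaton A R R' r (blockStart A.code R r σ)) A.lang := by
  set m := blockStart A.code R r σ with hm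
  set idx' := nextIdx A.code R r idx with hidx'
  have hstable := (h.stable h' hA hL (Nat.le_succ l) hl.le).2
  have hrep : ∀ u, ∃ v, u ∈ prefixes A.lang →
      v ∈ prefixesUpTo A.lang l ∧ ConvexEquiv A.lang v u := by
    intro u
    by_cases hu : u ∈ prefixes A.lang
    · obtain ⟨v, hv, hlen, hvu⟩ := exists_short_convexEquiv hL hu
      exact ⟨v, fun _ => ⟨⟨hv, by omega⟩, hvu⟩⟩
    · exact ⟨[], fun h => absurd h hu⟩
  choose rep hrep using hrep
  -- the class of `u` is the run of a word of length at most `l` that is equivalent to `u`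
  have hsub : ∀ {u}, u ∈ prefixesUpTo A.lang l → u ∈ prefixesUpTo A.lang (l + 1) := fun hu =>
    ⟨hu.1, hu.2.trans (Nat.le_succ l)⟩
  have hlt : ∀ {u}, u ∈ prefixes A.lang → idx' (rep u) < m := fun hu =>
    h'.lt _ (hsub (hrep _ hu).1)
  let cl : List (Fin σ) → Fin m := fun u => Fin.ofNat m (idx' (rep u))
  have hcl : ∀ {u}, u ∈ prefixes A.lang → (cl u : ℕ) = idx' (rep u) := fun hu =>
    Nat.mod_eq_of_lt (hlt hu)
  have hsep : ∀ u ∈ prefixes A.lang, ∀ v ∈ prefixes A.lang, ConvexEquiv A.lang u v →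
      cl u = cl v := by
    intro u hu v hv huv
    apply Fin.ext
    rw [hcl hu, hcl hv]
    exact h'.idx_eq_of_convexEquiv hA (hsub (hrep u hu).1) (hsub (hrep v hv).1)
      ((hrep u hu).2.trans (huv.trans (hrep v hv).2.symm))
  have hequiv : ∀ u ∈ prefixes A.lang, ∀ v ∈ prefixes A.lang, cl u = cl v →
      ConvexEquiv A.lang u v := by
    intro u hu v hv huv
    rw [Fin.ext_iff, hcl hu, hcl hv] at huv
    exact (hrep u hu).2.symm.trans ((h'.convexEquiv_of_idx_eq hL (by omega) (hsub (hrep u hu).1)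
      (hsub (hrep v hv).1) huv).trans (hrep v hv).2)
  have hidxcl : ∀ {u}, u ∈ prefixesUpTo A.lang (l + 1) → (cl u : ℕ) = idx' u := fun hu => by
    rw [hcl hu.1]
    exact h'.idx_eq_of_convexEquiv hA (hsub (hrep _ hu.1).1) hu (hrep _ hu.1).2
  have hmap : IsClassMap (runAutomaton A R R' r m) A.lang cl := by
    refine ⟨?_, fun u c huc => ?_, fun u c hu huc => ?_, fun u hu => ?_, fun j => ?_,
      fun u hu v hv huv => ?_, fun u hu v hv huv => (hequiv u hu v hv huv).2.1⟩
    · apply Fin.ext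
      rw [hidxcl ⟨nil_mem_prefixes A hA.1, Nat.zero_le _⟩]
      rfl
    · have hu := prefixes_of_append huc
      obtain ⟨hv, hvu⟩ := hrep u hu
      have hvc := (hvu.concat c).1.mem_prefixes_iff.2 huc
      have hvc' : rep u ++ [c] ∈ prefixesUpTo A.lang (l + 1) := ⟨hvc, by simpa using hv.2⟩
      have hcode := (h.code_eq hA.1 hv c).1.2 hvc
      have hidx := hidxcl hvc'
      rw [hidx', nextIdx_concat] at hidx
      have hpos := one_le_blockStart (δ := A.code) (R := R) (r := r) c
      have hblk := blockStart_le_sweepCount (δ := A.code) (R := R) (r := r) c (idx (rep u) + 1)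
      have hsc : sweepCode A.code R r c (cl u) = sweepCount A.code R r c (idx (rep u) + 1) := by
        rw [hcl hu, ← hstable _ hv, sweepCode, if_neg hcode]
      have hval : sweepCode A.code R r c (cl u) = cl (rep u ++ [c]) + 1 := by omega
      have hstep : (runAutomaton A R R' r m).step (cl u) c = some (cl (rep u ++ [c])) := by
        simp only [runAutomaton]
        rw [dif_pos ⟨by omega, by have := (cl (rep u ++ [c])).isLt; omega⟩]
        exact congrArg some (Fin.ext (by simp only; omega))
      rw [hstep, hsep _ hvc _ huc (hvu.concat c)]
    · obtain ⟨hv, hvu⟩ := hrep u hu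
      have hvc : rep u ++ [c] ∉ prefixes A.lang := fun hvc =>
        huc ((hvu.1.append [c]).mem_prefixes_iff.1 hvc)
      have hcode : A.code (R (idx (rep u))) c = 0 := by
        by_contra hne
        exact hvc ((h.code_eq hA.1 hv c).1.1 hne)
      have hsc : sweepCode A.code R r c (cl u) = 0 := by
        rw [hcl hu, ← hstable _ hv, sweepCode, if_pos hcode]
      simp only [runAutomaton]
      rw [dif_neg fun h => h.1 hsc]
    · obtain ⟨hv, hvu⟩ := hrep u hu
      obtain ⟨q, hq⟩ := A.exists_run_of_mem_prefixes hv.1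
      have hR : R' (cl u) = q := by rw [hcl hu, h'.state _ (hsub hv) q hq]
      have hacc := A.append_mem_lang_iff (v := []) hq
      rw [List.append_nil, hvu.1.mem_iff] at hacc
      rw [hacc]
      simp only [runAutomaton, hR, q.isLt, dite_true, PDFA.AcceptsFrom, PDFA.runFrom,
        Option.some_inj, exists_eq_left', Fin.eta]
    · obtain ⟨u, hu, huj⟩ := h'.onto j j.isLt
      exact ⟨u, hu.1, Fin.ext ((hidxcl hu).trans huj)⟩
    · rw [← not_lt]
      intro hcon
      have hcon' := hcon
      rw [Fin.lt_def, hcl hu, hcl hv] at hcon'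
      have hvu := h'.colexLT_of_idx_lt (hsub (hrep v hv).1) (hsub (hrep u hu).1) hcon'
      have := (hrep u hu).2.of_crossing (hrep v hv).2 (hrep u hu).1.1 hv hvu.le huv
      exact hcon.ne' (hsep u hu v hv ((hrep u hu).2.symm.trans (this.trans (hrep v hv).2)))
  exact hmap.isMinWDFA hsep

end RunList

/-! ### Reasoning about the random access machine -/

section Machine

/-- The register file with the given contents of the first registers; the others hold `0`. -/
def regs (l : List ℕ) : ℕ → ℕ := fun i => l.getD i 0

theorem update_regs {l : List ℕ} {x : ℕ} (hx : x < l.length) (v : ℕ) :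
    Function.update (regs l) x v = regs (l.set x v) := by
  funext i
  rcases eq_or_ne i x with rfl | hi
  · simp [regs, hx]
  · simp [regs, hi, hi.symm, List.getElem?_set_ne]

/-- A sequence of assignments. -/
def block : List (ℕ × Rhs) → Program
  | [] => .skip
  | (x, e) :: p => .seq (.assign x e) (block p)

/-- The values of the registers in the list `l` after a sequence of assignments. -/
def evalBlock (mem : ℕ → ℕ) : List (ℕ × Rhs) → List ℕ → List ℕ
  | [], l => l
  | (x, e) :: p, l => evalBlock mem p (l.set x (e.eval ⟨regs l, mem⟩))

/-- The assignments only touch registers in the list and all values fit into a word. -/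
def SafeBlock (W : ℕ) (mem : ℕ → ℕ) : List (ℕ × Rhs) → List ℕ → Prop
  | [], _ => True
  | (x, e) :: p, l => x < l.length ∧ e.eval ⟨regs l, mem⟩ ≤ W ∧
      SafeBlock W mem p (l.set x (e.eval ⟨regs l, mem⟩))

theorem exec_block {W : ℕ} {mem : ℕ → ℕ} {p : List (ℕ × Rhs)} {l : List ℕ}
    (h : SafeBlock W mem p l) :
    Exec W (block p) ⟨regs l, mem⟩ ⟨regs (evalBlock mem p l), mem⟩ (p.length + 1) := by
  induction p generalizing l with
  | nil => exact Exec.skip _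
  | cons a p ih =>
    obtain ⟨x, e⟩ := a
    obtain ⟨hx, he, h⟩ := h
    have h1 := Exec.assign (W := W) ⟨regs l, mem⟩ x e he
    rw [update_regs hx] at h1
    have := Exec.seq h1 (ih h)
    rwa [show 1 + (p.length + 1) = (((x, e) :: p).length + 1) by rw [List.length_cons]; omega]
      at this

/-- The program `p` started in `s` halts after at most `T` steps in a state with property `Q`. -/
def Runs (W : ℕ) (p : Program) (s : RAMState) (T : ℕ) (Q : RAMState → Prop) : Prop :=
  ∃ s' t, Exec W p s s' t ∧ t ≤ T ∧ Q s'

variable {W : ℕ} {s : RAMState} {Q : RAMState → Prop}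

theorem Runs.seq {p q : Program} {T T' : ℕ} {Q' : RAMState → Prop} (hp : Runs W p s T Q')
    (hq : ∀ s', Q' s' → Runs W q s' T' Q) : Runs W (.seq p q) s (T + T') Q := by
  obtain ⟨s', t, h, ht, hs'⟩ := hp
  obtain ⟨s'', t', h', ht', hs''⟩ := hq s' hs'
  exact ⟨s'', t + t', h.seq h', Nat.add_le_add ht ht', hs''⟩

theorem Runs.mono {p : Program} {T T' : ℕ} (h : Runs W p s T Q) (hT : T ≤ T') :
    Runs W p s T' Q := by
  obtain ⟨s', t, h, ht, hs'⟩ := h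
  exact ⟨s', t, h, ht.trans hT, hs'⟩

theorem runs_block {mem : ℕ → ℕ} {p : List (ℕ × Rhs)} {l : List ℕ} (h : SafeBlock W mem p l)
    (hQ : Q ⟨regs (evalBlock mem p l), mem⟩) : Runs W (block p) ⟨regs l, mem⟩ (p.length + 1) Q :=
  ⟨_, _, exec_block h, le_rfl, hQ⟩

theorem runs_block_seq {mem : ℕ → ℕ} {p : List (ℕ × Rhs)} {l : List ℕ} {q : Program} {T : ℕ}
    (h : SafeBlock W mem p l) (hq : Runs W q ⟨regs (evalBlock mem p l), mem⟩ T Q) :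
    Runs W (.seq (block p) q) ⟨regs l, mem⟩ (p.length + 1 + T) Q :=
  (runs_block (Q := fun s => s = ⟨regs (evalBlock mem p l), mem⟩) h rfl).seq
    fun _ hs => hs ▸ hq

theorem runs_store {x y : ℕ} (hQ : Q ⟨s.reg, Function.update s.mem (s.reg x) (s.reg y)⟩) :
    Runs W (.store x y) s 1 Q :=
  ⟨_, _, Exec.store s x y, le_rfl, hQ⟩

theorem runs_store_seq {x y : ℕ} {q : Program} {T : ℕ}
    (hq : Runs W q ⟨s.reg, Function.update s.mem (s.reg x) (s.reg y)⟩ T Q) :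
    Runs W (.seq (.store x y) q) s (1 + T) Q :=
  (runs_store (Q := fun s' => s' = ⟨s.reg, Function.update s.mem (s.reg x) (s.reg y)⟩) rfl).seq
    fun _ hs => hs ▸ hq

theorem runs_skip (hQ : Q s) : Runs W .skip s 1 Q := ⟨_, _, Exec.skip s, le_rfl, hQ⟩

theorem runs_ite {b : Test} {p q : Program} {T : ℕ} (hp : b.Holds s → Runs W p s T Q)
    (hq : ¬ b.Holds s → Runs W q s T Q) : Runs W (.ite b p q) s (1 + T) Q := by
  by_cases hb : b.Holds s
  · obtain ⟨s', t, h, ht, hs'⟩ := hp hb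
    exact ⟨s', _, Exec.ite_true hb h, Nat.add_le_add_left ht 1, hs'⟩
  · obtain ⟨s', t, h, ht, hs'⟩ := hq hb
    exact ⟨s', _, Exec.ite_false hb h, Nat.add_le_add_left ht 1, hs'⟩

/-- A loop whose body is run `N` times, with an invariant `I` that is indexed by the number of the
rounds done. -/
theorem runs_while {b : Test} {p : Program} {N T : ℕ} (I : ℕ → RAMState → Prop)
    (hstep : ∀ i < N, ∀ s, I i s → b.Holds s ∧ Runs W p s T (I (i + 1)))
    (hend : ∀ s, I N s → ¬ b.Holds s) (h0 : I 0 s) :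
    Runs W (.while b p) s (N * (T + 1) + 1) (I N) := by
  have key : ∀ k i, i + k = N → ∀ s, I i s → Runs W (.while b p) s (k * (T + 1) + 1) (I N) := by
    intro k
    induction k with
    | zero =>
      intro i hi s hs
      obtain rfl : i = N := by omega
      exact ⟨s, 1, Exec.while_false (hend s hs), by omega, hs⟩
    | succ k ih =>
      intro i hi s hs
      obtain ⟨hb, s', t, h, ht, hs'⟩ := hstep i (by omega) s hs
      obtain ⟨s'', t', h', ht', hs''⟩ := ih (i + 1) (by omega) s' hs'
      refine ⟨s'', _, Exec.while_true hb h h', ?_, hs''⟩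
      rw [Nat.succ_mul]
      omega
  exact key N 0 (by omega) s h0

end Machine

/-! ### The program -/

section Code

/-!
Registers: `0` the start of the output area, `1` one, `2` the number of states of the input, `3` the
number of letters, `4` the initial state, `5` the start of the input table, `6` zero, `7` three, `8`
the number of sweeps done, `9` the number of sweeps to do, `10` the start of the list of runs, `11`
its length, `12` the start of the table that is written, `13` the start of the new list of runs,
`14` its length, `15` the letter, `16` the position in the old list, `17` the last transition code
found for this letter, `18`-`21` auxiliary.
-/

/-- Read the transition from one run with one letter, write its code, and start a new run if it is
different from the last transition found for this letter. -/
def entryProgram : Program :=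
  .seq (block [(18, .add 10 16), (18, .load 18), (18, .mul 18 3), (18, .add 18 15),
    (18, .add 18 5), (19, .load 18), (20, .mul 16 3), (20, .add 20 15), (20, .add 20 12)])
  (.seq (.ite (.eq 19 6) (.store 20 6)
    (.seq (.ite (.eq 19 17) .skip
      (.seq (block [(18, .add 13 14), (21, .sub 19 1)])
        (.seq (.store 18 21) (block [(14, .add 14 1), (17, .add 19 6)]))))
      (.store 20 14)))
    (block [(16, .add 16 1)]))

/-- Process all runs for one letter. -/
def letterProgram : Program :=
  .seq (block [(17, .const 0), (16, .const 0)])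
    (.seq (.while (.lt 16 11) entryProgram) (block [(15, .add 15 1)]))

/-- One sweep. The output area, the table and the new list are put behind the old list. -/
def sweepProgram : Program :=
  .seq (block [(0, .add 10 11), (12, .add 0 7), (12, .add 12 11), (18, .mul 11 3),
    (13, .add 12 18)])
  (.seq (.store 13 4) (.seq (block [(14, .const 1), (15, .const 0)])
    (.seq (.while (.lt 15 3) letterProgram)
      (block [(10, .add 13 6), (11, .add 14 6), (8, .add 8 1)]))))

/-- Write whether the state of a run is accepting. -/
def acceptProgram : Program :=
  .seq (block [(20, .add 10 16), (20, .load 20), (20, .add 20 7), (20, .load 20), (21, .add 18 16)])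
    (.seq (.store 21 20) (block [(16, .add 16 1)]))

/-- The minimum Wheeler DFA from the minimum DFA: `n + n ^ 2` sweeps, then the header of the output
and the accepting states. -/
def mainProgram : Program :=
  .seq (block [(1, .const 1), (7, .const 3), (2, .load 6), (3, .load 1), (18, .const 2),
    (4, .load 18), (5, .add 7 2), (18, .mul 2 3), (10, .add 5 18), (9, .mul 2 2), (9, .add 2 9),
    (11, .const 1), (8, .const 0)])
  (.seq (.store 10 4) (.seq (.while (.lt 8 9) sweepProgram)
    (.seq (.store 0 11) (.seq (block [(18, .add 0 1)]) (.seq (.store 18 3)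
      (.seq (block [(18, .add 18 1)]) (.seq (.store 18 6) (.seq (block [(18, .add 18 1),
        (16, .const 0)]) (.while (.lt 16 11) acceptProgram)))))))))

end Code

section Entry

variable {σ n : ℕ}

/-- The input stands at the beginning of the memory. -/
structure HoldsDFA (A : PDFA (Fin σ) (Fin n)) (mem : ℕ → ℕ) : Prop where
  states : mem 0 = n
  letters : mem 1 = σ
  init : mem 2 = A.init
  accept : ∀ q : Fin n, mem (3 + q) = (A.accept q).toNat
  table : ∀ x < n, ∀ c < σ, mem (3 + n + (x * σ + c)) = A.code x c

theorem mul_add_lt_mul {a b r σ : ℕ} (ha : a < r) (hb : b < σ) : a * σ + b < r * σ := by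
  calc a * σ + b < a * σ + σ := by omega
    _ = (a + 1) * σ := by ring
    _ ≤ r * σ := Nat.mul_le_mul_right σ ha

theorem HoldsDFA.congr {A : PDFA (Fin σ) (Fin n)} {mem mem' : ℕ → ℕ} (h : HoldsDFA A mem)
    (hm : ∀ a < 3 + n + n * σ, mem' a = mem a) : HoldsDFA A mem' := by
  refine ⟨?_, ?_, ?_, fun q => ?_, fun x hx c hc => ?_⟩
  · rw [hm 0 (by omega), h.states]
  · rw [hm 1 (by omega), h.letters]
  · rw [hm 2 (by omega), h.init]
  · rw [hm _ (by omega), h.accept]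
  · have := mul_add_lt_mul hx hc
    rw [hm _ (by omega), h.table x hx c hc]

/-- The memory during a sweep, when the letters below `c` and, for the letter `c`, the first `j`
runs have been processed.  The old list starts at address `a`; `mem₀` is the memory before. -/
structure SweepInv (A : PDFA (Fin σ) (Fin n)) (R : ℕ → ℕ) (r a : ℕ) (mem₀ : ℕ → ℕ) (c j : ℕ)
    (mem : ℕ → ℕ) : Prop where
  old : ∀ i < a + r, mem i = mem₀ i
  table : ∀ d < σ, ∀ i < r, (d < c ∨ d = c ∧ i < j) →
    mem (a + r + 3 + r + (i * σ + d)) = sweepCode A.code R r d i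
  zero : mem (a + r + 3 + r + r * σ) = A.init
  fresh : ∀ d, ∀ i < r, (d < c ∨ d = c ∧ i < j) → IsFresh A.code R d i →
    mem (a + r + 3 + r + r * σ + sweepCount A.code R r d i) = A.code (R i) d - 1

theorem mul_add_inj {a a' b b' σ : ℕ} (hb : b < σ) (hb' : b' < σ)
    (h : a * σ + b = a' * σ + b') : a = a' ∧ b = b' := by
  have hσ : 0 < σ := by omega
  have h1 := congrArg (· / σ) h
  have h2 := congrArg (· % σ) h
  simp only [Nat.mul_comm _ σ, Nat.mul_add_div hσ, Nat.mul_add_mod, Nat.div_eq_of_lt hb,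
    Nat.div_eq_of_lt hb', Nat.mod_eq_of_lt hb, Nat.mod_eq_of_lt hb'] at h1 h2
  exact ⟨by omega, h2⟩

/-- Processing the `j`-th run for the letter `c` writes one entry of the table and, if a new run is
started, its state; the two memory cells have not been written before in this sweep. -/
theorem SweepInv.step {A : PDFA (Fin σ) (Fin n)} {R : ℕ → ℕ} {r a c j : ℕ} {mem₀ mem mem' : ℕ → ℕ}
    (h : SweepInv A R r a mem₀ c j mem) (hc : c < σ) (hj : j < r)
    (hframe : ∀ i, i ≠ a + r + 3 + r + (j * σ + c) →
      (IsFresh A.code R c j → i ≠ a + r + 3 + r + r * σ + sweepCount A.code R r c j) →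
      mem' i = mem i)
    (htable : mem' (a + r + 3 + r + (j * σ + c)) = sweepCode A.code R r c j)
    (hfresh : IsFresh A.code R c j →
      mem' (a + r + 3 + r + r * σ + sweepCount A.code R r c j) = A.code (R j) c - 1) :
    SweepInv A R r a mem₀ c (j + 1) mem' := by
  have hlt := mul_add_lt_mul hj hc
  have hpos := one_le_blockStart (δ := A.code) (R := R) (r := r) c
  have hcount := blockStart_le_sweepCount (δ := A.code) (R := R) (r := r) c j
  refine ⟨fun i hi => ?_, fun d hd i hi hdi => ?_, ?_, fun d i hi hdi hf => ?_⟩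
  · rw [hframe i (by omega) fun _ => by omega, h.old i hi]
  · by_cases heq : d = c ∧ i = j
    · obtain ⟨rfl, rfl⟩ := heq
      exact htable
    · have := mul_add_lt_mul hi hd
      rw [hframe _ (fun he => heq (mul_add_inj hd hc (by omega)).symm) fun _ => by omega,
        h.table d hd i hi (by omega)]
  · rw [hframe _ (by omega) fun _ => by omega, h.zero]
  · by_cases heq : d = c ∧ i = j
    · obtain ⟨rfl, rfl⟩ := heq
      exact hfresh hf
    · have hdi' : d < c ∨ d = c ∧ i < j := by omega
      -- earlier runs have smaller numbers
      have hearlier : sweepCount A.code R r d (i + 1) ≤ sweepCount A.code R r c j := by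
        rcases hdi' with hd | ⟨rfl, hij⟩
        · exact (sweepCount_le_blockStart hd hi).trans hcount
        · exact sweepCount_mono d hij
      rw [sweepCount_succ, if_pos hf] at hearlier
      rw [hframe _ (by omega) fun _ => by omega, h.fresh d i hi hdi' hf]

theorem SweepInv.next_letter {A : PDFA (Fin σ) (Fin n)} {R : ℕ → ℕ} {r a c : ℕ} {mem₀ mem : ℕ → ℕ}
    (h : SweepInv A R r a mem₀ c r mem) : SweepInv A R r a mem₀ (c + 1) 0 mem :=
  ⟨h.old, fun d hd i hi hdi => h.table d hd i hi (by omega), h.zero,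
    fun d i hi hdi hf => h.fresh d i hi (by omega) hf⟩

end Entry

/-! ### A sweep on the machine -/

section Sweeps

variable {σ n : ℕ}

/-- The registers during a sweep of the `r` runs whose list starts at address `a`: the output area
follows the list, three cells of it are left for the header and `r` for the accepting states, then
comes the table, then the new list. -/
def sweepRegs (n σ q₀ it d a r cnt c j last x e y z : ℕ) : List ℕ :=
  [a + r, 1, n, σ, q₀, 3 + n, 0, 3, it, d, a, r, a + r + 3 + r, a + r + 3 + r + r * σ, cnt, c, j,
    last, x, e, y, z]

/-- The state of the machine after the letters below `c` and, for `c`, the first `j` runs have been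
processed. -/
def SweepState (A : PDFA (Fin σ) (Fin n)) (R : ℕ → ℕ) (r a : ℕ) (mem₀ : ℕ → ℕ) (it d c j : ℕ)
    (s : RAMState) : Prop :=
  ∃ x e y z mem, s = ⟨regs (sweepRegs n σ A.init it d a r (sweepCount A.code R r c j) c j
    (lastCode A.code R c j) x e y z), mem⟩ ∧ SweepInv A R r a mem₀ c j mem

/-- What a sweep finds: the input, and behind it, from address `a` on, the list of runs; and the
words of the machine are large enough for the addresses used. -/
structure SweepInput (W : ℕ) (A : PDFA (Fin σ) (Fin n)) (R : ℕ → ℕ) (r a : ℕ) (mem₀ : ℕ → ℕ) :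
    Prop where
  input : HoldsDFA A mem₀
  le : 3 + n + n * σ ≤ a
  list : ∀ j < r, mem₀ (a + j) = R j
  lt : ∀ j < r, R j < n
  word : a + 2 * r + 2 * (r * σ) + 5 ≤ W

variable {W : ℕ} {A : PDFA (Fin σ) (Fin n)} {R : ℕ → ℕ} {r a : ℕ} {mem₀ : ℕ → ℕ}

theorem sweepCount_le_word {δ : ℕ → ℕ → ℕ} {c j : ℕ} (hc : c < σ) (hj : j ≤ r) :
    sweepCount δ R r c j ≤ 1 + r * σ := by
  have := blockStart_le (δ := δ) (R := R) (r := r) σ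
  rw [Nat.mul_comm] at this
  exact (sweepCount_le_blockStart hc hj).trans this

/-- The machine performs one step of `lastCode`, `sweepCount` and `sweepCode`. -/
theorem runs_entryProgram (hin : SweepInput W A R r a mem₀) {it d c j : ℕ} (hc : c < σ) (hj : j < r)
    {s : RAMState} (hs : SweepState A R r a mem₀ it d c j s) :
    Runs W entryProgram s 24 (SweepState A R r a mem₀ it d c (j + 1)) := by
  obtain ⟨x, e, y, z, mem, rfl, hinv⟩ := hs
  have hmem : mem (a + j) = R j := by rw [hinv.old _ (by omega), hin.list j hj]
  have hRn := hin.lt j hj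
  have hRc := mul_add_lt_mul hRn hc
  have hjc := mul_add_lt_mul hj hc
  have hle := hin.le
  have hword := hin.word
  have htab : mem (R j * σ + c + (3 + n)) = A.code (R j) c := by
    rw [Nat.add_comm, hinv.old _ (by omega), hin.input.table _ hRn _ hc]
  have hcode := A.code_le (R j) c
  have hcount := sweepCount_le_word (δ := A.code) (R := R) hc (Nat.le_of_lt hj)
  set cnt := sweepCount A.code R r c j with hcnt
  set last := lastCode A.code R c j with hlast
  refine (runs_block_seq (T := 13) ?_ ?_).mono (by simp)
  · simp [SafeBlock, Rhs.eval, regs, sweepRegs, hmem, htab]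
    omega
  have hval : evalBlock mem [(18, .add 10 16), (18, .load 18), (18, .mul 18 3), (18, .add 18 15),
      (18, .add 18 5), (19, .load 18), (20, .mul 16 3), (20, .add 20 15), (20, .add 20 12)]
      (sweepRegs n σ A.init it d a r cnt c j last x e y z) =
      sweepRegs n σ A.init it d a r cnt c j last (R j * σ + c + (3 + n)) (A.code (R j) c)
        (j * σ + c + (a + r + 3 + r)) z := by
    simp [evalBlock, Rhs.eval, regs, sweepRegs, hmem, htab]
  rw [hval]
  have haddr : j * σ + c + (a + r + 3 + r) = a + r + 3 + r + (j * σ + c) := by omega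
  have hlast' : lastCode A.code R c (j + 1) = if A.code (R j) c = 0 then last else A.code (R j) c :=
    rfl
  have hcnt' : sweepCount A.code R r c (j + 1) = cnt + if IsFresh A.code R c j then 1 else 0 := rfl
  refine Runs.seq (T := 11) (T' := 2) (Q' := fun s' => ∃ x e y z mem', s' = ⟨regs (sweepRegs n σ
    A.init it d a r (sweepCount A.code R r c (j + 1)) c j (lastCode A.code R c (j + 1)) x e y z),
    mem'⟩ ∧ SweepInv A R r a mem₀ c (j + 1) mem') ?_ ?_
  swap
  · rintro s' ⟨x, e, y, z, mem', rfl, hinv'⟩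
    refine runs_block ?_ ⟨x, e, y, z, mem', ?_, hinv'⟩
    · simp [SafeBlock, Rhs.eval, regs, sweepRegs]
      omega
    · simp [evalBlock, Rhs.eval, regs, sweepRegs]
  refine runs_ite (T := 10) (fun hb => ?_) fun hb => ?_
  · -- no transition
    have hb : A.code (R j) c = 0 := hb
    have hf : ¬ IsFresh A.code R c j := fun h => h.1 hb
    rw [hlast', if_pos hb, hcnt', if_neg hf]
    refine (runs_store ⟨_, _, _, _, _, rfl, hinv.step hc hj (fun i hi _ => ?_) ?_
      fun h => absurd h hf⟩).mono (by omega)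
    · rw [← haddr] at hi
      exact Function.update_of_ne hi _ _
    · rw [← haddr]
      refine (Function.update_self _ _ _).trans ?_
      rw [sweepCode, if_pos hb]
      rfl
  have hb : A.code (R j) c ≠ 0 := hb
  have hsc : sweepCode A.code R r c j = sweepCount A.code R r c (j + 1) := if_neg hb
  rw [if_neg hb] at hlast'
  -- a new run, if there is one, is started before the table entry is written
  refine Runs.seq (T := 9) (T' := 1) (Q' := fun s' => ∃ x z mem', s' = ⟨regs (sweepRegs n σ A.init
    it d a r (sweepCount A.code R r c (j + 1)) c j (lastCode A.code R c (j + 1)) x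
    (A.code (R j) c) (j * σ + c + (a + r + 3 + r)) z), mem'⟩ ∧
    (∀ i, (IsFresh A.code R c j → i ≠ a + r + 3 + r + r * σ + cnt) → mem' i = mem i) ∧
    (IsFresh A.code R c j → mem' (a + r + 3 + r + r * σ + cnt) = A.code (R j) c - 1)) ?_ ?_
  swap
  · rintro s' ⟨x, z, mem', rfl, hframe, hfresh⟩
    refine runs_store ⟨_, _, _, _, _, rfl, hinv.step hc hj (fun i hi hi' => ?_) ?_ fun h => ?_⟩
    · rw [← haddr] at hi
      exact (Function.update_of_ne hi _ _).trans (hframe i hi')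
    · rw [← haddr, hsc]
      exact Function.update_self _ _ _
    · rw [← hfresh h]
      refine Function.update_of_ne ?_ _ _
      change _ ≠ j * σ + c + (a + r + 3 + r)
      omega
  refine runs_ite (T := 8) (fun hb' => ?_) fun hb' => ?_
  · -- the same transition as the last one
    have hb' : A.code (R j) c = last := hb'
    have hf : ¬ IsFresh A.code R c j := fun h => h.2 hb'
    rw [hlast', hcnt', if_neg hf]
    refine (runs_skip ⟨R j * σ + c + (3 + n), z, mem, ?_, fun i _ => rfl,
      fun h => absurd h hf⟩).mono (by omega)
    rw [hb']
    rfl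
  · have hb' : A.code (R j) c ≠ last := hb'
    have hf : IsFresh A.code R c j := ⟨hb, hb'⟩
    rw [hlast', hcnt', if_pos hf]
    have haddr' : a + r + 3 + r + r * σ + cnt ≤ W := by omega
    refine (runs_block_seq (T := 4) ?_ (runs_store_seq (T := 3) (runs_block ?_
      ⟨a + r + 3 + r + r * σ + cnt, A.code (R j) c - 1, Function.update mem
        (a + r + 3 + r + r * σ + cnt) (A.code (R j) c - 1), ?_,
        fun i hi => Function.update_of_ne (hi hf) _ _, fun _ => Function.update_self _ _ _⟩))).mono
      (by simp)
    · simp [SafeBlock, Rhs.eval, regs, sweepRegs]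
      omega
    · simp [SafeBlock, evalBlock, Rhs.eval, regs, sweepRegs]
      omega
    · simp [evalBlock, Rhs.eval, regs, sweepRegs]

end Sweeps

section Loop

variable {σ n : ℕ} {W : ℕ} {A : PDFA (Fin σ) (Fin n)} {R : ℕ → ℕ} {r a : ℕ} {mem₀ : ℕ → ℕ}

/-- The state of the machine between the processing of two letters. -/
def LetterState (A : PDFA (Fin σ) (Fin n)) (R : ℕ → ℕ) (r a : ℕ) (mem₀ : ℕ → ℕ) (it d c : ℕ)
    (s : RAMState) : Prop :=
  ∃ j last x e y z mem, s = ⟨regs (sweepRegs n σ A.init it d a r (blockStart A.code R r c) c j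
    last x e y z), mem⟩ ∧ SweepInv A R r a mem₀ c 0 mem

theorem runs_letterProgram (hin : SweepInput W A R r a mem₀) {it d c : ℕ} (hc : c < σ)
    (hσ : σ ≤ W) {s : RAMState} (hs : LetterState A R r a mem₀ it d c s) :
    Runs W letterProgram s (r * 25 + 6) (LetterState A R r a mem₀ it d (c + 1)) := by
  obtain ⟨j, last, x, e, y, z, mem, rfl, hinv⟩ := hs
  refine (runs_block_seq (T := r * 25 + 1 + 2) ?_ (Runs.seq
    (Q' := SweepState A R r a mem₀ it d c r) (runs_while (SweepState A R r a mem₀ it d c)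
    (fun j hj s hs => ⟨?_, runs_entryProgram hin hc hj hs⟩) ?_ ?_) ?_)).mono (by simp; omega)
  · simp [SafeBlock, Rhs.eval, sweepRegs]
  · obtain ⟨x, e, y, z, mem, rfl, -⟩ := hs
    exact hj
  · rintro s ⟨x, e, y, z, mem, rfl, -⟩
    exact lt_irrefl r
  · exact ⟨x, e, y, z, mem, rfl, hinv⟩
  · rintro s ⟨x, e, y, z, mem, rfl, hinv⟩
    refine runs_block ?_ ⟨r, lastCode A.code R c r, x, e, y, z, mem, ?_, hinv.next_letter⟩
    · simp [SafeBlock, Rhs.eval, regs, sweepRegs]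
      omega
    · rfl

/-- The registers between two sweeps, after `it` of `d` sweeps: the output area starts at `o`, the
list of the `r` runs at `a`, and `aux` holds the registers from `12` on. -/
def mainRegs (n σ q₀ it d o a r : ℕ) (aux : Fin 10 → ℕ) : List ℕ :=
  [o, 1, n, σ, q₀, 3 + n, 0, 3, it, d, a, r, aux 0, aux 1, aux 2, aux 3, aux 4, aux 5, aux 6, aux 7,
    aux 8, aux 9]

theorem runs_sweepProgram (hin : SweepInput W A R r a mem₀) {it d o : ℕ} {aux : Fin 10 → ℕ}
    (hit : it < W) :
    Runs W sweepProgram ⟨regs (mainRegs n σ A.init it d o a r aux), mem₀⟩ (σ * (r * 25 + 7) + 15)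
      fun s => ∃ aux mem, s = ⟨regs (mainRegs n σ A.init (it + 1) d (a + r)
        (a + r + 3 + r + r * σ) (blockStart A.code R r σ) aux), mem⟩ ∧
        SweepInv A R r a mem₀ σ 0 mem := by
  have hword := hin.word
  have hle := hin.le
  have hn : 0 < n := A.init.pos
  have hσ : σ ≤ W := by nlinarith
  have hcount : blockStart A.code R r σ ≤ 1 + r * σ := by
    have := blockStart_le (δ := A.code) (R := R) (r := r) σ
    rwa [Nat.mul_comm] at this
  refine (runs_block_seq (T := 1 + (3 + (σ * (r * 25 + 7) + 1 + 4))) ?_ (runs_store_seq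
    (runs_block_seq ?_ (Runs.seq (Q' := LetterState A R r a mem₀ it d σ)
    (runs_while (LetterState A R r a mem₀ it d)
    (fun c hc s hs => ⟨?_, runs_letterProgram hin hc hσ hs⟩) ?_ ?_) ?_)))).mono (by simp; omega)
  · simp [SafeBlock, Rhs.eval, regs, mainRegs]
    omega
  · simp [SafeBlock, Rhs.eval, evalBlock, regs, mainRegs]
    omega
  · obtain ⟨j, last, x, e, y, z, mem, rfl, -⟩ := hs
    exact hc
  · rintro s ⟨j, last, x, e, y, z, mem, rfl, -⟩
    exact lt_irrefl σ
  · refine ⟨aux 4, aux 5, r * σ, aux 7, aux 8, aux 9, Function.update mem₀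
      (a + r + 3 + r + r * σ) A.init, rfl, fun i hi => ?_, fun c hc i hi h => by omega, ?_,
      fun c i hi h => by omega⟩
    · exact Function.update_of_ne (by omega) _ _
    · exact Function.update_self _ _ _
  · rintro s ⟨j, last, x, e, y, z, mem, rfl, hinv⟩
    refine runs_block ?_ ⟨![a + r + 3 + r, a + r + 3 + r + r * σ, blockStart A.code R r σ, σ, j, last,
      x, e, y, z], mem, ?_, hinv⟩
    · simp [SafeBlock, Rhs.eval, regs, sweepRegs]
      omega
    · rfl

/-- What the last sweep has written: the table from address `o + 3 + r₀` on, for the list of runs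
found by the sweep before. -/
def SweepResult (A : PDFA (Fin σ) (Fin n)) (l r : ℕ) (R : ℕ → ℕ) (o a : ℕ) (mem : ℕ → ℕ) : Prop :=
  ∃ r₀ R₀ idx₀, IsRunList A l r₀ R₀ idx₀ ∧ r = blockStart A.code R₀ r₀ σ ∧
    IsRunList A (l + 1) r R (nextIdx A.code R₀ r₀ idx₀) ∧ a = o + 3 + r₀ + r₀ * σ ∧
    3 + n + n * σ ≤ o ∧
    ∀ c < σ, ∀ i < r₀, mem (o + 3 + r₀ + (i * σ + c)) = sweepCode A.code R₀ r₀ c i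

/-- The state of the machine after `it` sweeps, if no list of runs is longer than `M`: each sweep
moves the start of the list by at most `2 * M + 3 + 2 * (M * σ)` cells. -/
def MainState (A : PDFA (Fin σ) (Fin n)) (M d it : ℕ) (s : RAMState) : Prop :=
  ∃ o a r aux R idx mem, s = ⟨regs (mainRegs n σ A.init it d o a r aux), mem⟩ ∧
    HoldsDFA A mem ∧ 3 + n + n * σ ≤ a ∧ a ≤ 3 + n + n * σ + it * (2 * M + 3 + 2 * (M * σ)) ∧
    (∀ j < r, mem (a + j) = R j) ∧ IsRunList A it r R idx ∧
    ∀ l, it = l + 1 → SweepResult A l r R o a mem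

theorem IsRunList.state_lt {l : ℕ} {idx : List (Fin σ) → ℕ} (h : IsRunList A l r R idx) {j : ℕ}
    (hj : j < r) : R j < n := by
  obtain ⟨u, hu, rfl⟩ := h.onto j hj
  obtain ⟨q, hq⟩ := A.exists_run_of_mem_prefixes hu.1
  rw [h.state u hu q hq]
  exact q.isLt

/-- Enough memory for the lists of runs and tables of all sweeps, if no list of runs is longer than
`M`. -/
def wordBound (n σ M : ℕ) : ℕ :=
  3 + n + n * σ + (n + n ^ 2 + 1) * (2 * M + 3 + 2 * (M * σ)) + 5

theorem runs_sweepProgram_step (hA : IsBasic A.toNFA) {M : ℕ}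
    (hM : ∀ l ≤ n + n ^ 2, ∀ r R idx, IsRunList A l r R idx → r ≤ M) (hW : wordBound n σ M ≤ W)
    {it : ℕ} (hit : it < n + n ^ 2) {s : RAMState} (hs : MainState A M (n + n ^ 2) it s) :
    Runs W sweepProgram s (σ * (M * 25 + 7) + 15) (MainState A M (n + n ^ 2) (it + 1)) := by
  obtain ⟨o, a, r, aux, R, idx, mem, rfl, hmem, hle, hle', hlist, hrun, -⟩ := hs
  have hr : r ≤ M := hM it hit.le r R idx hrun
  have hrσ : r * σ ≤ M * σ := Nat.mul_le_mul_right σ hr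
  have hspace : (it + 2) * (2 * M + 3 + 2 * (M * σ)) ≤
      (n + n ^ 2 + 1) * (2 * M + 3 + 2 * (M * σ)) := Nat.mul_le_mul_right _ (by omega)
  rw [wordBound] at hW
  have hspace' : it + 2 ≤ (it + 2) * (2 * M + 3 + 2 * (M * σ)) :=
    Nat.le_mul_of_pos_right _ (by omega)
  rw [Nat.add_mul it 2] at hspace hspace'
  have hin : SweepInput W A R r a mem := ⟨hmem, hle, hlist, fun j hj => hrun.state_lt hj, by omega⟩
  obtain ⟨s', t, hex, ht, aux', mem', rfl, hinv⟩ := runs_sweepProgram (d := n + n ^ 2) (o := o)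
    (aux := aux) hin (show it < W by omega)
  refine ⟨_, t, hex, ht.trans ?_, ?_⟩
  · exact Nat.add_le_add_right (Nat.mul_le_mul_left σ (by omega)) 15
  have hnext : IsRunList A (it + 1) (blockStart A.code R r σ)
      (fun i => mem' (a + r + 3 + r + r * σ + i)) (nextIdx A.code R r idx) :=
    hrun.next hA hinv.zero fun c hc j hj hf => hinv.fresh c j hj (Or.inl hc) hf
  refine ⟨_, _, _, aux', _, _, mem', rfl, hmem.congr fun i hi => hinv.old i (by omega), by omega,
    ?_, fun j hj => rfl, hnext, fun l hl => ?_⟩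
  · rw [Nat.succ_mul]
    omega
  · obtain rfl : it = l := by omega
    exact ⟨r, R, idx, hrun, rfl, hnext, rfl, by omega,
      fun c hc i hi => hinv.table c hc i hi (Or.inl hc)⟩

/-- The state of the machine after `j` rounds of the loop that writes the accepting states; `mem₀`
is the memory before it. -/
def AcceptState (A : PDFA (Fin σ) (Fin n)) (R : ℕ → ℕ) (d o a r : ℕ) (mem₀ : ℕ → ℕ) (j : ℕ)
    (s : RAMState) : Prop :=
  ∃ aux mem, s = ⟨regs (mainRegs n σ A.init d d o a r aux), mem⟩ ∧ aux 4 = j ∧ aux 6 = o + 3 ∧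
    (∀ i, (i < o + 3 ∨ o + 3 + r ≤ i) → mem i = mem₀ i) ∧
    ∀ i < j, mem (o + 3 + i) = mem₀ (3 + R i)

theorem runs_acceptProgram {d o j : ℕ} (ho : 3 + n ≤ o) (hoa : o + 3 + r ≤ a) (haW : a + r ≤ W)
    (hlist : ∀ j < r, mem₀ (a + j) = R j) (hRn : ∀ j < r, R j < n)
    (hacc : ∀ q < n, mem₀ (3 + q) ≤ 1) (hj : j < r) (hd : 1 ≤ W)
    {s : RAMState} (hs : AcceptState A R d o a r mem₀ j s) :
    Runs W acceptProgram s 9 (AcceptState A R d o a r mem₀ (j + 1)) := by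
  obtain ⟨aux, mem, rfl, h4, h6, hframe, hdone⟩ := hs
  have hRj := hRn j hj
  have hmem : mem (a + j) = R j := by rw [hframe _ (by omega), hlist j hj]
  have hmem' : mem (R j + 3) = mem₀ (3 + R j) := by rw [hframe _ (by omega), Nat.add_comm]
  have hacc := hacc _ hRj
  refine (runs_block_seq (T := 3) ?_ (runs_store_seq (T := 2) (runs_block ?_
    ⟨![aux 0, aux 1, aux 2, aux 3, j + 1, aux 5, o + 3, aux 7, mem₀ (3 + R j), o + 3 + j],
      Function.update mem (o + 3 + j) (mem₀ (3 + R j)), ?_, rfl, rfl, fun i hi => ?_,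
      fun i hi => ?_⟩))).mono (by simp)
  · simp [SafeBlock, Rhs.eval, regs, mainRegs, h4, h6, hmem, hmem']
    omega
  · simp [SafeBlock, Rhs.eval, evalBlock, regs, mainRegs, h4]
    omega
  · simp [Rhs.eval, evalBlock, regs, mainRegs, h4, h6, hmem, hmem']
  · rw [Function.update_of_ne (by omega), hframe i hi]
  · rcases Nat.lt_succ_iff_lt_or_eq.1 hi with hi | rfl
    · rw [Function.update_of_ne (by omega), hdone i hi]
    · exact Function.update_self _ _ _

end Loop

/-! ### The encoding of automata -/

section Encoding

variable {σ n : ℕ}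

theorem encodeDFA_eq (A : PDFA (Fin σ) (Fin n)) : encodeDFA A =
    [n, σ, A.init.val] ++ (List.ofFn (fun q => (A.accept q).toNat) ++
      List.ofFn fun k : Fin (n * σ) => A.code (k / σ) (k % σ)) := by
  rw [encodeDFA, List.append_assoc, List.ofFn_mul]
  congr 4
  funext q
  congr 1
  funext c
  rw [← A.code_eq]
  have hσ : 0 < σ := c.pos
  congr 1
  · change (q : ℕ) = (q * σ + c) / σ
    rw [Nat.mul_comm, Nat.mul_add_div hσ, Nat.div_eq_of_lt c.isLt, Nat.add_zero]
  · change (c : ℕ) = (q * σ + c) % σ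
    rw [Nat.mul_comm, Nat.mul_add_mod, Nat.mod_eq_of_lt c.isLt]

theorem length_encodeDFA (A : PDFA (Fin σ) (Fin n)) : (encodeDFA A).length = 3 + n + n * σ := by
  rw [encodeDFA_eq]
  simp
  omega

theorem encodeDFA_getElem? (A : PDFA (Fin σ) (Fin n)) :
    (encodeDFA A)[0]? = some n ∧ (encodeDFA A)[1]? = some σ ∧
      (encodeDFA A)[2]? = some A.init.val ∧
      (∀ q : Fin n, (encodeDFA A)[3 + (q : ℕ)]? = some (A.accept q).toNat) ∧
      ∀ x < n, ∀ c < σ, (encodeDFA A)[3 + n + (x * σ + c)]? = some (A.code x c) := by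
  rw [encodeDFA_eq]
  refine ⟨rfl, rfl, rfl, fun q => ?_, fun x hx c hc => ?_⟩
  · rw [List.getElem?_append_right (by simp), List.getElem?_append_left (by simp)]
    simp
  · have := mul_add_lt_mul hx hc
    have hσ : 0 < σ := by omega
    rw [List.getElem?_append_right (by simp; omega), List.getElem?_append_right (by simp; omega)]
    rw [show 3 + n + (x * σ + c) - [n, σ, A.init.val].length -
      (List.ofFn fun q => (A.accept q).toNat).length = x * σ + c by simp; omega]
    rw [List.getElem?_ofFn, dif_pos this]
    simp only [Nat.mul_comm x σ, Nat.mul_add_div hσ, Nat.mul_add_mod, Nat.div_eq_of_lt hc,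
      Nat.mod_eq_of_lt hc, Nat.add_zero]

theorem holdsDFA_loadInput (A : PDFA (Fin σ) (Fin n)) (x : List ℕ) :
    HoldsDFA A (loadInput (encodeDFA A ++ x)).mem := by
  have key : ∀ i v, (encodeDFA A)[i]? = some v → (loadInput (encodeDFA A ++ x)).mem i = v := by
    intro i v h
    have hi : i < (encodeDFA A).length := (List.getElem?_eq_some_iff.1 h).1
    change (encodeDFA A ++ x).getD i 0 = v
    rw [List.getD_eq_getElem?_getD, List.getElem?_append_left hi, h]
    rfl
  obtain ⟨h0, h1, h2, h3, h4⟩ := encodeDFA_getElem? A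
  exact ⟨key _ _ h0, key _ _ h1, key _ _ h2, fun q => key _ _ (h3 q),
    fun x hx c hc => key _ _ (h4 x hx c hc)⟩

theorem hasOutput_encodeDFA {B : PDFA (Fin σ) (Fin n)} {s : RAMState}
    (h : HoldsDFA B fun i => s.mem (s.reg 0 + i)) : HasOutput s (encodeDFA B) := by
  obtain ⟨h0, h1, h2, h3, h4⟩ := encodeDFA_getElem? B
  have key : ∀ i, i < 3 + n + n * σ → (encodeDFA B)[i]? = some (s.mem (s.reg 0 + i)) := by
    intro i hi
    rcases Nat.lt_or_ge i 3 with h3' | h3'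
    · interval_cases i
      · rw [h0]; exact congrArg some h.states.symm
      · rw [h1]; exact congrArg some h.letters.symm
      · rw [h2]; exact congrArg some h.init.symm
    obtain ⟨i, rfl⟩ := Nat.exists_eq_add_of_le h3'
    rcases Nat.lt_or_ge i n with hn | hn
    · rw [h3 ⟨i, hn⟩]
      exact congrArg some (h.accept ⟨i, hn⟩).symm
    obtain ⟨i, rfl⟩ := Nat.exists_eq_add_of_le hn
    rw [← Nat.add_assoc] at hi ⊢
    have hi' : i < n * σ := by omega
    have hσ : 0 < σ := Nat.pos_of_ne_zero (by rintro rfl; simp at hi')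
    have hx : i / σ < n := Nat.div_lt_of_lt_mul (by rwa [Nat.mul_comm])
    have hc : i % σ < σ := Nat.mod_lt i hσ
    have hi'' : i / σ * σ + i % σ = i := by rw [Nat.mul_comm]; exact Nat.div_add_mod i σ
    have e1 := h4 _ hx _ hc
    have e2 := h.table _ hx _ hc
    simp only [hi''] at e1 e2
    rw [e1, ← e2]
  intro i hi
  have := key i (by rwa [length_encodeDFA] at hi)
  rw [List.getElem?_eq_getElem hi, Option.some_inj] at this
  exact this.symm

end Encoding

/-! ### Correctness of the program -/

section Main

variable {σ n : ℕ} {W : ℕ} {A : PDFA (Fin σ) (Fin n)}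

/-- The table of the last sweep is the table of the automaton of runs. -/
theorem runAutomaton_code {R R' : ℕ → ℕ} {r : ℕ} [NeZero (blockStart A.code R r σ)]
    {x c : ℕ} (hx : x < r) (hxm : x < blockStart A.code R r σ) (hc : c < σ) :
    (runAutomaton A R R' r (blockStart A.code R r σ)).code x c = sweepCode A.code R r c x := by
  rw [PDFA.code, dif_pos ⟨hxm, hc⟩]
  have hle : sweepCode A.code R r c x ≤ blockStart A.code R r σ := by
    rw [sweepCode]
    split_ifs
    · exact Nat.zero_le _
    · exact sweepCount_le_blockStart hc hx
  by_cases h0 : sweepCode A.code R r c x = 0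
  · simp [runAutomaton, h0]
  · simp only [runAutomaton]
    rw [dif_pos ⟨h0, hle⟩]
    simp only [Option.map_some, Option.getD_some]
    omega

/-- The time of `mainProgram`, if `m` bounds the number of runs. -/
def mainTime (n σ m : ℕ) : ℕ := (n + n ^ 2) * (σ * (m * 25 + 7) + 16) + 10 * m + 40

/-- The main program computes the minimum Wheeler DFA.  It starts from registers that may hold
anything where it assigns before it reads; the others have to hold `0`. -/
theorem runs_mainProgram (hA : IsMinDFA A) (hL : IsWheelerLanguage A.lang) {M : ℕ}
    (hM : ∀ l ≤ n + n ^ 2, ∀ r R idx, IsRunList A l r R idx → r ≤ M) (hW : wordBound n σ M ≤ W)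
    {mem : ℕ → ℕ} (hmem : HoldsDFA A mem) (b₁ b₂ b₃ b₇ b₁₈ : ℕ) :
    Runs W mainProgram
      ⟨regs [0, b₁, b₂, b₃, 0, 0, 0, b₇, 0, 0, 0, 0, 0, 0, 0, 0, 0, 0, b₁₈, 0, 0, 0], mem⟩
      (mainTime n σ M)
      fun s => ∃ (m : ℕ) (B : PDFA (Fin σ) (Fin m)), IsMinWDFA B A.lang ∧
        HasOutput s (encodeDFA B) ∧ ∃ R idx, IsRunList A (n + n ^ 2) m R idx := by
  have hn : 0 < n := A.init.pos
  have hinit := A.init.isLt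
  have hW' := hW
  rw [wordBound] at hW'
  have hKle : n + n ^ 2 + 1 ≤ (n + n ^ 2 + 1) * (2 * M + 3 + 2 * (M * σ)) :=
    Nat.le_mul_of_pos_right _ (by omega)
  have hσ : σ ≤ n * σ := Nat.le_mul_of_pos_left σ hn
  have hsq : n ^ 2 = n * n := sq n
  have e0 := hmem.states
  have e1 := hmem.letters
  have e2 := hmem.init
  have hd : 0 < n + n ^ 2 := by omega
  refine Runs.mono (T := 14 + (1 + ((n + n ^ 2) * (σ * (M * 25 + 7) + 15 + 1) + 1 +
    (1 + (2 + (1 + (2 + (1 + (3 + (M * (9 + 1) + 1))))))))) ) ?_ ?_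
  swap
  · rw [mainTime, Nat.add_assoc _ 15 1]
    omega
  refine runs_block_seq (p := [_, _, _, _, _, _, _, _, _, _, _, _, _]) ?_ (runs_store_seq ?_)
  · simp [SafeBlock, Rhs.eval, regs, e0, e1, e2]
    omega
  refine Runs.seq (Q' := MainState A M (n + n ^ 2) (n + n ^ 2)) (runs_while
    (MainState A M (n + n ^ 2)) (fun it hit s hs => ⟨?_, runs_sweepProgram_step hA.1 hM hW hit hs⟩)
    ?_ ?_) ?_
  · obtain ⟨o, a, r, aux, R, idx, mem, rfl, -⟩ := hs
    exact hit
  · rintro s ⟨o, a, r, aux, R, idx, mem, rfl, -⟩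
    exact lt_irrefl (n + n ^ 2)
  · refine ⟨0, 3 + n + n * σ, 1, ![0, 0, 0, 0, 0, 0, n * σ, 0, 0, 0],
      fun i => Function.update mem (3 + n + n * σ) A.init (3 + n + n * σ + i), _,
      Function.update mem (3 + n + n * σ) A.init, ?_, hmem.congr fun i hi =>
      Function.update_of_ne (by omega) _ _, le_rfl, by omega, fun j hj => rfl,
      IsRunList.zero hA.1 (Function.update_self _ _ _), fun l hl => by omega⟩
    simp [evalBlock, Rhs.eval, regs, mainRegs, e0, e1, e2, hsq, Nat.add_comm]
  rintro s ⟨o, a, r, aux, R, idx, mem, rfl, hmem, hle, hle', hlist, hrun, hres⟩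
  obtain ⟨l, hl⟩ := Nat.exists_eq_succ_of_ne_zero hd.ne'
  obtain ⟨r₀, R₀, idx₀, hrun₀, hr, hrun₁, ha, ho, htab⟩ := hres l hl
  have hrr : r₀ = r := (hrun₀.stable hrun₁ hA hL (Nat.le_succ l) hl.le).1
  have hrM : r ≤ M := hM _ le_rfl r R idx hrun
  have haW : a + r + 5 ≤ W := by
    rw [Nat.add_mul (n + n ^ 2) 1] at hW'
    omega
  refine Runs.mono (T := 1 + (2 + (1 + (2 + (1 + (3 + (r * (9 + 1) + 1))))))) ?_ (by omega)
  refine runs_store_seq (runs_block_seq (p := [_]) ?_ (runs_store_seq (runs_block_seq (p := [_]) ?_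
    (runs_store_seq (runs_block_seq (p := [_, _]) ?_ ?_)))))
  · simp [SafeBlock, Rhs.eval, regs, mainRegs]
    omega
  · simp [SafeBlock, evalBlock, Rhs.eval, regs, mainRegs]
    omega
  · simp [SafeBlock, evalBlock, Rhs.eval, regs, mainRegs]
    omega
  set mem' := Function.update (Function.update (Function.update mem o r) (o + 1) σ) (o + 2) 0
    with hmem'
  have hframe : ∀ i, (i < o ∨ o + 3 ≤ i) → mem' i = mem i := fun i hi => by
    rw [hmem', Function.update_of_ne (by omega), Function.update_of_ne (by omega),
      Function.update_of_ne (by omega)]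
  obtain ⟨s', t, hex, ht, hs'⟩ := runs_while (b := .lt 16 11) (p := acceptProgram) (W := W)
    (N := r) (T := 9) (s := ⟨regs (mainRegs n σ A.init (n + n ^ 2) (n + n ^ 2) o a r
      ![aux 0, aux 1, aux 2, aux 3, 0, aux 5, o + 3, aux 7, aux 8, aux 9]), mem'⟩)
    (AcceptState A R (n + n ^ 2) o a r mem')
    (fun j hj s hs => ⟨by
        obtain ⟨aux, mem, rfl, h4, -⟩ := hs
        change aux 4 < r
        omega,
      runs_acceptProgram (by omega) (by omega) (by omega)
        (fun j hj => by rw [hframe _ (by omega), hlist j hj]) (fun j hj => hrun.state_lt hj)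
        (fun q hq => by
          rw [hframe _ (by omega), hmem.accept ⟨q, hq⟩]
          exact Bool.toNat_le _) hj (by omega) hs⟩)
    (by
      rintro s ⟨aux, mem, rfl, h4, -⟩
      change ¬ aux 4 < r
      omega)
    ⟨_, mem', rfl, rfl, rfl, fun i _ => rfl, fun i hi => by omega⟩
  refine ⟨s', t, ?_, ht, ?_⟩
  · convert hex using 1
    simp [evalBlock, Rhs.eval, regs, mainRegs, hmem', Nat.add_assoc]
  obtain ⟨aux', mem'', rfl, -, -, hframe', hdone⟩ := hs'
  subst hr
  have : NeZero (blockStart A.code R₀ r₀ σ) := ⟨Nat.one_le_iff_ne_zero.1 (one_le_blockStart σ)⟩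
  refine ⟨_, _, runAutomaton_isMinWDFA hA hL hrun₀ hl hrun₁, hasOutput_encodeDFA ?_, R, idx, hrun⟩
  change HoldsDFA _ fun i => mem'' (o + i)
  refine ⟨?_, ?_, ?_, fun q => ?_, fun x hx c hc => ?_⟩
  · rw [hframe' _ (by omega), hmem', Function.update_of_ne (by omega),
      Function.update_of_ne (by omega), Nat.add_zero, Function.update_self]
  · rw [hframe' _ (by omega), hmem', Function.update_of_ne (by omega), Function.update_self]
  · rw [hframe' _ (by omega), hmem', Function.update_self]
    rfl
  · have hq := hrun.state_lt q.isLt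
    rw [← Nat.add_assoc, hdone q q.isLt, hframe _ (by omega), hmem.accept ⟨R q, hq⟩]
    simp only [runAutomaton]
    rw [dif_pos hq]
  · rw [← hrr] at hx
    have hxc := mul_add_lt_mul hx hc
    rw [runAutomaton_code hx (by omega) hc, ← htab c hc x hx, hframe' _ (by omega),
      hframe _ (by omega)]
    congr 1
    omega

end Main

/-! ### The number of runs -/

section Bounds

variable {σ n : ℕ} {W : ℕ} {A : PDFA (Fin σ) (Fin n)}

theorem IsRunList.le_card {l r : ℕ} {R : ℕ → ℕ} {idx : List (Fin σ) → ℕ}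
    (h : IsRunList A l r R idx) {ι : Type} [Fintype ι] (f : List (Fin σ) → ι)
    (hf : ∀ u ∈ prefixesUpTo A.lang l, ∀ v ∈ prefixesUpTo A.lang l, f u = f v → u = v) :
    r ≤ Fintype.card ι := by
  have hu : ∀ j : Fin r, ∃ u ∈ prefixesUpTo A.lang l, idx u = j := fun j => h.onto j j.isLt
  choose u hu hju using hu
  have hinj : Function.Injective fun j => f (u j) := fun i j hij => by
    apply Fin.ext
    rw [← hju, ← hju, hf _ (hu i) _ (hu j) hij]
  simpa using Fintype.card_le_of_injective _ hinj

/-- A word of length at most `l` is determined by its first `l` letters, where `none` stands behind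
its end. -/
theorem IsRunList.le_pow {l r : ℕ} {R : ℕ → ℕ} {idx : List (Fin σ) → ℕ}
    (h : IsRunList A l r R idx) : r ≤ (σ + 1) ^ l := by
  have := h.le_card (fun u (i : Fin l) => u[(i : ℕ)]?) fun u hu v hv huv => by
    refine List.ext_getElem? fun i => ?_
    by_cases hi : i < l
    · exact congrFun huv ⟨i, hi⟩
    · rw [List.getElem?_eq_none (by have := hu.2; omega),
        List.getElem?_eq_none (by have := hv.2; omega)]
  simpa using this

/-- The main program takes space and time as for lists of `m` runs, where `m` is the number of states
of the minimum Wheeler DFA: the number of runs is greatest at the end. -/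
theorem exists_runs_mainProgram (hA : IsMinDFA A) (hL : IsWheelerLanguage A.lang) {K : ℕ}
    (hK : ∀ l ≤ n + n ^ 2, ∀ r R idx, IsRunList A l r R idx → r ≤ K) :
    ∃ m ≤ K, ∀ W, wordBound n σ m ≤ W → ∀ mem, HoldsDFA A mem → ∀ b₁ b₂ b₃ b₇ b₁₈ : ℕ,
      Runs W mainProgram
        ⟨regs [0, b₁, b₂, b₃, 0, 0, 0, b₇, 0, 0, 0, 0, 0, 0, 0, 0, 0, 0, b₁₈, 0, 0, 0], mem⟩
        (mainTime n σ m)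
        fun s => ∃ B : PDFA (Fin σ) (Fin m), IsMinWDFA B A.lang ∧ HasOutput s (encodeDFA B) ∧
          ∃ R idx, IsRunList A (n + n ^ 2) m R idx := by
  let S : Set ℕ := {r | ∃ l ≤ n + n ^ 2, ∃ R idx, IsRunList A l r R idx}
  have hne : S.Nonempty := ⟨1, 0, Nat.zero_le _, fun _ => A.init, _, IsRunList.zero hA.1 rfl⟩
  have hbdd : BddAbove S := ⟨K, fun r ⟨l, hl, R, idx, h⟩ => hK l hl r R idx h⟩
  obtain ⟨l, hl, R, idx, hrun⟩ : sSup S ∈ S := Nat.sSup_mem hne hbdd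
  have hmax : ∀ l ≤ n + n ^ 2, ∀ r R idx, IsRunList A l r R idx → r ≤ sSup S :=
    fun l hl r R idx h => le_csSup hbdd ⟨l, hl, R, idx, h⟩
  refine ⟨sSup S, hK l hl _ R idx hrun, fun W hW mem hmem b₁ b₂ b₃ b₇ b₁₈ => ?_⟩
  obtain ⟨s, t, hex, ht, m, B, hB, hout, R', idx', hrun'⟩ :=
    runs_mainProgram hA hL hmax hW hmem b₁ b₂ b₃ b₇ b₁₈
  obtain rfl : m = sSup S := le_antisymm (hmax _ le_rfl m R' idx' hrun')
    (hrun.le_of_isRunList hrun' hA hL hl (Nat.le_succ _))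
  exact ⟨s, t, hex, ht, B, hB, hout, R', idx', hrun'⟩

theorem loadInput_eq (x : List ℕ) : loadInput x =
    ⟨regs [0, 0, 0, 0, 0, 0, 0, 0, 0, 0, 0, 0, 0, 0, 0, 0, 0, 0, 0, 0, 0, 0], (loadInput x).mem⟩ := by
  have : regs (List.replicate 22 0) = fun _ => 0 := by
    funext i
    rw [regs, List.getD_eq_getElem?_getD, List.getElem?_replicate]
    split_ifs <;> rfl
  rw [show [0, 0, 0, 0, 0, 0, 0, 0, 0, 0, 0, 0, 0, 0, 0, 0, 0, 0, 0, 0, 0, 0] =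
    List.replicate 22 0 from rfl, this]
  rfl

end Bounds

/-! ### The minimum Wheeler DFA from the minimum DFA alone -/

theorem exists_exec_exponential : ∃ (P : Program) (C : ℕ), ∀ (σ n : ℕ) (A : PDFA (Fin σ) (Fin n)),
    IsMinDFA A → IsWheelerLanguage A.lang →
      ∃ (m : ℕ) (B : PDFA (Fin σ) (Fin m)) (s : RAMState) (t : ℕ),
        IsMinWDFA B A.lang ∧ Exec ((σ + 2) ^ (C * n ^ 2)) P (loadInput (encodeDFA A)) s t ∧
        HasOutput s (encodeDFA B) ∧ t ≤ (σ + 2) ^ (C * n ^ 2) := by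
  refine ⟨mainProgram, 12, fun σ n A hA hL => ?_⟩
  have hn : 0 < n := A.init.pos
  obtain ⟨m, hm, h⟩ := exists_runs_mainProgram hA hL (K := (σ + 1) ^ (n + n ^ 2))
    fun l hl r R idx hrun => hrun.le_pow.trans (Nat.pow_le_pow_right (Nat.succ_pos σ) hl)
  -- `n`, `σ ≤ Y` and `m ≤ Y ^ 2`, so that space and time are `O(Y ^ 4)`; as `2 ≤ Y`, the factor
  -- `Y ^ 8` absorbs the constants
  set Y := (σ + 2) ^ n ^ 2 with hY
  have hpow : (σ + 2) ^ (12 * n ^ 2) = Y ^ 12 := by rw [hY, ← pow_mul, Nat.mul_comm]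
  have hn2 : n ≤ n ^ 2 := Nat.le_self_pow two_ne_zero n
  have h2Y : 2 ^ n ^ 2 ≤ Y := Nat.pow_le_pow_left (by omega) _
  have hn2Y : n ^ 2 ≤ Y := Nat.lt_two_pow_self.le.trans h2Y
  have hσY : σ + 2 ≤ Y := by
    have := Nat.pow_le_pow_right (n := σ + 2) (by omega) (show 1 ≤ n ^ 2 by omega)
    rwa [pow_one] at this
  have hmY : m ≤ Y ^ 2 := by
    refine hm.trans ((Nat.pow_le_pow_left (Nat.le_succ (σ + 1)) _).trans ?_)
    rw [hY, ← pow_mul]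
    exact Nat.pow_le_pow_right (by omega) (by omega)
  have hmσ : m * σ ≤ Y ^ 3 := by
    calc m * σ ≤ Y ^ 2 * Y := Nat.mul_le_mul hmY (by omega)
      _ = Y ^ 3 := by ring
  have hnσ : n * σ ≤ Y ^ 2 := by
    calc n * σ ≤ Y * Y := Nat.mul_le_mul (by omega) (by omega)
      _ = Y ^ 2 := by ring
  have hY2 : 2 ≤ Y := by omega
  have h12 : Y ≤ Y ^ 2 := Nat.le_self_pow two_ne_zero Y
  have h23 : Y ^ 2 ≤ Y ^ 3 := Nat.pow_le_pow_right (by omega) (by omega)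
  have h34 : Y ^ 3 ≤ Y ^ 4 := Nat.pow_le_pow_right (by omega) (by omega)
  have h412 : 256 * Y ^ 4 ≤ Y ^ 12 := by
    have : 2 ^ 8 ≤ Y ^ 8 := Nat.pow_le_pow_left hY2 8
    calc 256 * Y ^ 4 ≤ Y ^ 8 * Y ^ 4 := Nat.mul_le_mul_right _ this
      _ = Y ^ 12 := by ring
  have hword : wordBound n σ m ≤ Y ^ 12 := by
    have : (n + n ^ 2 + 1) * (2 * m + 3 + 2 * (m * σ)) ≤ 3 * Y * (7 * Y ^ 3) :=
      Nat.mul_le_mul (by omega) (by omega)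
    rw [show 3 * Y * (7 * Y ^ 3) = 21 * Y ^ 4 by ring] at this
    rw [wordBound]
    omega
  have htime : mainTime n σ m ≤ Y ^ 12 := by
    have h1 : σ * (m * 25 + 7) = 25 * (m * σ) + 7 * σ := by ring
    have : (n + n ^ 2) * (σ * (m * 25 + 7) + 16) ≤ 2 * Y * (48 * Y ^ 3) :=
      Nat.mul_le_mul (by omega) (by omega)
    rw [show 2 * Y * (48 * Y ^ 3) = 96 * Y ^ 4 by ring] at this
    rw [mainTime]
    omega
  have hmem := holdsDFA_loadInput A []
  rw [List.append_nil] at hmem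
  obtain ⟨s, t, hex, ht, B, hB, hout, -⟩ := h _ hword _ hmem 0 0 0 0 0
  rw [← loadInput_eq] at hex
  rw [hpow]
  exact ⟨m, B, s, t, hB, hex, hout, ht.trans htime⟩

/-! ### The minimum Wheeler DFA from the minimum DFA and the sorted list -/

section List

variable {σ n k : ℕ} {A : PDFA (Fin σ) (Fin n)} {w : Fin k → List (Fin σ)}

/-- If the language consists of the empty word only, its minimum DFA is the minimum Wheeler DFA. -/
theorem isMinWDFA_of_no_letter (hA : IsBasic A.toNFA)
    (h : ∀ a : Fin σ, [a] ∉ prefixes A.lang) : IsMinWDFA A A.lang := by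
  have hnil : ∀ u ∈ prefixes A.lang, u = [] := by
    rintro (_ | ⟨a, u⟩) hu
    · rfl
    · exact absurd (prefixes_of_append (u := [a]) hu) (h a)
  have hmap : IsClassMap A A.lang fun _ => A.init := by
    refine ⟨rfl, fun u a hu => absurd (hnil _ hu) (by simp), fun u a hu _ => ?_, fun u hu => ?_,
      fun q => ?_, fun _ _ _ _ _ => le_rfl, fun u hu v hv _ => by rw [hnil u hu, hnil v hv]⟩
    · rcases hs : A.step A.init a with _ | q
      · rfl
      · have hq : A.run ([] ++ [a]) = some q := by
          rw [PDFA.run_concat, PDFA.run_nil, Option.bind_some, hs]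
        exact absurd (PDFA.mem_prefixes_of_run_eq_some hA hq) (h a)
    · rw [hnil u hu, PDFA.mem_lang_iff]
      simp [PDFA.AcceptsFrom, PDFA.runFrom]
    · obtain ⟨u, hu⟩ := ((PDFA.isBasic_toNFA_iff.1 hA) q).1
      have hu' := PDFA.mem_prefixes_of_run_eq_some hA hu
      refine ⟨u, hu', ?_⟩
      rw [hnil u hu', PDFA.run_nil, Option.some_inj] at hu
      exact hu
  exact hmap.isMinWDFA fun _ _ _ _ _ => rfl

theorem IsSortedList.injective {d : ℕ} (hw : IsSortedList A.lang d w) : Function.Injective w := by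
  intro i j hij
  by_contra hne
  rcases lt_or_gt_of_ne hne with h | h
  · exact (hw.1 i j h).ne hij
  · exact (hw.1 j i h).ne hij.symm

/-- There are at most as many runs as words in the list; this bounds the space of `mainProgram` in
terms of the length of the input. -/
theorem IsSortedList.isRunList_le {d l r : ℕ} {R : ℕ → ℕ} {idx : List (Fin σ) → ℕ}
    (hw : IsSortedList A.lang d w) (hl : l ≤ d) (h : IsRunList A l r R idx) : r ≤ k := by
  have hmem : ∀ u ∈ prefixesUpTo A.lang l, ∃ i, w i = u := fun u hu => by
    have : u ∈ prefixesUpTo A.lang d := ⟨hu.1, hu.2.trans hl⟩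
    rwa [← hw.2] at this
  have hu : ∀ j : Fin r, ∃ i : Fin k, w i ∈ prefixesUpTo A.lang l ∧ idx (w i) = j := fun j => by
    obtain ⟨u, hu, hj⟩ := h.onto j j.isLt
    obtain ⟨i, rfl⟩ := hmem u hu
    exact ⟨i, hu, hj⟩
  choose i hi hij using hu
  have hinj : Function.Injective i := fun j j' hjj => by
    apply Fin.ext
    rw [← hij, ← hij, hjj]
  simpa using Fintype.card_le_of_injective _ hinj

/-- Read the length `k` of the sorted list: if it is `1`, the input is its own output, otherwise run
`mainProgram`, which does not need the list.  The distinction is needed because `m * log m = 0` for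
`m = 1`, so that only constant time is available. -/
def listProgram : Program :=
  .seq (block [(1, .const 1), (7, .const 3), (2, .load 6), (3, .load 1), (18, .mul 2 3),
    (18, .add 18 2), (18, .add 18 7), (18, .load 18)]) (.ite (.eq 18 1) .skip mainProgram)

theorem length_encodeWords (w : Fin k → List (Fin σ)) : k + 2 ≤ (encodeWords w).length := by
  simp [encodeWords]

theorem loadInput_encodeWords (A : PDFA (Fin σ) (Fin n)) (w : Fin k → List (Fin σ)) :
    (loadInput (encodeDFA A ++ encodeWords w)).mem (n * σ + n + 3) = k := by
  change (encodeDFA A ++ encodeWords w).getD _ 0 = k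
  have hlen := length_encodeDFA A
  rw [List.getD_eq_getElem?_getD, List.getElem?_append_right (by omega),
    show n * σ + n + 3 - (encodeDFA A).length = 0 by omega]
  rfl

/-- Numbers of `O(log N)` bits suffice. -/
theorem wordBound_le_pow {N m : ℕ} (hn : n ≤ N) (hσ : σ ≤ N) (hm : m ≤ N)
    (hnσ : 3 + n + n * σ ≤ N) : wordBound n σ m ≤ (N + 2) ^ 6 := by
  have h1 : n + n ^ 2 + 1 ≤ (N + 2) ^ 2 := by nlinarith
  have h2 : 2 * m + 3 + 2 * (m * σ) ≤ 3 * (N + 2) ^ 2 := by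
    have : m * σ ≤ N * N := Nat.mul_le_mul hm hσ
    nlinarith
  have h3 := Nat.mul_le_mul h1 h2
  have h4 : 4 * (N + 2) ^ 4 ≤ (N + 2) ^ 6 := by
    have : 2 ^ 2 ≤ (N + 2) ^ 2 := Nat.pow_le_pow_left (by omega) 2
    calc 4 * (N + 2) ^ 4 ≤ (N + 2) ^ 2 * (N + 2) ^ 4 := Nat.mul_le_mul_right _ this
      _ = (N + 2) ^ 6 := by ring
  have h5 : (N + 2) * 2 ^ 3 ≤ (N + 2) ^ 4 := by
    rw [pow_succ' (N + 2) 3]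
    exact Nat.mul_le_mul_left _ (Nat.pow_le_pow_left (by omega) 3)
  rw [show (N + 2) ^ 2 * (3 * (N + 2) ^ 2) = 3 * (N + 2) ^ 4 by ring] at h3
  rw [wordBound]
  omega

theorem mainTime_add_le {m : ℕ} (hn : 1 ≤ n) (hσ : 1 ≤ σ) (hm : 2 ≤ m) :
    ((mainTime n σ m + 10 : ℕ) : ℝ) ≤ 250 * ((n : ℝ) ^ 2 * σ * (m * Real.log m)) := by
  have hX : mainTime n σ m + 10 ≤ 150 * (n ^ 2 * σ * m) := by
    have h1 : n ≤ n ^ 2 := Nat.le_self_pow two_ne_zero n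
    have h2 : σ * (m * 25 + 7) + 16 ≤ 48 * (σ * m) := by nlinarith
    have h3 : (n + n ^ 2) * (σ * (m * 25 + 7) + 16) ≤ 2 * n ^ 2 * (48 * (σ * m)) :=
      Nat.mul_le_mul (by omega) h2
    have h4 : m ≤ n ^ 2 * σ * m := Nat.le_mul_of_pos_left m (by positivity)
    rw [show 2 * n ^ 2 * (48 * (σ * m)) = 96 * (n ^ 2 * σ * m) by ring] at h3
    rw [mainTime]
    omega
  -- as `2 ≤ m`, the factor `log m` is bounded below, and `150 ≤ 250 * (5 / 8)`
  have hlog : (5 : ℝ) / 8 ≤ Real.log m := by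
    have h1 : Real.log 2 ≤ Real.log m := Real.log_le_log (by norm_num) (by exact_mod_cast hm)
    have := Real.log_two_gt_d9
    linarith
  have hpos : (0 : ℝ) ≤ (n : ℝ) ^ 2 * σ * m := by positivity
  calc ((mainTime n σ m + 10 : ℕ) : ℝ) ≤ ((150 * (n ^ 2 * σ * m) : ℕ) : ℝ) := by exact_mod_cast hX
    _ = 150 * ((n : ℝ) ^ 2 * σ * m) := by push_cast; ring
    _ ≤ 250 * (((n : ℝ) ^ 2 * σ * m) * Real.log m) := by nlinarith
    _ = 250 * ((n : ℝ) ^ 2 * σ * (m * Real.log m)) := by ring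

end List

theorem exists_exec_list : ∃ (P : Program) (C : ℕ), ∀ (σ n k : ℕ) (A : PDFA (Fin σ) (Fin n))
    (w : Fin k → List (Fin σ)),
    IsMinDFA A → IsWheelerLanguage A.lang → IsSortedList A.lang (n + n ^ 2) w →
      ∃ (m : ℕ) (B : PDFA (Fin σ) (Fin m)) (s : RAMState) (t : ℕ),
        IsMinWDFA B A.lang ∧
        Exec (((encodeDFA A ++ encodeWords w).length + 2) ^ C) P
          (loadInput (encodeDFA A ++ encodeWords w)) s t ∧
        HasOutput s (encodeDFA B) ∧
        (t : ℝ) ≤ C * (k + (n : ℝ) ^ 2 * σ * (m * Real.log m)) := by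
  refine ⟨listProgram, 250, fun σ n k A w hA hL hw => ?_⟩
  have hn : 0 < n := A.init.pos
  have hlog : 0 ≤ (n : ℝ) ^ 2 * σ * (n * Real.log n) :=
    mul_nonneg (by positivity) (mul_nonneg (by positivity) (Real.log_natCast_nonneg n))
  have hmem := holdsDFA_loadInput A (encodeWords w)
  have hk := loadInput_encodeWords A w
  rw [loadInput_eq]
  set mem := (loadInput (encodeDFA A ++ encodeWords w)).mem
  set N := (encodeDFA A ++ encodeWords w).length with hN
  have hNle : 3 + n + n * σ + (k + 2) ≤ N := by
    have := length_encodeWords w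
    rw [hN, List.length_append, length_encodeDFA]
    omega
  have hσN : σ ≤ n * σ := Nat.le_mul_of_pos_left σ hn
  have hNW : N ≤ (N + 2) ^ 250 := by
    calc N ≤ N + 2 := by omega
      _ ≤ (N + 2) ^ 250 := Nat.le_self_pow (by norm_num) _
  have e0 := hmem.states
  have e1 := hmem.letters
  generalize hW : (N + 2) ^ 250 = W at *
  have hstart : ∀ {Q : RAMState → Prop} {T : ℕ}, Runs W (.ite (.eq 18 1) .skip mainProgram)
      ⟨regs [0, 1, n, σ, 0, 0, 0, 3, 0, 0, 0, 0, 0, 0, 0, 0, 0, 0, k, 0, 0, 0], mem⟩ T Q →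
      Runs W listProgram
      ⟨regs [0, 0, 0, 0, 0, 0, 0, 0, 0, 0, 0, 0, 0, 0, 0, 0, 0, 0, 0, 0, 0, 0], mem⟩ (9 + T) Q := by
    intro Q T h
    refine runs_block_seq (p := [_, _, _, _, _, _, _, _]) ?_ ?_
    · simp [SafeBlock, Rhs.eval, regs, e0, e1, hk]
      omega
    · convert h using 1
      simp [evalBlock, Rhs.eval, regs, e0, e1, hk]
  have hnil : [] ∈ prefixesUpTo A.lang (n + n ^ 2) := ⟨nil_mem_prefixes A hA.1, Nat.zero_le _⟩
  obtain ⟨i₀, hi₀⟩ : ∃ i, w i = [] := by rwa [← hw.2] at hnil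
  by_cases hk1 : k = 1
  · obtain ⟨s, t, hex, ht, rfl⟩ := hstart (T := 2) (Q := fun s => s =
      ⟨regs [0, 1, n, σ, 0, 0, 0, 3, 0, 0, 0, 0, 0, 0, 0, 0, 0, 0, k, 0, 0, 0], mem⟩)
      (runs_ite (T := 1) (fun _ => runs_skip rfl) fun h => absurd hk1 h)
    refine ⟨n, A, _, t, isMinWDFA_of_no_letter hA.1 fun a ha => ?_, hex, hasOutput_encodeDFA ?_, ?_⟩
    · have : [a] ∈ prefixesUpTo A.lang (n + n ^ 2) := ⟨ha, by simp; omega⟩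
      rw [← hw.2] at this
      obtain ⟨i, hi⟩ := this
      subst hk1
      rw [Subsingleton.elim i i₀, hi₀] at hi
      cases hi
    · change HoldsDFA A fun i => mem (0 + i)
      simpa using hmem
    · have ht' : (t : ℝ) ≤ 11 := by exact_mod_cast ht
      subst hk1
      push_cast
      linarith
  · obtain ⟨m, hm, h⟩ := exists_runs_mainProgram hA hL (K := k)
      fun l hl r R idx hrun => hw.isRunList_le hl hrun
    have hword : wordBound n σ m ≤ W := by
      rw [← hW]
      exact (wordBound_le_pow (by omega) (by omega) (by omega) (by omega)).trans
        (Nat.pow_le_pow_right (by omega) (by norm_num))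
    obtain ⟨s, t, hex, ht, B, hB, hout, R, idx, hrun⟩ := hstart (T := 1 + mainTime n σ m)
      (runs_ite (fun h => absurd h hk1) fun _ => h W hword mem hmem 1 n σ 3 k)
    -- a nonempty word in the list: it is not in the run of the empty word, so `2 ≤ m`
    obtain ⟨i, hi⟩ : ∃ i, i ≠ i₀ := by
      by_contra hcon
      push Not at hcon
      have : Fintype.card (Fin k) ≤ 1 := Fintype.card_le_one_iff.2 fun a b => by
        rw [hcon a, hcon b]
      have := i₀.pos
      simp only [Fintype.card_fin] at *
      omega
    have hwi : w i ≠ [] := fun h => hi (hw.injective (h.trans hi₀.symm))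
    have hmi : w i ∈ prefixesUpTo A.lang (n + n ^ 2) := hw.2 ▸ Set.mem_range_self i
    have hσ : 1 ≤ σ := ((w i).head hwi).pos
    have hm2 : 2 ≤ m := by
      have h1 := hrun.lt _ hmi
      have h2 := hrun.lt _ hnil
      by_contra hcon
      have := hrun.last _ hmi _ hnil (by omega)
      simp [hwi] at this
    refine ⟨m, B, s, t, hB, hex, hout, ?_⟩
    have h1 := mainTime_add_le hn hσ hm2
    have h2 : (t : ℝ) ≤ ((mainTime n σ m + 10 : ℕ) : ℝ) := by
      exact_mod_cast (show t ≤ mainTime n σ m + 10 by omega)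
    have h3 : (0 : ℝ) ≤ k := Nat.cast_nonneg k
    push_cast at *
    linarith

end WheelerDFA

open WheelerDFA in
theorem proposition4 :
    -- the boundaries of the sorted list are representatives, one for each class
    (∀ (σ n k : ℕ) (A : PDFA (Fin σ) (Fin n)) (w : Fin k → List (Fin σ)),
      IsMinDFA A → IsWheelerLanguage A.lang → IsSortedList A.lang (n + n ^ 2) w →
        ∀ u ∈ prefixes A.lang, ∃! i : Fin k, IsBoundary A.lang w i ∧ ConvexEquiv A.lang (w i) u) ∧
    -- the minimum Wheeler DFA from the minimum DFA and the sorted list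
    (∃ (P : Program) (C : ℕ), ∀ (σ n k : ℕ) (A : PDFA (Fin σ) (Fin n))
      (w : Fin k → List (Fin σ)),
      IsMinDFA A → IsWheelerLanguage A.lang → IsSortedList A.lang (n + n ^ 2) w →
        ∃ (m : ℕ) (B : PDFA (Fin σ) (Fin m)) (s : RAMState) (t : ℕ),
          IsMinWDFA B A.lang ∧
          Exec (((encodeDFA A ++ encodeWords w).length + 2) ^ C) P
            (loadInput (encodeDFA A ++ encodeWords w)) s t ∧
          HasOutput s (encodeDFA B) ∧
          (t : ℝ) ≤ C * (k + (n : ℝ) ^ 2 * σ * (m * Real.log m))) ∧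
    -- the minimum Wheeler DFA from the minimum DFA alone, in exponential time
    (∃ (P : Program) (C : ℕ), ∀ (σ n : ℕ) (A : PDFA (Fin σ) (Fin n)),
      IsMinDFA A → IsWheelerLanguage A.lang →
        ∃ (m : ℕ) (B : PDFA (Fin σ) (Fin m)) (s : RAMState) (t : ℕ),
          IsMinWDFA B A.lang ∧
          Exec ((σ + 2) ^ (C * n ^ 2)) P (loadInput (encodeDFA A)) s t ∧
          HasOutput s (encodeDFA B) ∧
          t ≤ (σ + 2) ^ (C * n ^ 2)) ∧
    -- exponential time is unavoidable, since the output can be exponentially large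
    (∃ σ c : ℕ, ∀ r : ℕ, ∃ (n : ℕ) (A : PDFA (Fin σ) (Fin n)),
      n ≤ c * (r + 1) ∧ IsMinDFA A ∧ IsWheelerLanguage A.lang ∧
        ∀ (m : ℕ) (B : PDFA (Fin σ) (Fin m)), IsMinWDFA B A.lang → 2 ^ r ≤ m) := by
  refine ⟨fun σ n k A w _ hL hw u hu => existsUnique_boundary hL hw hu, exists_exec_list,
    exists_exec_exponential, 2, 4, fun r => ⟨2 * r + 4, sandwich r, by omega, sandwich.isMinDFA,
      sandwich.isWheelerLanguage, fun m B hB => sandwich.two_pow_le hB.2.1 hB.2.2.1⟩⟩
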